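/- Let $\mathbb{F}$ be an algebraically closed field. An affine variety $V\subseteq\mathbb{A}^n=\mathbb{F}^n$ is the (possibly reducible or empty) set of common zeros of a set of polynomials in $\mathbb{F}[X_1,\dots,X_n]$. Its dimension is the maximal $r$ for which there is a chain $V_0\subsetneq V_1\subsetneq\dots\subsetneq V_r$ of irreducible subvarieties of $V$ ($-\infty$ if $V=\emptyset$). The degree of an irreducible $V$ is the number of points in which $V$ meets an affine subspace of codimension $\dim V$ in general position, and the degree of an arbitrary $V$ is the sum of the degrees of its irreducible components. A polynomial map $\varphi:\mathbb{A}^n\to\mathbb{A}^m$, $1\le m\le n$, is an $(n,m,k,d)$ deterministic rank condenser for varieties if $\dim\overline{\varphi(V)}=\dim V$ (Zariski closure) for every affine variety $V\subseteq\mathbb{A}^n$ of dimension at most $k$ and degree at most $d$; if $k=m$ it is called an $(n,m,d)$ deterministic rank extractor. (1) Let $n,d\ge 1$ and $m,k\in\{1,\dots,n\}$, let $d_1,\dots,d_n>d$ be pairwise coprime integers, and let $M=(c_{i,j})\in\mathbb{F}^{m\times n}$ be $k$-regular, i.e. any $k$ distinct columns of $M$ are linearly independent. Let $$\varphi:\mathbb{A}^n\to\mathbb{A}^m,\qquad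 \varphi(a)=\Big(\sum_{j=1}^n c_{i,j}a_j^{d_j}\Big)_{i=1}^m .$$ Then for every affine variety $V\subseteq\mathbb{A}^n$ of dimension at most $k$ and degree at most $d$ and every $b\in\mathbb{A}^m$, the fiber $\varphi^{-1}(b)\cap V$ is finite. Moreover $\varphi$ is an $(n,m,k,d)$ deterministic rank condenser; in particular, if $m=k$, it is an $(n,m,d)$ deterministic rank extractor. (2) There are an absolute constant $C$ and an algorithm that, given $n,d\ge1$ and $m\in\{1,n-1,n\}$ with $m\ge 1$, outputs sparse representations of integer polynomials $f_1,\dots,f_m$ of the form $f_i=\sum_{j=1}^n c_{i,j}X_j^{d_j}$, where $d_1,\dots,d_n>d$ are pairwise coprime, such that all coefficients of the $f_i$ lie in $\{0,1,-1\}$ and, over every algebraically closed field $\mathbb{F}$, $(f_1,\dots,f_m)$ defines an $(n,m,d)$ deterministic rank extractor. The degrees satisfy $\deg f_i\le C(n+d)\log_2(n+d)$ and the running time is at most $C(n+d)^C$. (3) The same holds, with another algorithm and constant $C$, with running time at most $C(n+\lfloor\log_2 d\rfloor)^C$ and degrees $\deg f_i\le C\,nd\log_2(n+1)$. Running times are measured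 on a random access machine with logarithmic (bit) cost. -/

import Mathlib

universe u

noncomputable section

namespace RankExtractor

section Varieties

variable {F : Type u} [Field F] {n m : ℕ}

/-- Affine varieties in affine `n`-space over an algebraically closed field: the sets of common
zeros of sets (equivalently, ideals) of polynomials. They may be reducible or empty. -/
def IsAffineVariety (V : Set (Fin n → F)) : Prop :=
  ∃ I : Ideal (MvPolynomial (Fin n) F), V = MvPolynomial.zeroLocus F I

/-- Irreducible affine varieties; the empty set is not irreducible. -/
def IsIrreducibleVariety (V : Set (Fin n → F)) : Prop :=
  IsAffineVariety V ∧ V.Nonempty ∧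
    ∀ A B : Set (Fin n → F), IsAffineVariety A → IsAffineVariety B →
      V = A ∪ B → V = A ∨ V = B

/-- The irreducible components of `V`: the maximal irreducible subvarieties. -/
def components (V : Set (Fin n → F)) : Set (Set (Fin n → F)) :=
  {W | Maximal (fun W' => IsIrreducibleVariety W' ∧ W' ⊆ V) W}

/-- The dimension of `V`: the supremum of the lengths `r` of chains `V₀ ⊊ V₁ ⊊ ⋯ ⊊ Vᵣ` of
irreducible subvarieties of `V` (with value `⊥` for the empty variety). -/
def dim (V : Set (Fin n → F)) : WithBot ℕ∞ :=
  Order.krullDim {W : Set (Fin n → F) // IsIrreducibleVariety W ∧ W ⊆ V}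

/-- `D` is the number of intersection points of `V` with an affine subspace of codimension
`dim V` in general position: outside of a proper closed subset (contained in `G = 0`) of the
space of all `(A, b)`, the subspace `A x = b` of codimension `dim V` meets `V` in exactly `D`
points. -/
def IsGenericSectionNumber (V : Set (Fin n → F)) (D : ℕ∞) : Prop :=
  ∃ r : ℕ, dim V = r ∧ ∃ G : MvPolynomial ((Fin r × Fin n) ⊕ Fin r) F, G ≠ 0 ∧
    ∀ (A : Matrix (Fin r) (Fin n) F) (b : Fin r → F), LinearIndependent F A.row →
      MvPolynomial.eval (Sum.elim (fun p => A p.1 p.2) b) G ≠ 0 →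
        (V ∩ {x | A.mulVec x = b}).encard = D

/-- The degree of an irreducible variety. (Over an algebraically closed field there is exactly
one generic section number, so the infimum is over a singleton.) -/
def irreducibleDegree (V : Set (Fin n → F)) : ℕ∞ :=
  sInf {D | IsGenericSectionNumber V D}

/-- The degree of an affine variety: the sum of the degrees of its (finitely many) irreducible
components, of whatever dimensions. -/
def degree (V : Set (Fin n → F)) : ℕ∞ :=
  ∑ᶠ W ∈ components V, irreducibleDegree W

/-- The Zariski closure. -/
def zariskiClosure (S : Set (Fin n → F)) : Set (Fin n → F) :=
  MvPolynomial.zeroLocus F (MvPolynomial.vanishingIdeal F S)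

/-- The polynomial map from affine `n`-space to affine `m`-space defined by `f₁, …, fₘ`. -/
def polyMap (f : Fin m → MvPolynomial (Fin n) F) (a : Fin n → F) : Fin m → F :=
  fun i => MvPolynomial.eval a (f i)

/-- `(n, m, k, d)` deterministic (lossless) rank condensers for varieties. -/
def IsRankCondenser (k d : ℕ) (f : Fin m → MvPolynomial (Fin n) F) : Prop :=
  ∀ V : Set (Fin n → F), IsAffineVariety V → dim V ≤ (k : WithBot ℕ∞) → degree V ≤ (d : ℕ∞) →
    dim (zariskiClosure (polyMap f '' V)) = dim V

/-- `(n, m, d)` deterministic (lossless) rank extractors for varieties. -/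
def IsRankExtractor (d : ℕ) (f : Fin m → MvPolynomial (Fin n) F) : Prop :=
  IsRankCondenser m d f

/-- A matrix is `k`-regular if any `k` distinct columns are linearly independent. -/
def IsRegularMatrix (k : ℕ) (M : Matrix (Fin m) (Fin n) F) : Prop :=
  ∀ s : Finset (Fin n), s.card = k → LinearIndependent F (fun j : s => M.col j)

end Varieties

/-- The polynomials `∑ⱼ c i j * Xⱼ ^ eⱼ`. -/
def diagonalPolys {R : Type u} [CommRing R] {n m : ℕ} (c : Matrix (Fin m) (Fin n) R)
    (e : Fin n → ℕ) : Fin m → MvPolynomial (Fin n) R :=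
  fun i => ∑ j, MvPolynomial.C (c i j) * MvPolynomial.X j ^ e j

section Machine

/-! Random access machines with logarithmic (bit) cost, programmed in structured form. -/

/-- Programs. Registers are numbered by naturals and hold naturals; `load` and `store` are the
instructions with indirect addressing, `write` appends to a write-only output tape. -/
inductive Program : Type
  | skip : Program
  | const (dst value : ℕ) : Program
  | add (dst a b : ℕ) : Program
  | sub (dst a b : ℕ) : Program
  | mul (dst a b : ℕ) : Program
  | div (dst a b : ℕ) : Program
  | mod (dst a b : ℕ) : Program
  | load (dst addr : ℕ) : Program
  | store (addr src : ℕ) : Program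
  | write (src : ℕ) : Program
  | seq (p q : Program) : Program
  | ifNonzero (test : ℕ) (p q : Program) : Program
  | whileNonzero (test : ℕ) (body : Program) : Program

/-- A machine state: contents of the registers and of the output tape. -/
structure State : Type where
  mem : ℕ → ℕ
  out : List ℕ

/-- The state after writing `v` into register `r`. -/
def State.set (s : State) (r v : ℕ) : State :=
  ⟨Function.update s.mem r v, s.out⟩

/-- The cost of handling the number `x`: the length of its binary expansion, plus one. -/
def bitCost (x : ℕ) : ℕ := x.size + 1

/-- `Exec p s s' t`: started in the state `s`, the program `p` halts in the state `s'`, and the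
total logarithmic cost of the executed instructions is `t`. -/
inductive Exec : Program → State → State → ℕ → Prop
  | skip (s : State) : Exec .skip s s 1
  | const (s : State) (dst v : ℕ) : Exec (.const dst v) s (s.set dst v) (bitCost v)
  | add (s : State) (dst a b : ℕ) :
      Exec (.add dst a b) s (s.set dst (s.mem a + s.mem b)) (bitCost (s.mem a) + bitCost (s.mem b))
  | sub (s : State) (dst a b : ℕ) :
      Exec (.sub dst a b) s (s.set dst (s.mem a - s.mem b)) (bitCost (s.mem a) + bitCost (s.mem b))
  | mul (s : State) (dst a b : ℕ) :
      Exec (.mul dst a b) s (s.set dst (s.mem a * s.mem b)) (bitCost (s.mem a) + bitCost (s.mem b))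
  | div (s : State) (dst a b : ℕ) :
      Exec (.div dst a b) s (s.set dst (s.mem a / s.mem b)) (bitCost (s.mem a) + bitCost (s.mem b))
  | mod (s : State) (dst a b : ℕ) :
      Exec (.mod dst a b) s (s.set dst (s.mem a % s.mem b)) (bitCost (s.mem a) + bitCost (s.mem b))
  | load (s : State) (dst addr : ℕ) :
      Exec (.load dst addr) s (s.set dst (s.mem (s.mem addr)))
        (bitCost (s.mem addr) + bitCost (s.mem (s.mem addr)))
  | store (s : State) (addr src : ℕ) :
      Exec (.store addr src) s (s.set (s.mem addr) (s.mem src))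
        (bitCost (s.mem addr) + bitCost (s.mem src))
  | write (s : State) (src : ℕ) :
      Exec (.write src) s ⟨s.mem, s.out ++ [s.mem src]⟩ (bitCost (s.mem src))
  | seq (p q : Program) (s s' s'' : State) (t t' : ℕ) :
      Exec p s s' t → Exec q s' s'' t' → Exec (.seq p q) s s'' (t + t')
  | ifTrue (r : ℕ) (p q : Program) (s s' : State) (t : ℕ) :
      s.mem r ≠ 0 → Exec p s s' t → Exec (.ifNonzero r p q) s s' (bitCost (s.mem r) + t)
  | ifFalse (r : ℕ) (p q : Program) (s s' : State) (t : ℕ) :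
      s.mem r = 0 → Exec q s s' t → Exec (.ifNonzero r p q) s s' (bitCost (s.mem r) + t)
  | whileStep (r : ℕ) (p : Program) (s s' s'' : State) (t t' : ℕ) :
      s.mem r ≠ 0 → Exec p s s' t → Exec (.whileNonzero r p) s' s'' t' →
        Exec (.whileNonzero r p) s s'' (bitCost (s.mem r) + t + t')
  | whileDone (r : ℕ) (p : Program) (s : State) :
      s.mem r = 0 → Exec (.whileNonzero r p) s s (bitCost (s.mem r))

/-- The initial state: the input in the first registers, zero in all others, no output. -/
def initState (input : List ℕ) : State :=
  ⟨fun r => input.getD r 0, []⟩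

/-- On the given input, the program halts with the given output, in time (cost) at most `T`. -/
def OutputsInTime (p : Program) (input output : List ℕ) (T : ℕ) : Prop :=
  ∃ (s : State) (t : ℕ), Exec p (initState input) s t ∧ s.out = output ∧ t ≤ T

end Machine

section SparseRepresentation

variable {n m : ℕ}

/-- A sparse representation of `p`: a list of its nonzero terms (exponent vector, coefficient),
in some order, without repetition. -/
def IsSparseRep (p : MvPolynomial (Fin n) ℤ) (l : List ((Fin n →₀ ℕ) × ℤ)) : Prop :=
  (l.map Prod.fst).Nodup ∧ (∀ t ∈ l, t.2 ≠ 0) ∧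
    (l.map fun t => MvPolynomial.monomial t.1 t.2).sum = p

/-- A term is written as sign (`1` if negative), absolute value of the coefficient, and the `n`
exponents. -/
def encodeTerm (t : (Fin n →₀ ℕ) × ℤ) : List ℕ :=
  [if t.2 < 0 then 1 else 0, t.2.natAbs] ++ List.ofFn (fun j => t.1 j)

/-- A list of terms is written as the number of the terms followed by the terms. -/
def encodeTerms (l : List ((Fin n →₀ ℕ) × ℤ)) : List ℕ :=
  l.length :: l.flatMap encodeTerm

/-- `w` consists of sparse representations of `f₁, …, fₘ`, one after the other. -/
def IsSparseEncoding (f : Fin m → MvPolynomial (Fin n) ℤ) (w : List ℕ) : Prop :=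
  ∃ l : Fin m → List ((Fin n →₀ ℕ) × ℤ), (∀ i, IsSparseRep (f i) (l i)) ∧
    w = (List.ofFn l).flatMap encodeTerms

end SparseRepresentation

/-- The program `prog` is an explicit construction of `(n, m, d)` deterministic rank extractors
for all `n, d ≥ 1` and all `m ∈ {1, n - 1, n}`, `m ≥ 1`, with degrees at most `degBound n d` and
in time at most `timeBound n d`. On input `(n, m, d)` it writes sparse representations of
polynomials `fᵢ = ∑ⱼ cᵢⱼ Xⱼ ^ eⱼ` with all coefficients in `{0, 1, -1}` and pairwise coprime
exponents `eⱼ > d`, which define a rank extractor over every algebraically closed field. -/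
def IsExplicitExtractorConstruction (prog : Program) (degBound : ℕ → ℕ → ℝ)
    (timeBound : ℕ → ℕ → ℕ) : Prop :=
  ∀ n m d : ℕ, 1 ≤ n → 1 ≤ d → 1 ≤ m → (m = 1 ∨ m + 1 = n ∨ m = n) →
    ∃ (c : Matrix (Fin m) (Fin n) ℤ) (e : Fin n → ℕ) (w : List ℕ),
      (∀ i j, c i j = 0 ∨ c i j = 1 ∨ c i j = -1) ∧
      (∀ j, d < e j) ∧ Pairwise (fun j j' => Nat.Coprime (e j) (e j')) ∧
      (∀ i s, (diagonalPolys c e i).coeff s = 0 ∨ (diagonalPolys c e i).coeff s = 1 ∨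
        (diagonalPolys c e i).coeff s = -1) ∧
      (∀ i, ((diagonalPolys c e i).totalDegree : ℝ) ≤ degBound n d) ∧
      IsSparseEncoding (diagonalPolys c e) w ∧
      OutputsInTime prog [n, m, d] w (timeBound n d) ∧
      ∀ (F : Type u) [Field F] [IsAlgClosed F],
        IsRankExtractor d
          (fun i => MvPolynomial.map (Int.castRingHom F) (diagonalPolys c e i))

end RankExtractor

end

noncomputable section

namespace RankExtractor

/-! ### Krull dimension and transcendence degree -/

/-! Part (1) follows from a stronger fact: on a variety `V` as in the theorem, every coordinate is
integral over the algebra generated by the components of `φ` (`IsIntegralOn`). Integrality gives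
finite fibers at once. It also makes the coordinate ring of `V` an integral extension of that of the
closure of `φ(V)`, so the two Krull dimensions agree. Products of monic polynomials reduce the claim
to irreducible components.

Let `W` be irreducible of dimension `r ≤ k` and degree at most `d`. Two ingredients give
integrality.

Relations of low degree (`exists_relation_of_isGenericSectionNumber`). Any `r + 1` coordinates
satisfy on `W` a nonzero polynomial of degree at most `d` in each variable. For generic linear forms
`y₀, …, yᵣ`, a relation `P` of minimal total degree is irreducible with some nonzero partial
derivative. After a generic shear `zᵢ = yᵢ₊₁ + vᵢ y₀` it becomes, up to a scalar, the separable
minimal polynomial of `y₀` over `F[z]`. A generic point `b` then has `deg P` different values of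
`y₀` above it, each extending to a point of `W`. These points lie in a linear section of codimension
`r`, so `deg P` is at most the degree of `W`. The existence of a relation in a fixed box of
exponents means that determinants of monomial values vanish. This is a closed condition on the
linear forms, so it passes from generic forms to coordinates.

Valuations (`mem_valuationSubring_of_diagonal`). The integral closure is an intersection of
valuation rings. Suppose that a valuation ring contains `F` and all components of `φ`, but not every
coordinate `xⱼ`. Let `w > 1` be the maximum of the values of the `xⱼ ^ eⱼ`, attained for `j ∈ S`. If
`S` had at most `k` elements, regularity of the matrix would give a combination of the components of
`φ` in which just one of the terms from `S` survives. Its value would be `w`, although the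
combination is in the valuation ring. So `S` contains `r + 1` indices, whose coordinates satisfy a
relation as above. The monomial `x ^ α` has value "`w` to the power `∑ αᵢ / eᵢ`" with `αᵢ ≤ d < eᵢ`.
As the `eᵢ` are pairwise coprime, these exponents differ for different `α`, so the terms of the
relation have different values and cannot cancel.

For (2) and (3) the matrix is an identity block followed by columns of ones, which is `m`-regular
over every field for the three admissible `m`. The exponents are the first `n` primes exceeding `d`,
respectively the least powers exceeding `d` of the first `n` primes. Chebyshev's bound controls
their size, and a program using trial division is run symbolically with an upper bound on its cost.
-/

/-- Incomparability gives `≤`. Lying over for the head of a chain, followed by going up, gives `≥`.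
-/
theorem ringKrullDim_eq_of_isIntegral (S R : Type*) [CommRing S] [CommRing R] [Algebra S R]
    [Algebra.IsIntegral S R] (hinj : Function.Injective (algebraMap S R)) :
    ringKrullDim R = ringKrullDim S := by
  apply le_antisymm
  · refine Order.krullDim_le_of_strictMono (PrimeSpectrum.comap (algebraMap S R)) ?_
    intro I J hIJ
    exact Ideal.IsIntegral.comap_lt_comap (R := S) (I := I.asIdeal) (J := J.asIdeal) hIJ
  · refine iSup_le fun l => ?_
    obtain ⟨Q, -, hQ, hQc⟩ := Ideal.exists_ideal_over_prime_of_isIntegral (S := R)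
      (RelSeries.head l).asIdeal ⊥ (by
        rw [← RingHom.ker_eq_comap_bot, (RingHom.injective_iff_ker_eq_bot _).1 hinj]
        exact bot_le)
    have : Q.LiesOver (RelSeries.head l).asIdeal := ⟨hQc.symm⟩
    obtain ⟨L, hL, -⟩ := Ideal.exists_ltSeries_of_hasGoingUp l Q
    rw [← hL]
    exact le_iSup (fun p : LTSeries (PrimeSpectrum R) => (p.length : WithBot ℕ∞)) L

/-- Both invariants are read off from one Noether normalization. -/
theorem exists_ringKrullDim_eq_and_trdeg_eq (F R : Type*) [Field F] [CommRing R] [IsDomain R]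
    [Algebra F R] [Algebra.FiniteType F R] :
    ∃ s : ℕ, ringKrullDim R = s ∧ Algebra.trdeg F R = s := by
  obtain ⟨s, g, hinj, hint⟩ := exists_integral_inj_algHom_of_fg F R
  refine ⟨s, ?_, ?_⟩
  · let := g.toRingHom.toAlgebra
    have : Algebra.IsIntegral (MvPolynomial (Fin s) F) R := ⟨hint⟩
    rw [ringKrullDim_eq_of_isIntegral (MvPolynomial (Fin s) F) R hinj]
    simp [ringKrullDim_eq_zero_of_field]
  · have hx : AlgebraicIndependent F (fun i => g (MvPolynomial.X i)) := by
      have := (MvPolynomial.algebraicIndependent_X (Fin s) F).map' hinj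
      exact this
    have halg : Algebra.IsAlgebraic (Algebra.adjoin F
        (Set.range fun i => g (MvPolynomial.X i))) R := by
      have hr : g.range = Algebra.adjoin F (Set.range fun i => g (MvPolynomial.X i)) := by
        rw [← Algebra.map_top, ← MvPolynomial.adjoin_range_X, AlgHom.map_adjoin, ← Set.range_comp]
        rfl
      rw [← hr]
      refine ⟨fun x => IsIntegral.isAlgebraic ?_⟩
      obtain ⟨p, hp, hpx⟩ := hint x
      refine ⟨p.map g.rangeRestrict.toRingHom, hp.map _, ?_⟩
      rw [Polynomial.eval₂_map]
      exact hpx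
    have hb := hx.isTranscendenceBasis_iff_isAlgebraic.2 halg
    have := hb.lift_cardinalMk_eq_trdeg
    simpa using this.symm

/-! ### The dictionary between varieties and ideals -/

section Dictionary

open MvPolynomial

variable {F : Type u} [Field F] {n m : ℕ}

theorem IsAffineVariety.zeroLocus_vanishingIdeal {V : Set (Fin n → F)} (hV : IsAffineVariety V) :
    zeroLocus F (vanishingIdeal F V) = V := by
  obtain ⟨I, rfl⟩ := hV
  refine le_antisymm ?_ (zeroLocus_vanishingIdeal_le _)
  exact zeroLocus_anti_mono (le_vanishingIdeal_zeroLocus I)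

theorem isAffineVariety_zeroLocus (I : Ideal (MvPolynomial (Fin n) F)) :
    IsAffineVariety (zeroLocus F I) := ⟨I, rfl⟩

theorem vanishingIdeal_union (A B : Set (Fin n → F)) :
    vanishingIdeal F (A ∪ B) = vanishingIdeal F A ⊓ vanishingIdeal F B := by
  ext p
  simp only [mem_vanishingIdeal_iff, Ideal.mem_inf, Set.mem_union]
  exact ⟨fun h => ⟨fun x hx => h x (.inl hx), fun x hx => h x (.inr hx)⟩,
    fun h x hx => hx.elim (h.1 x) (h.2 x)⟩

theorem IsIrreducibleVariety.isPrime_vanishingIdeal {V : Set (Fin n → F)}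
    (hV : IsIrreducibleVariety V) : (vanishingIdeal F V).IsPrime := by
  obtain ⟨hV, ⟨x, hx⟩, hirr⟩ := hV
  refine ⟨fun h => ?_, fun {p q} hpq => ?_⟩
  · have : (1 : MvPolynomial (Fin n) F) ∈ vanishingIdeal F V := h ▸ Submodule.mem_top
    simpa using this x hx
  · have key : ∀ f : MvPolynomial (Fin n) F,
        V = zeroLocus F (vanishingIdeal F V ⊔ Ideal.span {f}) → f ∈ vanishingIdeal F V := by
      intro f hf y hy
      rw [hf] at hy
      exact hy f (Ideal.mem_sup_right (Ideal.mem_span_singleton_self f))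
    have hmem : ∀ f : MvPolynomial (Fin n) F, ∀ y ∈ V, aeval y f = 0 →
        y ∈ zeroLocus F (vanishingIdeal F V ⊔ Ideal.span {f}) := by
      intro f y hy hfy g hg
      obtain ⟨a, ha, b, hb, rfl⟩ := Submodule.mem_sup.1 hg
      obtain ⟨c, rfl⟩ := Ideal.mem_span_singleton.1 hb
      rw [map_add, map_mul, ha y hy, hfy, zero_mul, add_zero]
    -- If `p * q` vanishes on `V`, then `V` is the union of its closed subsets `p = 0` and `q = 0`.
    refine (hirr _ _ (isAffineVariety_zeroLocus (vanishingIdeal F V ⊔ Ideal.span {p}))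
      (isAffineVariety_zeroLocus (vanishingIdeal F V ⊔ Ideal.span {q})) ?_).imp (key p) (key q)
    apply subset_antisymm
    · intro y hy
      have := hpq y hy
      rw [map_mul, mul_eq_zero] at this
      exact this.imp (hmem p y hy) (hmem q y hy)
    · have : ∀ f : MvPolynomial (Fin n) F,
          zeroLocus F (vanishingIdeal F V ⊔ Ideal.span {f}) ⊆ V := fun f => by
        conv_rhs => rw [← hV.zeroLocus_vanishingIdeal]
        exact zeroLocus_anti_mono le_sup_left
      exact Set.union_subset (this p) (this q)

theorem dim_mono {V W : Set (Fin n → F)} (h : W ⊆ V) : dim W ≤ dim V := by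
  refine Order.krullDim_le_of_strictMono
    (fun U => ⟨U.1, U.2.1, U.2.2.trans h⟩) ?_
  intro U U' hU
  exact hU

/-- The infimum of the empty set in `ℕ∞` is `⊤`, so a finite degree is attained by an actual generic
section number. Uniqueness of that number is not needed. -/
theorem exists_isGenericSectionNumber_le {W : Set (Fin n → F)} {d : ℕ}
    (h : irreducibleDegree W ≤ d) : ∃ D : ℕ, D ≤ d ∧ IsGenericSectionNumber W D := by
  have hne : {D | IsGenericSectionNumber W D}.Nonempty := by
    by_contra hcon
    rw [Set.not_nonempty_iff_eq_empty] at hcon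
    rw [irreducibleDegree, hcon, sInf_empty] at h
    exact absurd h (by simp)
  have hmem := csInf_mem hne
  change IsGenericSectionNumber W (irreducibleDegree W) at hmem
  obtain ⟨D, hD⟩ := ENat.ne_top_iff_exists.1 (ne_top_of_le_ne_top (ENat.natCast_ne_top d) h)
  rw [← hD] at h hmem
  exact ⟨D, by exact_mod_cast h, hmem⟩

variable [IsAlgClosed F]

theorem isIrreducibleVariety_zeroLocus (P : Ideal (MvPolynomial (Fin n) F)) [hP : P.IsPrime] :
    IsIrreducibleVariety (zeroLocus F P) := by
  refine ⟨⟨P, rfl⟩, ?_, ?_⟩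
  · rw [Set.nonempty_iff_ne_empty]
    intro h
    have h2 := IsPrime.vanishingIdeal_zeroLocus (K := F) P
    rw [h, vanishingIdeal_empty] at h2
    exact hP.ne_top h2.symm
  · intro A B hA hB hAB
    have h2 := IsPrime.vanishingIdeal_zeroLocus (K := F) P
    rw [hAB, vanishingIdeal_union] at h2
    have h3 : vanishingIdeal F A ≤ P ∨ vanishingIdeal F B ≤ P :=
      (Ideal.IsPrime.inf_le hP).1 h2.le
    refine h3.imp (fun h => ?_) (fun h => ?_)
    · refine subset_antisymm ?_ (hAB ▸ Set.subset_union_left)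
      conv_rhs => rw [← hA.zeroLocus_vanishingIdeal]
      exact zeroLocus_anti_mono h
    · refine subset_antisymm ?_ (hAB ▸ Set.subset_union_right)
      conv_rhs => rw [← hB.zeroLocus_vanishingIdeal]
      exact zeroLocus_anti_mono h

/-- Irreducible subvarieties of `V` correspond to the primes containing the ideal of `V`. -/
def irreducibleSubvarietiesOrderIso {V : Set (Fin n → F)} (hV : IsAffineVariety V) :
    {W : Set (Fin n → F) // IsIrreducibleVariety W ∧ W ⊆ V} ≃o
      (PrimeSpectrum.zeroLocus (vanishingIdeal F V : Set (MvPolynomial (Fin n) F)))ᵒᵈ where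
  toFun W := OrderDual.toDual ⟨⟨vanishingIdeal F W.1, W.2.1.isPrime_vanishingIdeal⟩,
    vanishingIdeal_anti_mono W.2.2⟩
  invFun P := ⟨zeroLocus F (OrderDual.ofDual P).1.asIdeal,
    isIrreducibleVariety_zeroLocus _, by
      conv_rhs => rw [← hV.zeroLocus_vanishingIdeal]
      exact zeroLocus_anti_mono (OrderDual.ofDual P).2⟩
  left_inv W := Subtype.ext W.2.1.1.zeroLocus_vanishingIdeal
  right_inv P := by
    apply OrderDual.ofDual.injective
    apply Subtype.ext
    apply PrimeSpectrum.ext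
    exact IsPrime.vanishingIdeal_zeroLocus _
  map_rel_iff' := by
    intro W W'
    constructor
    · intro h
      have h' : vanishingIdeal F W'.1 ≤ vanishingIdeal F W.1 := h
      have := zeroLocus_anti_mono (K := F) h'
      rw [W.2.1.1.zeroLocus_vanishingIdeal, W'.2.1.1.zeroLocus_vanishingIdeal] at this
      exact this
    · intro h
      exact vanishingIdeal_anti_mono (show W.1 ⊆ W'.1 from h)

theorem dim_eq_ringKrullDim {V : Set (Fin n → F)} (hV : IsAffineVariety V) :
    dim V = ringKrullDim (MvPolynomial (Fin n) F ⧸ vanishingIdeal F V) := by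
  rw [dim, Order.krullDim_eq_of_orderIso (irreducibleSubvarietiesOrderIso hV),
    Order.krullDim_orderDual, ringKrullDim_quotient]

theorem components_eq_image {V : Set (Fin n → F)} (hV : IsAffineVariety V) :
    components V = zeroLocus F '' (vanishingIdeal F V).minimalPrimes := by
  have hsub : ∀ P : Ideal (MvPolynomial (Fin n) F), vanishingIdeal F V ≤ P →
      zeroLocus F P ⊆ V := fun P hP => by
    conv_rhs => rw [← hV.zeroLocus_vanishingIdeal]
    exact zeroLocus_anti_mono hP
  ext W
  constructor
  · rintro ⟨⟨hW, hWV⟩, hmax⟩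
    refine ⟨vanishingIdeal F W, ⟨⟨hW.isPrime_vanishingIdeal, vanishingIdeal_anti_mono hWV⟩, ?_⟩,
      hW.1.zeroLocus_vanishingIdeal⟩
    rintro P ⟨hP, hVP⟩ hPW
    have h1 : W ≤ zeroLocus F P := le_zeroLocus_iff_le_vanishingIdeal.2 hPW
    have h2 := hmax ⟨isIrreducibleVariety_zeroLocus P, hsub P hVP⟩ h1
    rw [← IsPrime.vanishingIdeal_zeroLocus (K := F) P]
    exact vanishingIdeal_anti_mono h2
  · rintro ⟨P, ⟨⟨hP, hVP⟩, hmin⟩, rfl⟩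
    refine ⟨⟨isIrreducibleVariety_zeroLocus P, hsub P hVP⟩, ?_⟩
    rintro W ⟨hW, hWV⟩ hPW
    have h1 : vanishingIdeal F W ≤ P := by
      rw [← IsPrime.vanishingIdeal_zeroLocus (K := F) P]
      exact vanishingIdeal_anti_mono hPW
    have h2 := hmin ⟨hW.isPrime_vanishingIdeal, vanishingIdeal_anti_mono hWV⟩ h1
    have := zeroLocus_anti_mono (K := F) h2
    rwa [hW.1.zeroLocus_vanishingIdeal] at this

theorem finite_components {V : Set (Fin n → F)} (hV : IsAffineVariety V) :
    (components V).Finite := by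
  rw [components_eq_image hV]
  exact (Ideal.finite_minimalPrimes_of_isNoetherianRing _ _).image _

theorem exists_mem_components {V : Set (Fin n → F)} (hV : IsAffineVariety V) {x : Fin n → F}
    (hx : x ∈ V) : ∃ W ∈ components V, x ∈ W := by
  obtain ⟨P, hP, hPx⟩ := Ideal.exists_minimalPrimes_le (I := vanishingIdeal F V)
    (J := vanishingIdeal F {x}) (vanishingIdeal_anti_mono (by simpa using hx))
  refine ⟨zeroLocus F P, by rw [components_eq_image hV]; exact ⟨P, hP, rfl⟩, ?_⟩
  exact fun p hp => hPx hp x rfl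

theorem irreducibleDegree_le_degree {V W : Set (Fin n → F)} (hV : IsAffineVariety V)
    (hW : W ∈ components V) : irreducibleDegree W ≤ degree V := by
  classical
  -- Finiteness matters here: a `finsum` with infinite support would have the default value `0`.
  rw [degree, finsum_mem_eq_finite_toFinset_sum _ (finite_components hV)]
  exact Finset.single_le_sum (f := irreducibleDegree) (fun _ _ => zero_le) (by simpa using hW)

end Dictionary

/-! ### The valuation argument -/

section Valuation

open Finset

/-- The Chinese remainder argument, for `∑ aᵢ / eᵢ` with denominators cleared: modulo `e i` only the
`i`-th summand survives, and its cofactor is invertible. -/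
theorem eq_of_sum_mul_prod_erase_eq {ι : Type*} [Fintype ι] [DecidableEq ι] {e a b : ι → ℕ}
    (he : Pairwise fun i j => Nat.Coprime (e i) (e j)) (ha : ∀ i, a i < e i) (hb : ∀ i, b i < e i)
    (h : ∑ i, a i * ∏ j ∈ univ.erase i, e j = ∑ i, b i * ∏ j ∈ univ.erase i, e j) : a = b := by
  funext i
  have key : ∀ c : ι → ℕ, (∑ l, c l * ∏ j ∈ univ.erase l, e j) ≡
      c i * ∏ j ∈ univ.erase i, e j [MOD e i] := by
    intro c
    rw [← Finset.add_sum_erase _ _ (mem_univ i)]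
    have : (∑ l ∈ univ.erase i, c l * ∏ j ∈ univ.erase l, e j) ≡ 0 [MOD e i] := by
      rw [Nat.modEq_zero_iff_dvd]
      refine Finset.dvd_sum fun l hl => Dvd.dvd.mul_left (Finset.dvd_prod_of_mem e ?_) _
      simp only [mem_erase, mem_univ, and_true] at hl ⊢
      exact hl.symm
    simpa using this.add_left (c i * ∏ j ∈ univ.erase i, e j)
  have h1 := (key a).symm.trans (h ▸ key b)
  have hc : Nat.gcd (e i) (∏ j ∈ univ.erase i, e j) = 1 :=
    Nat.Coprime.prod_right fun j hj => he (by simp at hj; exact Ne.symm hj)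
  have h2 := Nat.ModEq.cancel_right_of_coprime hc h1
  rwa [Nat.ModEq, Nat.mod_eq_of_lt (ha i), Nat.mod_eq_of_lt (hb i)] at h2

theorem eq_of_prod_pow_eq {Γ : Type*} [LinearOrderedCommGroupWithZero Γ] {ι : Type*} [Fintype ι]
    {e a b : ι → ℕ} {γ : ι → Γ} {w : Γ}
    (he : Pairwise fun i j => Nat.Coprime (e i) (e j)) (ha : ∀ i, a i < e i) (hb : ∀ i, b i < e i)
    (hw : 1 < w) (hγ : ∀ i, γ i ^ e i = w) (h : ∏ i, γ i ^ a i = ∏ i, γ i ^ b i) : a = b := by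
  classical
  apply eq_of_sum_mul_prod_erase_eq he ha hb
  -- Raising to the power `∏ j, e j` replaces the rational exponents of `w` by integers.
  have key : ∀ c : ι → ℕ, (∏ i, γ i ^ c i) ^ (∏ j, e j) =
      w ^ (∑ i, c i * ∏ j ∈ univ.erase i, e j) := by
    intro c
    rw [← Finset.prod_pow_eq_pow_sum, ← Finset.prod_pow]
    refine Finset.prod_congr rfl fun i _ => ?_
    rw [← hγ i, ← Finset.mul_prod_erase univ e (mem_univ i), ← pow_mul, ← pow_mul]
    congr 1
    ring
  have h1 := congrArg (· ^ (∏ j, e j)) h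
  simp only [key] at h1
  exact (pow_right_injective₀ (zero_lt_one.trans hw) hw.ne') h1

theorem sum_ne_zero_of_valuation_injOn {K Γ : Type*} [Field K] [LinearOrderedCommGroupWithZero Γ]
    (v : Valuation K Γ) {ι : Type*} (s : Finset ι) (hs : s.Nonempty) (f : ι → K)
    (hf : ∀ i ∈ s, f i ≠ 0) (hinj : Set.InjOn (fun i => v (f i)) s) : ∑ i ∈ s, f i ≠ 0 := by
  classical
  obtain ⟨i, hi, hmax⟩ := s.exists_max_image (fun i => v (f i)) hs
  rw [← Finset.add_sum_erase _ _ hi]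
  have hlt : v (∑ j ∈ s.erase i, f j) < v (f i) := by
    refine v.map_sum_lt ((v.ne_zero_iff).2 (hf i hi)) fun j hj => ?_
    rw [mem_erase] at hj
    exact lt_of_le_of_ne (hmax j hj.2) fun h => hj.1 (hinj hj.2 hi h)
  intro h0
  have := v.map_add_eq_of_lt_left hlt
  rw [h0, map_zero] at this
  exact (v.ne_zero_iff).2 (hf i hi) this.symm

variable {F K : Type*} [Field F] [Field K] [Algebra F K]

/-- At most `k` columns extend to `k` columns, which are independent and thus have dual functionals.
The functional is the row combination that isolates one term of the diagonal forms. -/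
theorem exists_dual_col {m n k : ℕ} {M : Matrix (Fin m) (Fin n) F} (hM : IsRegularMatrix k M)
    (hkn : k ≤ n) (s : Finset (Fin n)) (hs : s.card ≤ k) (j₀ : Fin n) (hj₀ : j₀ ∈ s) :
    ∃ a : Fin m → F, ∀ j ∈ s, ∑ i, a i * M i j = if j = j₀ then 1 else 0 := by
  classical
  obtain ⟨t, hst, ht⟩ := Finset.exists_superset_card_eq (s := s) hs (by simpa using hkn)
  have hli := hM t ht
  obtain ⟨g, hg⟩ := (Finsupp.linearCombination F (fun j : t => M.col j)).exists_leftInverse_of_injective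
    (LinearMap.ker_eq_bot.2 hli)
  let φ : (Fin m → F) →ₗ[F] F := (Finsupp.lapply ⟨j₀, hst hj₀⟩) ∘ₗ g
  refine ⟨fun i => φ fun l => if i = l then 1 else 0, fun j hj => ?_⟩
  have h1 : φ (M.col j) = if j = j₀ then 1 else 0 := by
    have := congrArg (fun L => L (Finsupp.single (⟨j, hst hj⟩ : t) (1 : F))) hg
    simp only [LinearMap.comp_apply, Finsupp.linearCombination_single, one_smul,
      LinearMap.id_apply] at this
    simp only [φ, LinearMap.comp_apply, this, Finsupp.lapply_apply, Finsupp.single_apply,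
      Subtype.mk.injEq]
  rw [← h1, LinearMap.pi_apply_eq_sum_univ φ (M.col j)]
  refine Finset.sum_congr rfl fun i _ => ?_
  rw [smul_eq_mul, mul_comm]
  rfl

theorem mem_valuationSubring_of_diagonal {m n k d r : ℕ} {M : Matrix (Fin m) (Fin n) F}
    (hM : IsRegularMatrix k M) (hkn : k ≤ n) (hr : r ≤ k) {e : Fin n → ℕ} (hd : ∀ j, d < e j)
    (he : Pairwise fun j j' => Nat.Coprime (e j) (e j')) (x : Fin n → K)
    (hP : ∀ T : Fin (r + 1) ↪ Fin n, ∃ P : MvPolynomial (Fin (r + 1)) F, P ≠ 0 ∧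
      (∀ α ∈ P.support, ∀ i, α i ≤ d) ∧ MvPolynomial.aeval (x ∘ T) P = 0)
    (O : ValuationSubring K) (hF : ∀ a : F, algebraMap F K a ∈ O)
    (hO : ∀ i, ∑ j, algebraMap F K (M i j) * x j ^ e j ∈ O) (j : Fin n) : x j ∈ O := by
  classical
  set v := O.valuation with hv
  have hvO : ∀ y : K, v y ≤ 1 ↔ y ∈ O := fun y => O.valuation_le_one_iff y
  have hvF : ∀ a : F, a ≠ 0 → v (algebraMap F K a) = 1 := by
    intro a ha
    have h1 := (hvO _).2 (hF a)
    have h2 := (hvO _).2 (hF a⁻¹)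
    rw [map_inv₀, map_inv₀] at h2
    refine le_antisymm h1 ?_
    have h0 : v (algebraMap F K a) ≠ 0 := (v.ne_zero_iff).2 (by simpa using ha)
    exact (inv_le_one₀ (zero_lt_iff.2 h0)).1 h2
  by_contra hj
  obtain ⟨j₁, -, hmax⟩ := (univ : Finset (Fin n)).exists_max_image (fun j => v (x j ^ e j))
    ⟨j, mem_univ j⟩
  set w := v (x j₁ ^ e j₁) with hw
  have hw1 : 1 < w := by
    refine lt_of_lt_of_le ?_ (hmax j (mem_univ j))
    rw [map_pow]
    exact one_lt_pow₀ (not_le.1 (fun h => hj ((hvO _).1 h))) (by have := hd j; omega)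
  set S := univ.filter (fun j => v (x j ^ e j) = w) with hS
  -- Otherwise a combination of the given elements of `O` equals `x j₁ ^ e j₁` plus terms of value
  -- below `w`, so it has value `w > 1`.
  have hcard : k + 1 ≤ S.card := by
    by_contra hlt
    obtain ⟨a, ha⟩ := exists_dual_col hM hkn S (by omega) j₁ (by simp [hS, hw])
    have hsum : ∑ i, algebraMap F K (a i) * ∑ j, algebraMap F K (M i j) * x j ^ e j =
        x j₁ ^ e j₁ + ∑ j ∈ Sᶜ, algebraMap F K (∑ i, a i * M i j) * x j ^ e j := by
      calc _ = ∑ j, algebraMap F K (∑ i, a i * M i j) * x j ^ e j := by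
            simp only [Finset.mul_sum, map_sum, map_mul, Finset.sum_mul]
            rw [Finset.sum_comm]
            simp only [mul_assoc]
        _ = _ := by
            rw [← Finset.sum_add_sum_compl S]
            congr 1
            rw [Finset.sum_congr rfl (g := fun j => if j = j₁ then x j ^ e j else 0)]
            · rw [Finset.sum_ite_eq' S j₁ (fun j => x j ^ e j), if_pos (by simp [hS, hw])]
            · intro j hj
              rw [ha j hj]
              split_ifs <;> simp
    have h1 : v (∑ i, algebraMap F K (a i) * ∑ j, algebraMap F K (M i j) * x j ^ e j) < w :=
      lt_of_le_of_lt ((hvO _).2 (sum_mem fun i _ => mul_mem (hF _) (hO i))) hw1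
    have h2 : v (∑ j ∈ Sᶜ, algebraMap F K (∑ i, a i * M i j) * x j ^ e j) < w := by
      refine v.map_sum_lt (zero_lt_one.trans hw1).ne' fun j hj => ?_
      have hj' : v (x j ^ e j) < w := by
        refine lt_of_le_of_ne (hmax j (mem_univ j)) fun h => ?_
        simp only [mem_compl, hS, mem_filter, mem_univ, true_and] at hj
        exact hj h
      rw [map_mul]
      exact lt_of_le_of_lt (mul_le_of_le_one_left' ((hvO _).2 (hF _))) hj'
    rw [hsum, v.map_add_eq_of_lt_left (by rwa [← hw]), ← hw] at h1
    exact lt_irrefl _ h1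
  obtain ⟨S', hS'S, hS'⟩ := Finset.exists_subset_card_eq (s := S) (n := r + 1) (by omega)
  let T : Fin (r + 1) ↪ Fin n := (S'.orderEmbOfFin hS').toEmbedding
  have hT : ∀ i, v (x (T i)) ^ e (T i) = w := by
    intro i
    have : T i ∈ S := hS'S (S'.orderEmbOfFin_mem hS' i)
    rw [hS, mem_filter] at this
    rw [← map_pow]
    exact this.2
  obtain ⟨P, hP0, hPd, hPx⟩ := hP T
  have hx0 : ∀ i, x (T i) ≠ 0 := by
    intro i h0
    have := hT i
    -- The exponent is positive because it exceeds `d`; `0 ^ 0` would spoil the argument.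
    rw [h0, map_zero, zero_pow (by have := hd (T i); omega)] at this
    exact (zero_lt_one.trans hw1).ne this
  rw [MvPolynomial.aeval_def, MvPolynomial.eval₂_eq'] at hPx
  have hval : ∀ α ∈ P.support,
      v (algebraMap F K (P.coeff α) * ∏ i, (x ∘ T) i ^ α i) = ∏ i, v (x (T i)) ^ α i := by
    intro α hα
    rw [map_mul, hvF _ (MvPolynomial.mem_support_iff.1 hα), one_mul, map_prod]
    simp
  refine sum_ne_zero_of_valuation_injOn v P.support (by simpa using hP0) _ ?_ ?_ hPx
  · intro α hα
    refine mul_ne_zero (by simpa using hα)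
      (Finset.prod_ne_zero_iff.2 fun i _ => pow_ne_zero _ (hx0 i))
  · have hlt : ∀ α ∈ P.support, ∀ i, α i < e (T i) := by
      intro α hα i
      exact lt_of_le_of_lt (hPd α hα i) (hd (T i))
    intro α hα β hβ hαβ
    simp only at hαβ
    rw [hval α hα, hval β hβ] at hαβ
    ext i
    exact congrFun (eq_of_prod_pow_eq (fun i j hij => he (T.injective.ne hij)) (hlt α hα) (hlt β hβ)
      hw1 hT hαβ) i

theorem isIntegral_of_diagonal {m n k d r : ℕ} {M : Matrix (Fin m) (Fin n) F}
    (hM : IsRegularMatrix k M) (hkn : k ≤ n) (hr : r ≤ k) {e : Fin n → ℕ} (hd : ∀ j, d < e j)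
    (he : Pairwise fun j j' => Nat.Coprime (e j) (e j')) (x : Fin n → K)
    (hP : ∀ T : Fin (r + 1) ↪ Fin n, ∃ P : MvPolynomial (Fin (r + 1)) F, P ≠ 0 ∧
      (∀ α ∈ P.support, ∀ i, α i ≤ d) ∧ MvPolynomial.aeval (x ∘ T) P = 0) (j : Fin n) :
    IsIntegral (Algebra.adjoin F
      (Set.range fun i => ∑ j, algebraMap F K (M i j) * x j ^ e j)) (x j) := by
  set s : Set K := Set.range (algebraMap F K) ∪
    Set.range (fun i => ∑ j, algebraMap F K (M i j) * x j ^ e j)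
  have hmem : x j ∈ (integralClosure (Subring.closure s) K).toSubring := by
    -- Valuative criterion: the integral closure in a field is the intersection of the valuation
    -- rings above the subring.
    rw [← iInf_valuationSubring_superset, Subring.mem_iInf]
    rintro ⟨O, hO⟩
    exact mem_valuationSubring_of_diagonal hM hkn hr hd he x hP O
      (fun a => hO (.inl ⟨a, rfl⟩)) (fun i => hO (.inr ⟨i, rfl⟩)) j
  have hint : IsIntegral (Subring.closure s) (x j) := hmem
  obtain ⟨p, hp, hpx⟩ := hint
  have hle : Subring.closure s ≤ (Algebra.adjoin F
      (Set.range fun i => ∑ j, algebraMap F K (M i j) * x j ^ e j)).toSubring := by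
    rw [Algebra.adjoin_eq_ring_closure]
  refine ⟨p.map (Subring.inclusion hle), hp.map _, ?_⟩
  rw [Polynomial.eval₂_map]
  exact hpx

end Valuation

/-! ### Extending points along generically finite extensions -/

section Lifting

open Polynomial

/-- Choose a valuation ring of the fraction field that dominates the image of `S` at `I`. It
contains every `x j`, hence `R`, and its maximal ideal contracts to the required prime. The
condition on leading coefficients says that no `x j` escapes to infinity over the point `I`. -/
theorem exists_isPrime_comap_ge {S R ι : Type*} [CommRing S] [CommRing R] [IsDomain R]
    (f : S →+* R) (I : Ideal S) [hI : I.IsMaximal] (hker : RingHom.ker f ≤ I) (x : ι → R)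
    (hx : Subring.closure (Set.range f ∪ Set.range x) = ⊤)
    (hp : ∀ j, ∃ p : S[X], p.eval₂ f (x j) = 0 ∧ p.leadingCoeff ∉ I) :
    ∃ q : Ideal R, q.IsPrime ∧ ∀ s ∈ I, f s ∈ q := by
  let K := FractionRing R
  let g : S →+* K := (algebraMap R K).comp f
  let J : Ideal g.range := I.map g.rangeRestrict
  have hJmem : ∀ s : S, g.rangeRestrict s ∈ J → s ∈ I := by
    intro s hs
    obtain ⟨t, ht, hts⟩ := (Ideal.mem_map_iff_of_surjective _ g.rangeRestrict_surjective).1 hs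
    have : g t = g s := congrArg Subtype.val hts
    have h2 : f t = f s := IsFractionRing.injective R K this
    have h3 : t - s ∈ I := hker (by rw [RingHom.mem_ker, map_sub, h2, sub_self])
    simpa using I.sub_mem ht h3
  have hJ : J ≠ ⊤ := by
    intro h
    apply hI.ne_top
    rw [Ideal.eq_top_iff_one]
    exact hJmem 1 (by rw [h]; trivial)
  obtain ⟨B, hAB, hB⟩ := Ideal.image_subset_nonunits_valuationSubring J hJ
  have hgB : ∀ s, g s ∈ B := fun s => hAB ⟨s, rfl⟩
  have hIB : ∀ s ∈ I, B.valuation (g s) < 1 := fun s hs =>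
    B.mem_nonunits_iff.1
      (hB ⟨g.rangeRestrict s, Ideal.mem_map_of_mem _ hs, rfl⟩)
  have hunit : ∀ s, s ∉ I → B.valuation (g s) = 1 := by
    intro s hs
    refine le_antisymm ((B.valuation_le_one_iff _).2 (hgB s)) ?_
    by_contra hlt
    rw [not_le] at hlt
    obtain ⟨t, i, hi, hts⟩ := hI.exists_inv hs
    have h1 : g t * g s + g i = 1 := by rw [← map_mul, ← map_add, hts, map_one]
    have h2 : B.valuation (g t * g s + g i) < 1 := by
      refine B.valuation.map_add_lt ?_ (hIB i hi)
      rw [map_mul]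
      exact lt_of_le_of_lt (mul_le_of_le_one_left' ((B.valuation_le_one_iff _).2 (hgB t))) hlt
    rw [h1, map_one] at h2
    exact lt_irrefl _ h2
  have hxB : ∀ j, algebraMap R K (x j) ∈ B := by
    intro j
    obtain ⟨p, hpx, hpl⟩ := hp j
    let := g.toAlgebra
    have h0 : aeval (algebraMap R K (x j)) p = 0 := by
      rw [aeval_def]
      change eval₂ ((algebraMap R K).comp f) (algebraMap R K (x j)) p = 0
      rw [← hom_eval₂, hpx, map_zero]
    have h1 := isIntegral_leadingCoeff_smul p _ h0
    -- A root multiplied by the leading coefficient is integral, and valuation rings are integrally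
    -- closed; the leading coefficient is a unit of `B`.
    have h2 : g p.leadingCoeff * algebraMap R K (x j) ∈ B := by
      obtain ⟨q, hq, hqx⟩ := h1
      let g' : S →+* B := g.codRestrict B hgB
      have : IsIntegral B (g p.leadingCoeff * algebraMap R K (x j)) := by
        refine ⟨q.map g', hq.map _, ?_⟩
        rw [eval₂_map]
        exact hqx
      obtain ⟨y, hy⟩ := IsIntegrallyClosed.isIntegral_iff.1 this
      rw [← hy]
      exact y.2
    rw [← B.valuation_le_one_iff, map_mul, hunit _ hpl, one_mul] at h2
    exact (B.valuation_le_one_iff _).1 h2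
  have hRB : ∀ y : R, algebraMap R K y ∈ B := by
    have : Subring.closure (Set.range f ∪ Set.range x) ≤ B.toSubring.comap (algebraMap R K) := by
      rw [Subring.closure_le]
      rintro _ (⟨s, rfl⟩ | ⟨j, rfl⟩)
      · exact hgB s
      · exact hxB j
    rw [hx] at this
    exact fun y => this trivial
  refine ⟨(IsLocalRing.maximalIdeal B).comap ((algebraMap R K).codRestrict B hRB),
    Ideal.comap_isPrime _ _, fun s hs => ?_⟩
  rw [Ideal.mem_comap, ValuationSubring.valuation_lt_one_iff]
  exact hIB s hs

/-- Modulo the prime found above, the generators of `R` satisfy the specialized polynomials, which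
are nonzero. The quotient is therefore integral over `F`, hence equal to `F`. -/
theorem exists_algHom_extending {F S R ι : Type*} [Field F] [IsAlgClosed F] [CommRing S]
    [CommRing R] [IsDomain R] [Algebra F S] [Algebra F R] (f : S →ₐ[F] R) (χ : S →ₐ[F] F)
    (hker : ∀ s, f s = 0 → χ s = 0) (x : ι → R) (hx : Algebra.adjoin F (Set.range x) = ⊤)
    (hp : ∀ j, ∃ p : S[X], p.eval₂ f.toRingHom (x j) = 0 ∧ χ p.leadingCoeff ≠ 0) :
    ∃ ψ : R →ₐ[F] F, ∀ s, ψ (f s) = χ s := by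
  have hsurj : Function.Surjective χ := fun a => ⟨algebraMap F S a, by simp⟩
  have hmax : (RingHom.ker χ.toRingHom).IsMaximal :=
    RingHom.ker_isMaximal_of_surjective χ.toRingHom hsurj
  have hmem : ∀ s, s ∈ RingHom.ker χ.toRingHom ↔ χ s = 0 := fun s => Iff.rfl
  obtain ⟨q, hq, hqI⟩ := exists_isPrime_comap_ge f.toRingHom (RingHom.ker χ.toRingHom)
    (fun s hs => hker s hs) x (by
      rw [eq_top_iff]
      rintro y -
      have hy : y ∈ Algebra.adjoin F (Set.range x) := by rw [hx]; trivial
      rw [← Subalgebra.mem_toSubring, Algebra.adjoin_eq_ring_closure] at hy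
      refine Subring.closure_mono (Set.union_subset_union_left _ ?_) hy
      rintro _ ⟨a, rfl⟩
      exact ⟨algebraMap F S a, by simp⟩)
    (fun j => by
      obtain ⟨p, h1, h2⟩ := hp j
      exact ⟨p, h1, h2⟩)
  have hfχ : ∀ s, Ideal.Quotient.mk q (f s) = algebraMap F (R ⧸ q) (χ s) := by
    intro s
    have h1 : s - algebraMap F S (χ s) ∈ RingHom.ker χ.toRingHom := by
      rw [hmem]; simp
    have h2 := hqI _ h1
    have h3 : f s - algebraMap F R (χ s) ∈ q := by simpa using h2
    exact Ideal.Quotient.eq.2 h3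
  have halg : ∀ j, IsIntegral F (Ideal.Quotient.mk q (x j)) := by
    intro j
    rw [← isAlgebraic_iff_isIntegral]
    obtain ⟨p, h1, h2⟩ := hp j
    refine ⟨p.map χ.toRingHom, ?_, ?_⟩
    · intro h0
      apply h2
      have := congrArg (fun r => r.coeff p.natDegree) h0
      simpa using this
    · rw [aeval_def, eval₂_map]
      have h3 : (algebraMap F (R ⧸ q)).comp χ.toRingHom =
          (Ideal.Quotient.mk q).comp f.toRingHom := by
        ext s
        exact (hfχ s).symm
      rw [h3, ← hom_eval₂, h1, map_zero]
  have hint : Algebra.IsIntegral F (R ⧸ q) := by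
    have hle : Algebra.adjoin F (Set.range x) ≤
        (integralClosure F (R ⧸ q)).comap (Ideal.Quotient.mkₐ F q) := by
      rw [Algebra.adjoin_le_iff]
      rintro _ ⟨j, rfl⟩
      exact halg j
    rw [hx] at hle
    refine ⟨fun y => ?_⟩
    obtain ⟨r, rfl⟩ := Ideal.Quotient.mk_surjective y
    exact hle (trivial : r ∈ ⊤)
  have hbij := IsAlgClosed.algebraMap_bijective_of_isIntegral (k := F) (K := R ⧸ q)
  let E : F ≃ₐ[F] (R ⧸ q) := AlgEquiv.ofBijective (Algebra.ofId F (R ⧸ q)) hbij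
  refine ⟨E.symm.toAlgHom.comp (Ideal.Quotient.mkₐ F q), fun s => ?_⟩
  change E.symm (Ideal.Quotient.mk q (f s)) = χ s
  rw [hfχ, AlgEquiv.symm_apply_eq]
  rfl

end Lifting

/-! ### Counting the points of a generic fiber -/

section Counting

open Polynomial

/-- Clearing denominators in a Bézout relation for a separable polynomial. -/
theorem exists_bezout_of_separable_map {B : Type*} [CommRing B] [IsDomain B] (K : Type*) [Field K]
    [Algebra B K] [IsFractionRing B K] {h : B[X]} (hsep : (h.map (algebraMap B K)).Separable) :
    ∃ (c : B) (a b : B[X]), c ≠ 0 ∧ a * h + b * derivative h = C c := by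
  obtain ⟨a, b, hab⟩ := hsep
  obtain ⟨s, hs0, hs⟩ := IsLocalization.integerNormalization_spec (nonZeroDivisors B) a
  obtain ⟨t, ht0, ht⟩ := IsLocalization.integerNormalization_spec (nonZeroDivisors B) b
  set a' := IsLocalization.integerNormalization (nonZeroDivisors B) a
  set b' := IsLocalization.integerNormalization (nonZeroDivisors B) b
  refine ⟨s * t, C t * a', C s * b',
    mul_ne_zero (nonZeroDivisors.ne_zero hs0) (nonZeroDivisors.ne_zero ht0), ?_⟩
  apply Polynomial.map_injective _ (IsFractionRing.injective B K)
  have hs' : a'.map (algebraMap B K) = C (algebraMap B K s) * a := by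
    rw [hs, Algebra.smul_def]; rfl
  have ht' : b'.map (algebraMap B K) = C (algebraMap B K t) * b := by
    rw [ht, Algebra.smul_def]; rfl
  simp only [Polynomial.map_add, Polynomial.map_mul, Polynomial.map_C, hs', ht', map_mul]
  rw [derivative_map] at hab
  linear_combination (C (algebraMap B K s) * C (algebraMap B K t)) * hab

/-- The Bézout identity survives every specialization in which `c` stays nonzero, so all roots
remain simple there. -/
theorem card_roots_of_bezout {B F : Type*} [CommRing B] [Field F] [IsAlgClosed F] [DecidableEq F]
    (φ : B →+* F) {h a b : B[X]} {c : B} (hm : h.Monic) (hab : a * h + b * derivative h = C c)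
    (hc : φ c ≠ 0) : (h.map φ).roots.toFinset.card = h.natDegree := by
  have hsep : (h.map φ).Separable := by
    refine ⟨C (φ c)⁻¹ * a.map φ, C (φ c)⁻¹ * b.map φ, ?_⟩
    have := congrArg (Polynomial.map φ) hab
    simp only [Polynomial.map_add, Polynomial.map_mul, Polynomial.map_C] at this
    rw [derivative_map, mul_assoc, mul_assoc, ← mul_add, this, ← C_mul, inv_mul_cancel₀ hc, C_1]
  rw [Multiset.toFinset_card_of_nodup (nodup_roots hsep),
    ← (IsAlgClosed.splits (h.map φ)).natDegree_eq_card_roots, hm.natDegree_map]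

variable {F R : Type*} [Field F] [IsAlgClosed F] [CommRing R] [IsDomain R] [Algebra F R]

theorem exists_algHoms_over_generic_point {n r : ℕ} (x : Fin n → R)
    (hx : Algebra.adjoin F (Set.range x) = ⊤) (z : Fin r → R) (hz : AlgebraicIndependent F z)
    (halg : ∀ j, IsAlgebraic (Algebra.adjoin F (Set.range z)) (x j)) (y : R)
    (h : (MvPolynomial (Fin r) F)[X]) (hm : h.Monic) (hirr : Irreducible h)
    (hder : derivative h ≠ 0) (hy : h.eval₂ (MvPolynomial.aeval z).toRingHom y = 0) :
    ∃ g : MvPolynomial (Fin r) F, g ≠ 0 ∧ ∀ b : Fin r → F, MvPolynomial.eval b g ≠ 0 →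
      ∃ s : Finset (R →ₐ[F] F), s.card = h.natDegree ∧ ∀ ψ ∈ s, ∀ i, ψ (z i) = b i := by
  classical
  let B := MvPolynomial (Fin r) F
  let K := FractionRing B
  let algB : Algebra B R := (MvPolynomial.aeval z).toRingHom.toAlgebra
  have hinj : Function.Injective (algebraMap B R) := hz
  have : FaithfulSMul B R := (faithfulSMul_iff_algebraMap_injective B R).2 hinj
  have : Module.IsTorsionFree B R := inferInstance
  have hyint : IsIntegral B y := ⟨h, hm, hy⟩
  -- As `B` is integrally closed, the kernel of evaluation at `y` is generated by `h`. Hence each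
  -- root of the specialized `h` defines a point of the image `B[y]`.
  have hmin : minpoly B y = h := by
    have hdvd : minpoly B y ∣ h := minpoly.isIntegrallyClosed_dvd hyint hy
    have := (minpoly.prime_of_isIntegrallyClosed hyint).irreducible.associated_of_dvd hirr hdvd
    exact eq_of_monic_of_associated (minpoly.monic hyint) hm this
  have hsep : (h.map (algebraMap B K)).Separable := by
    have h1 : Irreducible (h.map (algebraMap B K)) :=
      (hm.irreducible_iff_irreducible_map_fraction_map (K := K)).1 hirr
    rw [separable_iff_derivative_ne_zero h1, derivative_map]
    intro h0
    exact hder (Polynomial.map_injective _ (IsFractionRing.injective B K) (by rw [h0]; simp))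
  obtain ⟨c, a, b', hc, hab⟩ := exists_bezout_of_separable_map K hsep
  have hp : ∀ j, ∃ p : B[X], p ≠ 0 ∧ p.eval₂ (MvPolynomial.aeval z).toRingHom (x j) = 0 := by
    intro j
    obtain ⟨p, hp0, hpx⟩ := halg j
    let E := hz.aevalEquiv
    refine ⟨p.map (E.symm : Algebra.adjoin F (Set.range z) →+* B), ?_, ?_⟩
    · exact (Polynomial.map_ne_zero_iff E.symm.injective).2 hp0
    · rw [eval₂_map]
      have : ((MvPolynomial.aeval z).toRingHom).comp
          (E.symm : Algebra.adjoin F (Set.range z) →+* B) =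
          algebraMap (Algebra.adjoin F (Set.range z)) R := by
        ext w
        obtain ⟨w', rfl⟩ := E.surjective w
        simp [E]
      rw [this]
      exact hpx
  choose p hp0 hpx using hp
  -- The factor `c` keeps the roots distinct; the leading coefficients let each root extend to a
  -- point of `R`.
  refine ⟨c * ∏ j, (p j).leadingCoeff, mul_ne_zero hc (Finset.prod_ne_zero_iff.2 fun j _ =>
    leadingCoeff_ne_zero.2 (hp0 j)), fun b hb => ?_⟩
  rw [map_mul, map_prod] at hb
  have hb1 := left_ne_zero_of_mul hb
  have hb2 := Finset.prod_ne_zero_iff.1 (right_ne_zero_of_mul hb)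
  have hcard := card_roots_of_bezout (MvPolynomial.eval b) hm hab hb1
  have hlift : ∀ t ∈ (h.map (MvPolynomial.eval b)).roots.toFinset,
      ∃ ψ : R →ₐ[F] F, (∀ i, ψ (z i) = b i) ∧ ψ y = t := by
    intro t ht
    let f : B[X] →ₐ[F] R := Polynomial.eval₂AlgHom (MvPolynomial.aeval z) y fun _ => Commute.all _ _
    let χ : B[X] →ₐ[F] F := Polynomial.eval₂AlgHom (MvPolynomial.aeval b) t fun _ => Commute.all _ _
    have hf : ∀ q : B[X], f q = q.eval₂ (MvPolynomial.aeval z).toRingHom y := fun q => rfl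
    have hχ : ∀ q : B[X], χ q = q.eval₂ (MvPolynomial.eval b) t := fun q => rfl
    have hht : χ h = 0 := by
      rw [Multiset.mem_toFinset] at ht
      rw [hχ, ← eval_map]
      exact isRoot_of_mem_roots ht
    obtain ⟨ψ, hψ⟩ := exists_algHom_extending f χ (fun q hq => by
        have hdvd : h ∣ q := by
          rw [← hmin]
          exact minpoly.isIntegrallyClosed_dvd hyint hq
        obtain ⟨w, rfl⟩ := hdvd
        rw [map_mul, hht, zero_mul]) x hx (fun j => by
        refine ⟨(p j).map C, ?_, ?_⟩
        · rw [eval₂_map, ← hpx j]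
          congr 1
          refine RingHom.ext fun q => ?_
          change f (C q) = _
          rw [hf, eval₂_C]
        · rw [leadingCoeff_map_of_injective C_injective, hχ, eval₂_C]
          exact hb2 j (Finset.mem_univ j))
    refine ⟨ψ, fun i => ?_, ?_⟩
    · have := hψ (C (MvPolynomial.X i))
      simpa [hf, hχ] using this
    · have := hψ X
      simpa [hf, hχ] using this
  choose ψ hψz hψy using hlift
  refine ⟨(h.map (MvPolynomial.eval b)).roots.toFinset.attach.image fun t => ψ t.1 t.2, ?_, ?_⟩
  · rw [Finset.card_image_of_injective, Finset.card_attach, hcard]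
    intro t t' htt'
    apply Subtype.ext
    rw [← hψy t.1 t.2, ← hψy t'.1 t'.2]
    exact congrArg (fun φ => φ y) htt'
  · intro φ hφ
    obtain ⟨t, -, rfl⟩ := Finset.mem_image.1 hφ
    exact hψz t.1 t.2

end Counting

/-! ### Shears -/

section Shear

open MvPolynomial

theorem exists_eval_ne_zero {F σ : Type*} [Field F] [Infinite F] {p : MvPolynomial σ F}
    (hp : p ≠ 0) : ∃ a : σ → F, eval a p ≠ 0 := by
  by_contra hcon
  push Not at hcon
  exact hp (MvPolynomial.funext fun a => by rw [hcon a, map_zero])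

theorem natDegree_prod_pow_le_and_coeff {B ι : Type*} [CommRing B] (s : Finset ι)
    (l : ι → Polynomial B) (hl : ∀ i, (l i).natDegree ≤ 1) (α : ι → ℕ) :
    (∏ i ∈ s, l i ^ α i).natDegree ≤ ∑ i ∈ s, α i ∧
      (∏ i ∈ s, l i ^ α i).coeff (∑ i ∈ s, α i) = ∏ i ∈ s, (l i).coeff 1 ^ α i := by
  classical
  induction s using Finset.induction_on with
  | empty => simp
  | insert i s hi ih =>
    have h1 : (l i ^ α i).natDegree ≤ α i :=
      (Polynomial.natDegree_pow_le_of_le (α i) (hl i)).trans (by simp)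
    rw [Finset.prod_insert hi, Finset.sum_insert hi, Finset.prod_insert hi]
    refine ⟨Polynomial.natDegree_mul_le_of_le h1 ih.1, ?_⟩
    rw [Polynomial.coeff_mul_add_eq_of_natDegree_le h1 ih.1, ih.2]
    congr 1
    have := Polynomial.coeff_pow_of_natDegree_le (m := α i) (hl i)
    rwa [mul_one] at this

variable {F : Type*} [Field F] {r : ℕ}

/-- The substitution `X₀ ↦ X₀`, `Xᵢ₊₁ ↦ Xᵢ₊₁ - vᵢ X₀`. -/
def shear (v : Fin r → F) : MvPolynomial (Fin (r + 1)) F →ₐ[F] MvPolynomial (Fin (r + 1)) F :=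
  aeval (Fin.cons (X 0) fun i => X i.succ - C (v i) * X 0)

@[simp] theorem shear_X_zero (v : Fin r → F) : shear v (X 0) = X 0 := by simp [shear]

@[simp] theorem shear_X_succ (v : Fin r → F) (i : Fin r) :
    shear v (X i.succ) = X i.succ - C (v i) * X 0 := by simp [shear]

theorem shear_comp_shear_neg (v : Fin r → F) :
    (shear v).comp (shear (-v)) = AlgHom.id F _ := by
  ext i : 1
  refine Fin.cases ?_ (fun i => ?_) i
  · simp
  · simp [algHom_C]

/-- The shear as an automorphism. -/
def shearEquiv (v : Fin r → F) :
    MvPolynomial (Fin (r + 1)) F ≃ₐ[F] MvPolynomial (Fin (r + 1)) F :=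
  AlgEquiv.ofAlgHom (shear v) (shear (-v)) (shear_comp_shear_neg v)
    (by simpa using shear_comp_shear_neg (-v))

theorem aeval_shear {R : Type*} [CommRing R] [Algebra F R] (v : Fin r → F) (y : Fin (r + 1) → R)
    (P : MvPolynomial (Fin (r + 1)) F) :
    aeval (Fin.cons (y 0) fun i => y i.succ + algebraMap F R (v i) * y 0 : Fin (r + 1) → R)
      (shear v P) = aeval y P := by
  rw [← AlgHom.comp_apply]
  congr 1
  ext i
  refine Fin.cases ?_ (fun i => ?_) i <;> simp

/-- The chain rule; after a shear, separability in `X₀` concerns a directional derivative of `P`,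
which is nonzero for generic `v`. -/
theorem pderiv_zero_shear (v : Fin r → F) (P : MvPolynomial (Fin (r + 1)) F) :
    pderiv 0 (shear v P) = shear v (pderiv 0 P - ∑ i, C (v i) * pderiv i.succ P) := by
  let D : Derivation F (MvPolynomial (Fin (r + 1)) F) (MvPolynomial (Fin (r + 1)) F) :=
    pderiv 0 - ∑ i, v i • pderiv i.succ
  have hD : ∀ Q, D Q = pderiv 0 Q - ∑ i, C (v i) * pderiv i.succ Q := by
    intro Q
    rw [Derivation.sub_apply]
    congr 1
    change Derivation.coeFnAddMonoidHom (∑ i, v i • pderiv i.succ) Q = _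
    rw [map_sum, Finset.sum_apply]
    exact Finset.sum_congr rfl fun i _ => smul_eq_C_mul _ _
  have hX : ∀ j, pderiv 0 (shear v (X j)) = shear v (D (X j)) := by
    intro j
    refine Fin.cases ?_ (fun j => ?_) j
    · simp [hD, pderiv_X_of_ne (Fin.succ_ne_zero _).symm]
    · simp [hD, algHom_C, pderiv_X_of_ne (Fin.succ_ne_zero _), pderiv_X, Pi.single_apply]
  rw [← hD]
  induction P using MvPolynomial.induction_on with
  | C a => simp [algHom_C]
  | add p q hp hq => simp only [map_add, hp, hq]
  | mul_X p j hp =>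
    rw [map_mul, Derivation.leibniz, hX, hp, Derivation.leibniz]
    simp only [smul_eq_mul, map_add, map_mul]

/-- The image of `P` under the shear, as a polynomial in `X₀`. -/
def shearPoly (v : Fin r → F) (P : MvPolynomial (Fin (r + 1)) F) :
    Polynomial (MvPolynomial (Fin r) F) := finSuccEquiv F r (shear v P)

/-- Each variable becomes linear in `X₀` with leading coefficients `1, -v₁, …, -vᵣ`, so only the top
homogeneous part contributes in the maximal degree. For generic `v` this makes the polynomial monic
up to a scalar. -/
theorem shearPoly_natDegree_le_and_coeff (v : Fin r → F) (P : MvPolynomial (Fin (r + 1)) F) :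
    (shearPoly v P).natDegree ≤ P.totalDegree ∧ (shearPoly v P).coeff P.totalDegree =
      C (eval (Fin.cons 1 (-v) : Fin (r + 1) → F) (homogeneousComponent P.totalDegree P)) := by
  let l : Fin (r + 1) → Polynomial (MvPolynomial (Fin r) F) :=
    Fin.cons Polynomial.X fun i => Polynomial.C (X i) - Polynomial.C (C (v i)) * Polynomial.X
  have hl : ∀ i, (l i).natDegree ≤ 1 := by
    intro i
    refine Fin.cases ?_ (fun i => ?_) i
    · simp [l]
    · simp only [l, Fin.cons_succ]
      compute_degree
  have hl1 : ∀ i, (l i).coeff 1 = C ((Fin.cons 1 (-v) : Fin (r + 1) → F) i) := by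
    intro i
    refine Fin.cases ?_ (fun i => ?_) i
    · simp [l]
    · simp [l, Polynomial.coeff_C]
  have hcomp : ∀ Q, shearPoly v Q = aeval l Q := by
    intro Q
    have : (finSuccEquiv F r).toAlgHom.comp (shear v) = aeval l := by
      ext i : 1
      refine Fin.cases ?_ (fun i => ?_) i
      · simp [l, finSuccEquiv_X_zero]
      · simp only [AlgHom.comp_apply, shear_X_succ, map_sub, map_mul, aeval_X, l, Fin.cons_succ]
        change finSuccEquiv F r (X i.succ) - finSuccEquiv F r (C (v i)) * finSuccEquiv F r (X 0) = _
        rw [finSuccEquiv_X_zero, finSuccEquiv_X_succ]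
        congr 2
        simp [finSuccEquiv_apply]
    exact congrArg (fun f => f Q) this
  have hmon : ∀ (α : Fin (r + 1) →₀ ℕ) (a : F), aeval l (monomial α a) =
      Polynomial.C (C a) * ∏ i, l i ^ α i := by
    intro α a
    rw [aeval_monomial, Finsupp.prod_fintype _ _ (fun i => pow_zero _)]
    rfl
  have hdeg : ∀ α ∈ P.support, ∑ i, α i ≤ P.totalDegree := by
    intro α hα
    have := le_totalDegree hα
    rwa [Finsupp.sum_fintype _ _ (fun i => rfl)] at this
  have hsum : shearPoly v P = ∑ α ∈ P.support, Polynomial.C (C (P.coeff α)) * ∏ i, l i ^ α i := by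
    rw [hcomp]
    conv_lhs => rw [← support_sum_monomial_coeff P]
    rw [map_sum]
    exact Finset.sum_congr rfl fun α _ => hmon α _
  constructor
  · rw [hsum]
    refine Polynomial.natDegree_sum_le_of_forall_le _ _ fun α hα => ?_
    exact (Polynomial.natDegree_C_mul_le _ _).trans
      ((natDegree_prod_pow_le_and_coeff Finset.univ l hl α).1.trans (hdeg α hα))
  · rw [hsum, Polynomial.finsetSum_coeff, homogeneousComponent_apply, map_sum, map_sum,
      Finset.sum_filter]
    refine Finset.sum_congr rfl fun α hα => ?_
    have h2 := natDegree_prod_pow_le_and_coeff Finset.univ l hl α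
    have h3 : α.degree = ∑ i, α i := Finsupp.degree_eq_sum α
    rw [Polynomial.coeff_C_mul]
    split_ifs with h
    · rw [← h, h3, h2.2, eval_monomial, Finsupp.prod_fintype _ _ (fun i => pow_zero _), map_mul,
        map_prod]
      simp only [hl1, map_pow]
    · rw [Polynomial.coeff_eq_zero_of_natDegree_lt, mul_zero]
      exact lt_of_le_of_lt h2.1 (lt_of_le_of_ne (hdeg α hα) (h3 ▸ h))

theorem derivative_finSuccEquiv (Q : MvPolynomial (Fin (r + 1)) F) :
    Polynomial.derivative (finSuccEquiv F r Q) = finSuccEquiv F r (pderiv 0 Q) := by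
  induction Q using MvPolynomial.induction_on with
  | C a => simp [finSuccEquiv_apply]
  | add p q hp hq => simp only [map_add, hp, hq]
  | mul_X p j hp =>
    simp only [map_mul, Polynomial.derivative_mul, hp, Derivation.leibniz, smul_eq_mul, map_add]
    refine Fin.cases ?_ (fun j => ?_) j
    · simp [finSuccEquiv_X_zero]
      ring
    · simp [finSuccEquiv_X_succ]
      ring

end Shear

/-! ### Relations of bounded degree between generic linear forms -/

section Relations

open MvPolynomial

variable {F R : Type*} [Field F] [CommRing R] [Algebra F R]

theorem eval₂_finSuccEquiv {r : ℕ} (y : R) (z : Fin r → R) (Q : MvPolynomial (Fin (r + 1)) F) :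
    (finSuccEquiv F r Q).eval₂ (aeval z).toRingHom y =
      aeval (Fin.cons y z : Fin (r + 1) → R) Q := by
  have : ((Polynomial.eval₂AlgHom (aeval z) y fun _ => Commute.all _ _).comp
      (finSuccEquiv F r).toAlgHom) = aeval (Fin.cons y z : Fin (r + 1) → R) := by
    ext i
    refine Fin.cases ?_ (fun i => ?_) i
    · simp [finSuccEquiv_X_zero]
    · simp [finSuccEquiv_X_succ]
  exact congrArg (fun f => f Q) this

theorem exists_minimal_relation {r : ℕ} {y : Fin r → R} (h : ¬ AlgebraicIndependent F y) :
    ∃ P : MvPolynomial (Fin r) F, P ≠ 0 ∧ aeval y P = 0 ∧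
      ∀ Q : MvPolynomial (Fin r) F, Q ≠ 0 → aeval y Q = 0 → P.totalDegree ≤ Q.totalDegree := by
  classical
  have hex : ∃ k : ℕ, ∃ Q : MvPolynomial (Fin r) F, Q ≠ 0 ∧ aeval y Q = 0 ∧ Q.totalDegree = k := by
    rw [AlgebraicIndependent, injective_iff_map_eq_zero] at h
    push Not at h
    obtain ⟨Q, hQ, hQ0⟩ := h
    exact ⟨_, Q, hQ0, hQ, rfl⟩
  obtain ⟨P, hP0, hP, hPd⟩ := Nat.find_spec hex
  refine ⟨P, hP0, hP, fun Q hQ0 hQ => ?_⟩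
  rw [hPd]
  exact Nat.find_min' hex ⟨Q, hQ0, hQ, rfl⟩

theorem eval_smul_of_isHomogeneous {r δ : ℕ} {φ : MvPolynomial (Fin r) F} (hφ : φ.IsHomogeneous δ)
    (t : F) (a : Fin r → F) : eval (t • a) φ = t ^ δ * eval a φ := by
  rw [eval_eq', eval_eq', Finset.mul_sum]
  refine Finset.sum_congr rfl fun α hα => ?_
  have h1 : ∑ i, α i = δ := by
    rw [← Finsupp.degree_eq_sum, Finsupp.degree_eq_weight_one]
    exact hφ (mem_support_iff.1 hα)
  simp only [Pi.smul_apply, smul_eq_mul, mul_pow, Finset.prod_mul_distrib,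
    Finset.prod_pow_eq_pow_sum, h1]
  ring

theorem homogeneousComponent_totalDegree_ne_zero {r : ℕ} {P : MvPolynomial (Fin r) F}
    (hP : P ≠ 0) : homogeneousComponent P.totalDegree P ≠ 0 := by
  obtain ⟨σ, hσ, hσd⟩ := Finset.exists_mem_eq_sup P.support (by simpa using hP)
    (fun s => s.sum fun _ e => e)
  intro h0
  have := congrArg (coeff σ) h0
  rw [coeff_homogeneousComponent, if_pos, coeff_zero] at this
  · exact mem_support_iff.1 hσ this
  · exact hσd.symm

variable [IsAlgClosed F] [IsDomain R]

/-- Minimality of the degree forces irreducibility and, as `F` is perfect, separability in some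
variable: in characteristic `p`, a relation with all exponents divisible by `p` would yield a
relation of smaller degree. -/
theorem exists_pderiv_ne_zero_of_minimal_relation {r : ℕ} {y : Fin r → R}
    {P : MvPolynomial (Fin r) F} (hP0 : P ≠ 0) (hP : aeval y P = 0)
    (hmin : ∀ Q : MvPolynomial (Fin r) F, Q ≠ 0 → aeval y Q = 0 →
      P.totalDegree ≤ Q.totalDegree) : Irreducible P ∧ ∃ i, pderiv i P ≠ 0 := by
  let K := FractionRing R
  have hinj : Function.Injective (algebraMap R K) := IsFractionRing.injective R K
  let a : Fin r → K := fun i => algebraMap R K (y i)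
  have ha : ∀ Q : MvPolynomial (Fin r) F, aeval a Q = algebraMap R K (aeval y Q) := fun Q =>
    (aeval_algebraMap_apply K y Q)
  have hmin' : ∀ Q : MvPolynomial (Fin r) F, Q ≠ 0 → aeval a Q = 0 →
      P.totalDegree ≤ Q.totalDegree := fun Q hQ0 hQ =>
    hmin Q hQ0 (hinj (by rw [← ha, hQ, map_zero]))
  have haP : aeval a P = 0 := by rw [ha, hP, map_zero]
  have hirr := irreducible_of_forall_totalDegree_le hmin' hP0 haP
  refine ⟨hirr, ?_⟩
  have hsupp : ∃ i, ∃ σ ∈ P.support, ((σ i : ℕ) : F) ≠ 0 := by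
    obtain h0 | ⟨p, hp, hpF⟩ := CharP.exists' F
    · by_contra hcon
      push Not at hcon
      have hC : P.totalDegree = 0 := by
        rw [totalDegree_eq_zero_iff]
        intro σ hσ i
        have := hcon i σ hσ
        exact_mod_cast this
      rw [totalDegree_eq_zero_iff_eq_C] at hC
      rw [hC, aeval_C] at hP
      have : coeff 0 P = 0 := FaithfulSMul.algebraMap_injective F R (by rw [hP, map_zero])
      exact hP0 (by rw [hC, this, map_zero])
    · have : ExpChar F p := .prime hp.out
      have : CharP K p := .of_ringHom_of_ne_zero (algebraMap F K) p hp.out.ne_zero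
      obtain ⟨i, σ, hσ, hi⟩ := exists_mem_support_not_dvd_of_forall_totalDegree_le (K := K) p hp.out
        (fun s hs => by
          -- Raising to the `p`-th power preserves linear independence because scalars of `F` have
          -- `p`-th roots.
          refine hs.map_of_injective_injective (frobeniusEquiv F p).symm
            (frobenius K p).toAddMonoidHom (by simp) (by simp) fun c m => ?_
          change (_ • m) ^ p = c • m ^ p
          have hc : (frobeniusEquiv F p).symm c ^ p = c := (frobeniusEquiv F p).apply_symm_apply c
          rw [Algebra.smul_def, mul_pow, ← map_pow, hc, ← Algebra.smul_def])
        hmin' hP0 haP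
      exact ⟨i, σ, hσ, by rwa [Ne, CharP.cast_eq_zero_iff F p]⟩
  obtain ⟨i, σ, hσ, hi⟩ := hsupp
  refine ⟨i, fun h0 => ?_⟩
  have hσi : σ i ≠ 0 := fun h => hi (by rw [h, Nat.cast_zero])
  have hle : Finsupp.single i 1 ≤ σ := by
    rw [Finsupp.single_le_iff]; omega
  have h1 := coeff_pderiv (i := i) P (σ - Finsupp.single i 1)
  rw [h0, coeff_zero, tsub_add_cancel_of_le hle] at h1
  have h2 : (((σ - Finsupp.single i 1 : Fin r →₀ ℕ) i : ℕ) : F) + 1 = (σ i : F) := by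
    rw [Finsupp.tsub_apply, Finsupp.single_eq_same, Nat.cast_sub (by omega)]
    simp
  rw [h2] at h1
  exact mul_ne_zero (mem_support_iff.1 hσ) hi h1.symm

/-- The degree of the minimal relation is realized as a number of points in a fiber of `z`, which
`hD` bounds by `D`. Keeping `v` as a parameter allows the shear to be chosen generically. -/
theorem exists_relation_totalDegree_le {n r D : ℕ} (x : Fin n → R)
    (hx : Algebra.adjoin F (Set.range x) = ⊤) (htr : Algebra.trdeg F R = r)
    (y : Fin (r + 1) → R) (hy : AlgebraicIndependent F fun i : Fin r => y i.succ)
    (g : MvPolynomial (Fin r ⊕ Fin r) F) (hg : g ≠ 0)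
    (hD : ∀ v b : Fin r → F,
      AlgebraicIndependent F (fun i : Fin r => y i.succ + algebraMap F R (v i) * y 0) →
      eval (Sum.elim v b) g ≠ 0 → ∀ s : Finset (R →ₐ[F] F),
        (∀ ψ ∈ s, ∀ i : Fin r, ψ (y i.succ + algebraMap F R (v i) * y 0) = b i) → s.card ≤ D) :
    ∃ P : MvPolynomial (Fin (r + 1)) F, P ≠ 0 ∧ P.totalDegree ≤ D ∧ aeval y P = 0 := by
  have hdep : ¬ AlgebraicIndependent F y := by
    intro h
    have := h.lift_cardinalMk_le_trdeg
    rw [htr] at this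
    simp only [Cardinal.mk_fin, Cardinal.lift_natCast] at this
    have := Nat.cast_le.1 this
    omega
  obtain ⟨P, hP0, hPy, hmin⟩ := exists_minimal_relation hdep
  obtain ⟨hirr, i₀, hi₀⟩ := exists_pderiv_ne_zero_of_minimal_relation hP0 hPy hmin
  refine ⟨P, hP0, ?_, hPy⟩
  set δ := P.totalDegree with hδ
  have hPδ : homogeneousComponent δ P ≠ 0 := homogeneousComponent_totalDegree_ne_zero hP0
  have hQeval : ∀ v : Fin r → F,
      eval v (aeval (Fin.cons 1 fun i => -X i : Fin (r + 1) → MvPolynomial (Fin r) F)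
        (homogeneousComponent δ P)) =
      eval (Fin.cons 1 (-v) : Fin (r + 1) → F) (homogeneousComponent δ P) := by
    intro v
    rw [← aeval_eq_eval, ← aeval_eq_eval, ← AlgHom.comp_apply]
    congr 1
    ext i
    refine Fin.cases ?_ (fun i => ?_) i <;> simp
  -- A nonzero form is nonzero at some point `u` with `u 0 ≠ 0`; homogeneity permits rescaling to
  -- first coordinate `1`.
  have hQ : aeval (Fin.cons 1 fun i => -X i : Fin (r + 1) → MvPolynomial (Fin r) F)
      (homogeneousComponent δ P) ≠ 0 := by
    obtain ⟨u, hu⟩ := exists_eval_ne_zero (mul_ne_zero (X_ne_zero (R := F) (0 : Fin (r + 1))) hPδ)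
    rw [map_mul, eval_X] at hu
    intro h0
    have h1 := hQeval (fun i => -((u 0)⁻¹ * u i.succ))
    have h2 : (Fin.cons 1 (-fun i => -((u 0)⁻¹ * u i.succ)) : Fin (r + 1) → F) =
        (u 0)⁻¹ • u := by
      funext i
      refine Fin.cases ?_ (fun i => ?_) i
      · simp [left_ne_zero_of_mul hu]
      · simp
    rw [h0, map_zero, h2, eval_smul_of_isHomogeneous (homogeneousComponent_isHomogeneous δ P)] at h1
    exact mul_ne_zero (pow_ne_zero _ (inv_ne_zero (left_ne_zero_of_mul hu)))
      (right_ne_zero_of_mul hu) h1.symm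
  obtain ⟨a, ha⟩ := exists_eval_ne_zero hi₀
  have hLeval : ∀ v : Fin r → F, eval v (C (eval a (pderiv 0 P)) -
      ∑ i : Fin r, C (eval a (pderiv i.succ P)) * X i) =
      eval a (pderiv 0 P - ∑ i, C (v i) * pderiv i.succ P) := by
    intro v
    simp [mul_comm]
  have hL : (C (eval a (pderiv 0 P)) - ∑ i : Fin r, C (eval a (pderiv i.succ P)) * X i :
      MvPolynomial (Fin r) F) ≠ 0 := by
    intro h0
    rw [h0] at hLeval
    simp only [map_zero, map_sub, map_sum, map_mul, eval_C] at hLeval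
    have h1 : eval a (pderiv 0 P) = 0 := by simpa using (hLeval 0).symm
    refine ha (Fin.cases h1 (fun i => ?_) i₀)
    have := hLeval (Pi.single i 1)
    rw [h1, Finset.sum_eq_single i] at this
    · simpa using this
    · intro j _ hj
      simp [hj]
    · simp
  obtain ⟨w, hw⟩ := exists_eval_ne_zero hg
  have hGeval : ∀ v : Fin r → F, eval v (aeval (Sum.elim X fun i => C (w (.inr i))) g :
      MvPolynomial (Fin r) F) = eval (Sum.elim v fun i => w (.inr i)) g := by
    intro v
    rw [← aeval_eq_eval, ← aeval_eq_eval, ← AlgHom.comp_apply]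
    congr 1
    ext i
    rcases i with i | i <;> simp
  have hG : (aeval (Sum.elim X fun i => C (w (.inr i))) g : MvPolynomial (Fin r) F) ≠ 0 := by
    intro h0
    have := hGeval (fun i => w (.inl i))
    rw [h0, map_zero] at this
    have hwe : Sum.elim (fun i => w (.inl i)) (fun i => w (.inr i)) = w := Sum.elim_comp_inl_inr w
    rw [hwe] at this
    exact hw this.symm
  -- The three factors ensure, in this order, that `P` becomes monic, that it becomes separable in
  -- `X₀`, and that `g` stays nonzero after fixing `v`.
  obtain ⟨v, hv⟩ := exists_eval_ne_zero (mul_ne_zero (mul_ne_zero hQ hL) hG)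
  rw [map_mul, map_mul] at hv
  have hv1 := left_ne_zero_of_mul (left_ne_zero_of_mul hv)
  have hv2 := right_ne_zero_of_mul (left_ne_zero_of_mul hv)
  have hv3 := right_ne_zero_of_mul hv
  rw [hQeval] at hv1
  rw [hLeval] at hv2
  rw [hGeval] at hv3
  set q := eval (Fin.cons 1 (-v) : Fin (r + 1) → F) (homogeneousComponent δ P) with hq
  obtain ⟨hdeg, hcoeff⟩ := shearPoly_natDegree_le_and_coeff v P
  rw [← hδ, ← hq] at hcoeff
  have hCq : IsUnit (Polynomial.C (C q⁻¹ : MvPolynomial (Fin r) F)) :=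
    Polynomial.isUnit_C.2 ((isUnit_iff_ne_zero.2 (inv_ne_zero hv1)).map C)
  let h : Polynomial (MvPolynomial (Fin r) F) := Polynomial.C (C q⁻¹) * shearPoly v P
  have hcoeff' : h.coeff δ = 1 := by
    rw [Polynomial.coeff_C_mul, hcoeff, ← C_mul, inv_mul_cancel₀ hv1, C_1]
  have hdeg' : h.natDegree ≤ δ := (Polynomial.natDegree_C_mul_le _ _).trans hdeg
  have hnat : h.natDegree = δ := le_antisymm hdeg'
    (Polynomial.le_natDegree_of_ne_zero (by rw [hcoeff']; exact one_ne_zero))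
  have hmonic : h.Monic := Polynomial.monic_of_natDegree_le_of_coeff_eq_one δ hdeg' hcoeff'
  have hirr' : Irreducible h := by
    rw [irreducible_isUnit_mul hCq]
    exact (MulEquiv.irreducible_iff (finSuccEquiv F r)).2
      ((MulEquiv.irreducible_iff (shearEquiv v)).2 hirr)
  have hder : Polynomial.derivative h ≠ 0 := by
    rw [Polynomial.derivative_C_mul]
    refine mul_ne_zero hCq.ne_zero ?_
    rw [shearPoly, derivative_finSuccEquiv, pderiv_zero_shear]
    intro h0
    have h1 := (shearEquiv v).injective
      (((finSuccEquiv F r).injective (h0.trans (map_zero _).symm)).trans (map_zero _).symm)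
    rw [h1] at hv2
    exact hv2 (map_zero _)
  let z : Fin r → R := fun i => y i.succ + algebraMap F R (v i) * y 0
  have hroot : h.eval₂ (aeval z).toRingHom (y 0) = 0 := by
    rw [Polynomial.eval₂_mul, shearPoly, eval₂_finSuccEquiv, aeval_shear, hPy, mul_zero]
  -- Since `y 0` is integral over `F[z]`, so is each `y i.succ = z i - v i * y 0`. Hence `z` is
  -- again a transcendence basis.
  have hy0 : IsAlgebraic (Algebra.adjoin F (Set.range z)) (y 0) := by
    rw [Algebra.adjoin_range_eq_range_aeval]
    refine IsIntegral.isAlgebraic ⟨h.map (aeval z).rangeRestrict.toRingHom, hmonic.map _, ?_⟩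
    rw [Polynomial.eval₂_map]
    exact hroot
  have halg : Algebra.IsAlgebraic (Algebra.adjoin F (Set.range z)) R := by
    have hb : IsTranscendenceBasis F fun i : Fin r => y i.succ :=
      hy.isTranscendenceBasis_of_lift_trdeg_le_of_finite (by simp [htr])
    refine ⟨fun a => (hb.isAlgebraic.isAlgebraic a).adjoin_of_forall_isAlgebraic ?_⟩
    rintro _ ⟨⟨i, rfl⟩, -⟩
    have h1 : y i.succ = z i - algebraMap F R (v i) * y 0 := by simp [z]
    have hmem : ∀ a : R, a ∈ Algebra.adjoin F (Set.range z) →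
        IsAlgebraic (Algebra.adjoin F (Set.range z)) a := fun a ha =>
      isAlgebraic_algebraMap (⟨a, ha⟩ : Algebra.adjoin F (Set.range z))
    simp only [h1]
    exact (hmem _ (Algebra.subset_adjoin ⟨i, rfl⟩)).sub
      ((hmem _ (Subalgebra.algebraMap_mem _ _)).mul hy0)
  have hz : AlgebraicIndependent F z :=
    (Algebra.IsAlgebraic.isTranscendenceBasis_of_lift_le_trdeg_of_finite F z (by simp [htr])).1
  obtain ⟨g₂, hg₂, hcount⟩ := exists_algHoms_over_generic_point x hx z hz
    (fun j => halg.isAlgebraic (x j)) (y 0) h hmonic hirr' hder hroot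
  have hgbeval : ∀ b : Fin r → F, eval b (aeval (Sum.elim (fun i => C (v i)) X) g :
      MvPolynomial (Fin r) F) = eval (Sum.elim v b) g := by
    intro b
    rw [← aeval_eq_eval, ← aeval_eq_eval, ← AlgHom.comp_apply]
    congr 1
    ext i
    rcases i with i | i <;> simp
  have hgb : (aeval (Sum.elim (fun i => C (v i)) X) g : MvPolynomial (Fin r) F) ≠ 0 := by
    intro h0
    have := hgbeval (fun i => w (.inr i))
    rw [h0, map_zero] at this
    exact hv3 this.symm
  obtain ⟨b, hb⟩ := exists_eval_ne_zero (mul_ne_zero hg₂ hgb)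
  rw [map_mul, hgbeval] at hb
  obtain ⟨s, hs, hsz⟩ := hcount b (left_ne_zero_of_mul hb)
  rw [← hnat, ← hs]
  exact hD v b hz (right_ne_zero_of_mul hb) s hsz

end Relations

/-! ### Generic linear forms -/

section GenericForms

open MvPolynomial

variable {F R : Type*} [Field F] [CommRing R] [Algebra F R]

/-- Two bad parameters would make a nonzero multiple of `w i`, the difference of the two new
elements, algebraic over the remaining `w j`. -/
theorem subsingleton_setOf_not_algebraicIndependent_update [IsDomain R] {ι : Type*} [DecidableEq ι]
    {w : ι → R} (hw : AlgebraicIndependent F w) (i : ι) (u : R) :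
    {t : F | ¬ AlgebraicIndependent F
      (Function.update w i (u + algebraMap F R t * w i))}.Subsingleton := by
  have himage : ∀ a : R, Function.update w i a '' {i}ᶜ = w '' {i}ᶜ := by
    intro a
    refine Set.image_congr fun j hj => ?_
    exact Function.update_of_ne hj _ _
  have hw' := (AlgebraicIndependent.iff_transcendental_adjoin_image i).1 hw
  have key : ∀ t : F, ¬ AlgebraicIndependent F
      (Function.update w i (u + algebraMap F R t * w i)) →
      IsAlgebraic (Algebra.adjoin F (w '' {i}ᶜ)) (u + algebraMap F R t * w i) := by
    intro t ht
    rw [AlgebraicIndependent.iff_transcendental_adjoin_image i, himage, Function.update_self,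
      Transcendental, not_and, not_not] at ht
    apply ht
    convert hw'.1 using 2 with j
    exact Function.update_of_ne j.2 _ _
  intro t ht t' ht'
  by_contra hne
  have h1 := (key t ht).sub (key t' ht')
  have h2 : u + algebraMap F R t * w i - (u + algebraMap F R t' * w i) =
      algebraMap F R (t - t') * w i := by
    rw [map_sub]; ring
  rw [h2] at h1
  have h3 : IsAlgebraic (Algebra.adjoin F (w '' {i}ᶜ)) (algebraMap F R (t - t')⁻¹) :=
    isAlgebraic_algebraMap
      (⟨_, Subalgebra.algebraMap_mem _ _⟩ : Algebra.adjoin F (w '' {i}ᶜ))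
  have h4 := h3.mul h1
  rw [← mul_assoc, ← map_mul, inv_mul_cancel₀ (sub_ne_zero.2 hne), map_one, one_mul] at h4
  exact hw'.2 h4

/-- The independent coordinates are exchanged for linear forms one at a time. Perturbing the `i`-th
form along `x (j i)` leaves only finitely many bad parameters, those violating `H ≠ 0` included. -/
theorem exists_algebraicIndependent_linear_forms [Infinite F] [IsDomain R] {n r : ℕ}
    (x : Fin n → R) (j : Fin r → Fin n) (hj : AlgebraicIndependent F fun i => x (j i))
    (H : MvPolynomial (Fin r × Fin n) F) (A : Fin r → Fin n → F)
    (hA : eval (fun p => A p.1 p.2) H ≠ 0) :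
    ∃ A' : Fin r → Fin n → F, eval (fun p => A' p.1 p.2) H ≠ 0 ∧
      AlgebraicIndependent F fun i => ∑ l, algebraMap F R (A' i l) * x l := by
  classical
  suffices h : ∀ s : Finset (Fin r), ∃ A' : Fin r → Fin n → F,
      eval (fun p => A' p.1 p.2) H ≠ 0 ∧ AlgebraicIndependent F fun i =>
        if i ∈ s then ∑ l, algebraMap F R (A' i l) * x l else x (j i) by
    obtain ⟨A', h1, h2⟩ := h Finset.univ
    exact ⟨A', h1, by simpa using h2⟩
  intro s
  induction s using Finset.induction_on with
  | empty => exact ⟨A, hA, by simpa using hj⟩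
  | insert i s hi ih =>
    obtain ⟨A', h1, h2⟩ := ih
    set w : Fin r → R := fun i =>
      if i ∈ s then ∑ l, algebraMap F R (A' i l) * x l else x (j i) with hw
    let B : F → Fin r → Fin n → F := fun t =>
      Function.update A' i (fun l => A' i l + t * if l = j i then 1 else 0)
    let Q : Polynomial F := aeval (fun p : Fin r × Fin n => Polynomial.C (A' p.1 p.2) +
      Polynomial.X * Polynomial.C (if p.1 = i then if p.2 = j i then 1 else 0 else 0)) H
    have hQ : ∀ t, Q.eval t = eval (fun p => B t p.1 p.2) H := by
      intro t
      rw [← Polynomial.coe_aeval_eq_eval, ← aeval_eq_eval]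
      change ((Polynomial.aeval t).comp (aeval _)) H = _
      congr 1
      ext p
      simp only [AlgHom.comp_apply, aeval_X, map_add, map_mul, Polynomial.aeval_C,
        Polynomial.aeval_X, B]
      by_cases hp : p.1 = i
      · rw [hp]
        simp
      · simp [hp]
    have hB0 : B 0 = A' := by
      funext p l
      by_cases hp : p = i
      · subst hp; simp [B]
      · simp [B, hp]
    have hQ0 : Q ≠ 0 := by
      intro h0
      have := hQ 0
      rw [h0, Polynomial.eval_zero, hB0] at this
      exact h1 this.symm
    have hfin : ((Q.roots.toFinset : Set F) ∪ {t : F | ¬ AlgebraicIndependent F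
        (Function.update w i ((∑ l, algebraMap F R (A' i l) * x l) +
          algebraMap F R t * w i))}).Finite :=
      (Finset.finite_toSet _).union
        (subsingleton_setOf_not_algebraicIndependent_update h2 i _).finite
    obtain ⟨t, ht⟩ := hfin.exists_notMem
    simp only [Set.mem_union, Finset.mem_coe, Multiset.mem_toFinset, Set.mem_ofPred_eq,
      not_or, not_not] at ht
    refine ⟨B t, ?_, ?_⟩
    · rw [← hQ]
      intro h0
      exact ht.1 ((Polynomial.mem_roots hQ0).2 h0)
    · convert ht.2 using 1
      funext i'
      by_cases hi' : i' = i
      · subst hi'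
        simp only [Finset.mem_insert_self, if_true, Function.update_self, B, hw, hi, if_false,
          map_add, add_mul, Finset.sum_add_distrib]
        congr 1
        simp [apply_ite (algebraMap F R), ite_mul]
      · simp [hi', B, hw]

/-- Independence of the functions means that their vectors of values span `ι → F`; a basis chosen
among these vectors gives the points. -/
theorem exists_det_ne_zero_of_linearIndependent {X ι : Type*} [Fintype ι] [DecidableEq ι]
    {f : ι → X → F} (hf : LinearIndependent F f) :
    ∃ p : ι → X, (Matrix.of fun a b => f b (p a)).det ≠ 0 := by
  let e : X → ι → F := fun ξ i => f i ξ
  have hspan : Submodule.span F (Set.range e) = ⊤ := by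
    by_contra hne
    obtain ⟨φ, hφ0, hφ⟩ := Submodule.exists_le_ker_of_lt_top _ (lt_top_iff_ne_top.2 hne)
    apply hφ0
    have hsum : ∑ i, φ (fun l => if i = l then 1 else 0) • f i = 0 := by
      funext ξ
      have h1 : φ (e ξ) = 0 := hφ (Submodule.subset_span ⟨ξ, rfl⟩)
      rw [LinearMap.pi_apply_eq_sum_univ φ] at h1
      simp only [Finset.sum_apply, Pi.smul_apply, smul_eq_mul, Pi.zero_apply]
      refine Eq.trans ?_ h1
      exact Finset.sum_congr rfl fun i _ => by rw [smul_eq_mul, mul_comm]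
    have hc := Fintype.linearIndependent_iff.1 hf _ hsum
    refine LinearMap.ext fun u => ?_
    rw [LinearMap.pi_apply_eq_sum_univ φ]
    simp [hc]
  obtain ⟨g, hg, -, hgli⟩ := Submodule.exists_fun_fin_finrank_span_eq F (Set.range e)
  have hcard : Module.finrank F (Submodule.span F (Set.range e)) = Fintype.card ι := by
    rw [hspan, finrank_top, Module.finrank_fintype_fun_eq_card]
  choose p hp using hg
  let E : ι ≃ Fin (Module.finrank F (Submodule.span F (Set.range e))) :=
    (Fintype.equivFin ι).trans (finCongr hcard.symm)
  refine ⟨fun a => p (E a), ?_⟩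
  have hli : LinearIndependent F (Matrix.of fun a b => f b (p (E a))).row := by
    have heq : (Matrix.of fun a b => f b (p (E a))).row = g ∘ E := funext fun a => hp (E a)
    rw [heq]
    exact hgli.comp E E.injective
  rw [Matrix.linearIndependent_rows_iff_isUnit, Matrix.isUnit_iff_isUnit_det] at hli
  exact hli.ne_zero

end GenericForms

/-! ### Relations between the coordinates of a variety of bounded degree -/

section DegreeBound

open MvPolynomial

/-- Exponent vectors with entries at most `D`. -/
def boxExponent {r D : ℕ} (α : Fin r → Fin (D + 1)) : Fin r →₀ ℕ :=
  Finsupp.equivFunOnFinite.symm fun i => (α i : ℕ)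

@[simp] theorem boxExponent_apply {r D : ℕ} (α : Fin r → Fin (D + 1)) (i : Fin r) :
    boxExponent α i = α i := rfl

theorem boxExponent_injective {r D : ℕ} :
    Function.Injective (boxExponent : (Fin r → Fin (D + 1)) → _) := by
  intro α β h
  funext i
  exact Fin.ext (DFunLike.congr_fun h i)

variable {F : Type u} [Field F] {n r : ℕ}

theorem eval_eq_sum_box {D : ℕ} {P : MvPolynomial (Fin r) F}
    (hP : ∀ α ∈ P.support, ∀ i, α i ≤ D) (ξ : Fin r → F) :
    eval ξ P = ∑ α : Fin r → Fin (D + 1), P.coeff (boxExponent α) * ∏ i, ξ i ^ (α i : ℕ) := by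
  classical
  rw [eval_eq']
  have h1 : P.support ⊆ Finset.univ.image (boxExponent : (Fin r → Fin (D + 1)) → _) := by
    intro α hα
    refine Finset.mem_image.2 ⟨fun i => ⟨α i, Nat.lt_succ_of_le (hP α hα i)⟩, Finset.mem_univ _, ?_⟩
    ext i
    rfl
  rw [Finset.sum_subset h1, Finset.sum_image boxExponent_injective.injOn]
  · rfl
  · intro α _ hα
    rw [notMem_support_iff.1 hα, zero_mul]

/-- The coordinate functions of a set in its coordinate ring. -/
def coord (W : Set (Fin n → F)) (j : Fin n) : MvPolynomial (Fin n) F ⧸ vanishingIdeal F W :=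
  Ideal.Quotient.mk _ (X j)

theorem adjoin_range_coord (W : Set (Fin n → F)) :
    Algebra.adjoin F (Set.range (coord W)) = ⊤ := by
  have h := congrArg (Subalgebra.map (Ideal.Quotient.mkₐ F (vanishingIdeal F W)))
    (adjoin_range_X (R := F) (σ := Fin n))
  rw [AlgHom.map_adjoin, Algebra.map_top, ← Set.range_comp,
    (AlgHom.range_eq_top _).2 (Ideal.Quotient.mkₐ_surjective F _)] at h
  exact h

theorem aeval_coord (W : Set (Fin n → F)) (p : MvPolynomial (Fin n) F) :
    aeval (coord W) p = Ideal.Quotient.mk (vanishingIdeal F W) p := by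
  have : aeval (coord W) = Ideal.Quotient.mkₐ F (vanishingIdeal F W) := by
    ext i
    simp [coord]
  rw [this]
  rfl

/-- Evaluation at a point, on the coordinate ring. -/
def pointHom (W : Set (Fin n → F)) (ξ : Fin n → F) (hξ : ξ ∈ W) :
    (MvPolynomial (Fin n) F ⧸ vanishingIdeal F W) →ₐ[F] F :=
  Ideal.Quotient.liftₐ _ (aeval ξ) fun _ hp => hp ξ hξ

@[simp] theorem pointHom_coord (W : Set (Fin n → F)) (ξ : Fin n → F) (hξ : ξ ∈ W) (j : Fin n) :
    pointHom W ξ hξ (coord W j) = ξ j := by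
  simp [pointHom, coord]

theorem algHom_mem_of_isAffineVariety {W : Set (Fin n → F)} (hW : IsAffineVariety W)
    (ψ : (MvPolynomial (Fin n) F ⧸ vanishingIdeal F W) →ₐ[F] F) :
    (fun j => ψ (coord W j)) ∈ W := by
  have hmem : (fun j => ψ (coord W j)) ∈ zeroLocus F (vanishingIdeal F W) := by
    intro p hp
    have h1 : aeval (fun j => ψ (coord W j)) p = ψ (aeval (coord W) p) := by
      rw [← AlgHom.comp_apply, comp_aeval]
    rw [h1, aeval_coord, Ideal.Quotient.eq_zero_iff_mem.2 hp, map_zero]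
  rwa [hW.zeroLocus_vanishingIdeal] at hmem

theorem algHom_ext_coord {W : Set (Fin n → F)}
    {ψ ψ' : (MvPolynomial (Fin n) F ⧸ vanishingIdeal F W) →ₐ[F] F}
    (h : ∀ j, ψ (coord W j) = ψ' (coord W j)) : ψ = ψ' :=
  AlgHom.ext_of_adjoin_eq_top (adjoin_range_coord W) (by rintro _ ⟨j, rfl⟩; exact h j)

/-- The determinant of the values of all monomials with exponents at most `D` in the linear forms
with coefficients `A` at the points `p`, as a polynomial in `A`. -/
def monomialDet (D : ℕ) (p : (Fin r → Fin (D + 1)) → Fin n → F) :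
    MvPolynomial (Fin r × Fin n) F :=
  (Matrix.of fun β α : Fin r → Fin (D + 1) =>
    ∏ i, (∑ j, X (i, j) * C (p β j) : MvPolynomial (Fin r × Fin n) F) ^ (α i : ℕ)).det

theorem eval_monomialDet {D : ℕ} (p : (Fin r → Fin (D + 1)) → Fin n → F) (A : Fin r × Fin n → F) :
    eval A (monomialDet D p) = (Matrix.of fun β α : Fin r → Fin (D + 1) =>
      ∏ i, (∑ j, A (i, j) * p β j) ^ (α i : ℕ)).det := by
  rw [monomialDet, RingHom.map_det]
  congr 1
  ext β α
  simp

theorem linearIndependent_row_of_algebraicIndependent {R : Type*} [CommRing R] [Algebra F R]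
    (x : Fin n → R) (B : Matrix (Fin r) (Fin n) F)
    (h : AlgebraicIndependent F fun i => ∑ l, algebraMap F R (B i l) * x l) :
    LinearIndependent F B.row := by
  have : Nontrivial R := h.algebraMap_injective.nontrivial
  refine LinearIndependent.of_comp (Fintype.linearCombination F x) ?_
  have hcomp : Fintype.linearCombination F x ∘ B.row =
      fun i => ∑ l, algebraMap F R (B i l) * x l := by
    funext i
    simp [Fintype.linearCombination_apply, Algebra.smul_def]
  rw [hcomp]
  exact h.linearIndependent

variable [IsAlgClosed F]

/-- If the box monomials in the coordinates `T` were independent on `W`, so would be those in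
generic linear forms, because one determinant would not vanish identically. Generic forms, however,
satisfy a relation of total degree at most `D`. -/
theorem exists_relation_of_isGenericSectionNumber {W : Set (Fin n → F)}
    (hW : IsIrreducibleVariety W) {D : ℕ} (hD : IsGenericSectionNumber W (D : ℕ∞)) :
    ∃ r : ℕ, dim W = r ∧ ∀ T : Fin (r + 1) → Fin n, ∃ P : MvPolynomial (Fin (r + 1)) F,
      P ≠ 0 ∧ (∀ α ∈ P.support, ∀ i, α i ≤ D) ∧ ∀ ξ ∈ W, eval (fun i => ξ (T i)) P = 0 := by
  classical
  obtain ⟨r, hr, G, hG0, hG⟩ := hD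
  refine ⟨r, hr, fun T => ?_⟩
  by_contra hcon
  push Not at hcon
  let R := MvPolynomial (Fin n) F ⧸ vanishingIdeal F W
  have hprime : (vanishingIdeal F W).IsPrime := hW.isPrime_vanishingIdeal
  have hdom : IsDomain R := Ideal.Quotient.isDomain _
  let x : Fin n → R := coord W
  have hx : Algebra.adjoin F (Set.range x) = ⊤ := adjoin_range_coord W
  have htr : Algebra.trdeg F R = r := by
    obtain ⟨s, hs1, hs2⟩ := exists_ringKrullDim_eq_and_trdeg_eq F R
    rw [dim_eq_ringKrullDim hW.1, hs1] at hr
    have : s = r := by exact_mod_cast hr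
    rw [hs2, this]
  have hli : LinearIndependent F (fun (α : Fin (r + 1) → Fin (D + 1)) (ξ : W) =>
      ∏ i, ξ.1 (T i) ^ (α i : ℕ)) := by
    rw [Fintype.linearIndependent_iff]
    intro c hc
    by_contra hne
    push Not at hne
    obtain ⟨α₀, hα₀⟩ := hne
    let P : MvPolynomial (Fin (r + 1)) F := ∑ α, monomial (boxExponent α) (c α)
    have hcoeff : ∀ α, P.coeff (boxExponent α) = c α := by
      intro α
      simp only [P, coeff_sum, coeff_monomial, boxExponent_injective.eq_iff]
      simp
    have hP0 : P ≠ 0 := fun h0 => hα₀ (by rw [← hcoeff, h0, coeff_zero])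
    have hbox : ∀ α ∈ P.support, ∀ i, α i ≤ D := by
      intro α hα i
      have h1 := MvPolynomial.support_sum hα
      simp only [Finset.mem_biUnion, Finset.mem_univ, true_and] at h1
      obtain ⟨β, hβ⟩ := h1
      have := support_monomial_subset hβ
      rw [Finset.mem_singleton] at this
      rw [this, boxExponent_apply]
      omega
    obtain ⟨ξ, hξ, hξP⟩ := hcon P hP0 hbox
    apply hξP
    rw [eval_eq_sum_box hbox]
    have := congrFun hc ⟨ξ, hξ⟩
    simpa [hcoeff] using this
  obtain ⟨p, hp⟩ := exists_det_ne_zero_of_linearIndependent hli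
  let Δ := monomialDet (r := r + 1) (n := n) D fun β => (p β).1
  -- The coefficient matrix that selects the coordinates `T` specializes the determinant to the
  -- nonzero one.
  have hΔ : Δ ≠ 0 := by
    intro h0
    have h1 := eval_monomialDet (fun β => (p β).1)
      (fun q : Fin (r + 1) × Fin n => if q.2 = T q.1 then 1 else 0)
    change eval _ Δ = _ at h1
    rw [h0, map_zero] at h1
    apply hp
    rw [h1]
    congr 1
    ext β α
    simp
  obtain ⟨j, hj⟩ : ∃ j : Fin r → Fin n, AlgebraicIndependent F fun i => x (j i) := by
    have halg : Algebra.IsAlgebraic (Algebra.adjoin F (Set.range x)) R := by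
      rw [hx]
      exact ⟨fun a => isAlgebraic_algebraMap (⟨a, trivial⟩ : (⊤ : Subalgebra F R))⟩
    obtain ⟨t, ht, htb⟩ := exists_isTranscendenceBasis_subset (R := F) (Set.range x)
    have hcard : Cardinal.mk t = r := by rw [htb.cardinalMk_eq_trdeg, htr]
    have hfin : Finite t := Cardinal.lt_aleph0_iff_finite.1 (hcard ▸ Cardinal.natCast_lt_aleph0)
    have hnat : Nat.card t = r := by rw [Nat.card, hcard, Cardinal.toNat_natCast]
    let E : Fin r ≃ t := (Finite.equivFinOfCardEq hnat).symm
    choose j hj using fun i : Fin r => ht (E i).2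
    refine ⟨j, ?_⟩
    simp only [hj]
    exact htb.1.comp E E.injective
  let ρ : (Fin r × Fin n) ⊕ Fin r → (Fin (r + 1) × Fin n) ⊕ Fin r :=
    Sum.map (fun q => (q.1.succ, q.2)) id
  have hρ : Function.Injective ρ := by
    refine Sum.map_injective.2 ⟨fun q q' h => ?_, Function.injective_id⟩
    simp only [Prod.mk.injEq, Fin.succ_inj] at h
    exact Prod.ext h.1 h.2
  -- One point makes both genericity conditions hold: `Δ ≠ 0` for all `r + 1` forms, and `G ≠ 0` for
  -- the last `r` forms with right-hand side `b₀`.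
  obtain ⟨a, ha⟩ := exists_eval_ne_zero (mul_ne_zero
    ((map_ne_zero_iff (rename Sum.inl) (rename_injective (R := F) (Sum.inl :
      Fin (r + 1) × Fin n → (Fin (r + 1) × Fin n) ⊕ Fin r) Sum.inl_injective)).2 hΔ)
    ((map_ne_zero_iff (rename ρ) (rename_injective (R := F) ρ hρ)).2 hG0))
  let A₀ : Fin n → F := fun l => a (.inl (0, l))
  let b₀ : Fin r → F := fun i => a (.inr i)
  let full : (Fin r → Fin n → F) → Fin (r + 1) × Fin n → F := fun A q =>
    (Fin.cons A₀ A : Fin (r + 1) → Fin n → F) q.1 q.2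
  let H : MvPolynomial (Fin r × Fin n) F :=
    aeval (fun q : Fin (r + 1) × Fin n =>
      (Fin.cons (fun l => C (A₀ l)) (fun i l => X (i, l)) :
        Fin (r + 1) → Fin n → MvPolynomial (Fin r × Fin n) F) q.1 q.2) Δ *
    aeval (Sum.elim X fun i => C (b₀ i)) G
  have hH : ∀ A : Fin r → Fin n → F, eval (fun q => A q.1 q.2) H =
      eval (full A) Δ * eval (Sum.elim (fun q => A q.1 q.2) b₀) G := by
    intro A
    rw [map_mul]
    congr 1
    · rw [← aeval_eq_eval, ← aeval_eq_eval, ← AlgHom.comp_apply]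
      congr 1
      ext ⟨i, l⟩
      refine Fin.cases ?_ (fun i => ?_) i <;> simp [full]
    · rw [← aeval_eq_eval, ← aeval_eq_eval, ← AlgHom.comp_apply]
      congr 1
      ext q
      rcases q with q | q <;> simp
  have hstart : eval (fun q : Fin r × Fin n => a (.inl (q.1.succ, q.2))) H ≠ 0 := by
    rw [hH fun i l => a (.inl (i.succ, l))]
    rw [map_mul, eval_rename, eval_rename] at ha
    convert ha using 3
    · congr 1
      funext q
      obtain ⟨i, l⟩ := q
      refine Fin.cases ?_ (fun i => ?_) i <;> rfl
    · congr 1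
      funext q
      rcases q with q | q <;> rfl
  obtain ⟨A, hA, hAind⟩ := exists_algebraicIndependent_linear_forms x j hj H
    (fun i l => a (.inl (i.succ, l))) hstart
  rw [hH] at hA
  have hA1 := left_ne_zero_of_mul hA
  have hA2 := right_ne_zero_of_mul hA
  let y : Fin (r + 1) → R := fun i => ∑ l, algebraMap F R (full A (i, l)) * x l
  let g : MvPolynomial (Fin r ⊕ Fin r) F :=
    aeval (Sum.elim (fun q : Fin r × Fin n => C (A q.1 q.2) + X (.inl q.1) * C (A₀ q.2))
      fun i => X (.inr i)) G
  have hgeval : ∀ v b : Fin r → F, eval (Sum.elim v b) g =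
      eval (Sum.elim (fun q : Fin r × Fin n => A q.1 q.2 + v q.1 * A₀ q.2) b) G := by
    intro v b
    rw [← aeval_eq_eval, ← aeval_eq_eval, ← AlgHom.comp_apply]
    congr 1
    ext q
    rcases q with q | q <;> simp
  have hg0 : g ≠ 0 := by
    intro h0
    have := hgeval 0 b₀
    rw [h0, map_zero] at this
    apply hA2
    rw [this]
    simp
  have hz : ∀ (v : Fin r → F) (i : Fin r), y i.succ + algebraMap F R (v i) * y 0 =
      ∑ l, algebraMap F R (A i l + v i * A₀ l) * x l := by
    intro v i
    simp only [y, full, Fin.cons_succ, Fin.cons_zero, map_add, map_mul, add_mul,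
      Finset.sum_add_distrib, mul_assoc]
    rw [Finset.mul_sum]
  -- Homomorphisms to `F` with prescribed values of the sheared forms are points of `W` on an affine
  -- subspace of codimension `r`, and `G` certifies that this subspace is generic.
  obtain ⟨P, hP0, hPD, hPy⟩ := exists_relation_totalDegree_le (D := D) x hx htr y hAind g hg0 (by
    intro v b hind hgb s hs
    rw [hgeval] at hgb
    simp only [hz] at hind hs
    let B : Matrix (Fin r) (Fin n) F := Matrix.of fun i l => A i l + v i * A₀ l
    have hrow : LinearIndependent F B.row :=
      linearIndependent_row_of_algebraicIndependent x B hind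
    have hcard := hG B b hrow hgb
    have hle : ((s.image fun ψ => fun l => ψ (x l) : Finset (Fin n → F)) : Set (Fin n → F)) ⊆
        W ∩ {ξ | B.mulVec ξ = b} := by
      intro ξ hξ
      simp only [Finset.coe_image, Set.mem_image, Finset.mem_coe] at hξ
      obtain ⟨ψ, hψ, rfl⟩ := hξ
      refine ⟨algHom_mem_of_isAffineVariety hW.1 ψ, ?_⟩
      funext i
      have := hs ψ hψ i
      simp only [map_sum, map_mul, AlgHom.commutes] at this
      rw [← this]
      rfl
    have h1 := Set.encard_le_encard hle
    rw [hcard, Set.encard_coe_eq_coe_finsetCard, Finset.card_image_of_injective] at h1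
    · exact_mod_cast h1
    · intro ψ ψ' h
      exact algHom_ext_coord fun l => congrFun h l)
  have hbox : ∀ α ∈ P.support, ∀ i, α i ≤ D := fun α hα i =>
    (Finsupp.le_degree i α).trans ((le_totalDegree hα).trans hPD)
  apply hA1
  change eval _ (monomialDet D _) = 0
  rw [eval_monomialDet]
  apply Matrix.exists_mulVec_eq_zero_iff.1
  -- The coefficients of the relation form a nonzero kernel vector of the matrix of monomial values.
  refine ⟨fun α => P.coeff (boxExponent α), ?_, ?_⟩
  · intro h0
    apply hP0
    ext α
    by_contra hα
    have hα' := mem_support_iff.2 hα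
    have := congrFun h0 fun i => ⟨α i, Nat.lt_succ_of_le (hbox α hα' i)⟩
    apply hα
    rw [coeff_zero]
    have hα_eq :
        boxExponent (fun i => (⟨α i, Nat.lt_succ_of_le (hbox α hα' i)⟩ : Fin (D + 1))) = α :=
      Finsupp.ext fun _ => rfl
    simpa only [hα_eq, Pi.zero_apply] using this
  · funext β
    have h1 : pointHom W (p β).1 (p β).2 (aeval y P) =
        eval (fun i => ∑ l, full A (i, l) * (p β).1 l) P := by
      rw [← AlgHom.comp_apply, comp_aeval, ← aeval_eq_eval]
      congr 2
      funext i
      simp only [y, x, map_sum, map_mul, pointHom_coord]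
      exact Finset.sum_congr rfl fun l _ => by rw [AlgHom.commutes]; rfl
    rw [hPy, map_zero, eval_eq_sum_box hbox] at h1
    rw [Pi.zero_apply, h1]
    exact Finset.sum_congr rfl fun α _ => mul_comm _ _

end DegreeBound

/-! ### Finite fibers and dimension of images -/

section Condenser

open MvPolynomial

variable {F : Type u} [Field F] {n m : ℕ}

theorem eval_aeval_polyMap (f : Fin m → MvPolynomial (Fin n) F) (p : MvPolynomial (Fin m) F)
    (ξ : Fin n → F) : eval ξ (aeval f p) = eval (polyMap f ξ) p := by
  rw [← aeval_eq_eval, ← aeval_eq_eval, ← AlgHom.comp_apply, comp_aeval]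
  rfl

theorem vanishingIdeal_image_polyMap (f : Fin m → MvPolynomial (Fin n) F) (V : Set (Fin n → F)) :
    vanishingIdeal F (polyMap f '' V) =
      (vanishingIdeal F V).comap (aeval f : MvPolynomial (Fin m) F →ₐ[F] _) := by
  ext p
  simp only [Ideal.mem_comap, mem_vanishingIdeal_iff, Set.forall_mem_image, aeval_eq_eval,
    eval_aeval_polyMap]

theorem vanishingIdeal_zariskiClosure (S : Set (Fin n → F)) :
    vanishingIdeal F (zariskiClosure S) = vanishingIdeal F S := by
  apply le_antisymm
  · exact vanishingIdeal_anti_mono fun ξ hξ p hp => hp ξ hξ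
  · exact fun p hp ξ hξ => hξ p hp

/-- Integrality of the coordinates on `V` over the image of the polynomial map `f`, in terms of
polynomials. -/
def IsIntegralOn (f : Fin m → MvPolynomial (Fin n) F) (V : Set (Fin n → F)) : Prop :=
  ∀ j, ∃ p : Polynomial (MvPolynomial (Fin m) F), p.Monic ∧
    p.eval₂ (aeval f : MvPolynomial (Fin m) F →ₐ[F] MvPolynomial (Fin n) F).toRingHom (X j) ∈
      vanishingIdeal F V

/-- On a fiber each coordinate is a root of a monic polynomial with constant coefficients. -/
theorem IsIntegralOn.finite_fiber {f : Fin m → MvPolynomial (Fin n) F} {V : Set (Fin n → F)}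
    (h : IsIntegralOn f V) (b : Fin m → F) : (polyMap f ⁻¹' {b} ∩ V).Finite := by
  classical
  choose p hp hpV using h
  refine (Set.Finite.pi' fun j => ((p j).map (eval b)).roots.toFinset.finite_toSet).subset ?_
  rintro ξ ⟨hξb, hξV⟩ j
  have hb : polyMap f ξ = b := hξb
  have h1 := hpV j ξ hξV
  rw [aeval_eq_eval, Polynomial.hom_eval₂, eval_X] at h1
  rw [Finset.mem_coe, Multiset.mem_toFinset, Polynomial.mem_roots ((hp j).map _).ne_zero,
    Polynomial.IsRoot, Polynomial.eval_map, ← h1]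
  congr 1
  ext q
  · simp
  · simp [← hb, polyMap]

theorem IsIntegralOn.ringKrullDim_eq {f : Fin m → MvPolynomial (Fin n) F} {V : Set (Fin n → F)}
    (h : IsIntegralOn f V) :
    ringKrullDim (MvPolynomial (Fin m) F ⧸ vanishingIdeal F (polyMap f '' V)) =
      ringKrullDim (MvPolynomial (Fin n) F ⧸ vanishingIdeal F V) := by
  rw [vanishingIdeal_image_polyMap]
  set I := vanishingIdeal F V
  let φ : (MvPolynomial (Fin m) F ⧸ I.comap (aeval f : MvPolynomial (Fin m) F →ₐ[F] _)) →ₐ[F]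
      MvPolynomial (Fin n) F ⧸ I := Ideal.quotientMapₐ I (aeval f) le_rfl
  have hφ : Function.Injective φ :=
    Ideal.quotientMap_injective' (f := (aeval f : MvPolynomial (Fin m) F →ₐ[F] _).toRingHom)
      (H := le_rfl) le_rfl
  let _ := φ.toRingHom.toAlgebra
  have htower : IsScalarTower F
      (MvPolynomial (Fin m) F ⧸ I.comap (aeval f : MvPolynomial (Fin m) F →ₐ[F] _))
      (MvPolynomial (Fin n) F ⧸ I) := IsScalarTower.of_algebraMap_eq fun a => (φ.commutes a).symm
  have hint : Algebra.IsIntegral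
      (MvPolynomial (Fin m) F ⧸ I.comap (aeval f : MvPolynomial (Fin m) F →ₐ[F] _))
      (MvPolynomial (Fin n) F ⧸ I) := by
    refine ⟨fun a => ?_⟩
    have hle : Algebra.adjoin F (Set.range (coord V)) ≤ (integralClosure
        (MvPolynomial (Fin m) F ⧸ I.comap (aeval f : MvPolynomial (Fin m) F →ₐ[F] _))
        (MvPolynomial (Fin n) F ⧸ I)).restrictScalars F := by
      refine Algebra.adjoin_le ?_
      rintro _ ⟨j, rfl⟩
      obtain ⟨p, hp, hpV⟩ := h j
      refine ⟨p.map (Ideal.Quotient.mk _), hp.map _, ?_⟩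
      have h0 := Ideal.Quotient.eq_zero_iff_mem.2 hpV
      rw [Polynomial.hom_eval₂] at h0
      rw [Polynomial.eval₂_map]
      exact h0
    rw [adjoin_range_coord] at hle
    exact hle (Algebra.mem_top (x := a))
  exact (ringKrullDim_eq_of_isIntegral _ _ hφ).symm

variable [IsAlgClosed F]

theorem IsIntegralOn.dim_image {f : Fin m → MvPolynomial (Fin n) F} {V : Set (Fin n → F)}
    (hV : IsAffineVariety V) (h : IsIntegralOn f V) :
    dim (zariskiClosure (polyMap f '' V)) = dim V := by
  rw [dim_eq_ringKrullDim hV, ← h.ringKrullDim_eq,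
    dim_eq_ringKrullDim (V := zariskiClosure _) (isAffineVariety_zeroLocus _),
    vanishingIdeal_zariskiClosure]

theorem isIntegralOn_of_components {f : Fin m → MvPolynomial (Fin n) F} {V : Set (Fin n → F)}
    (hV : IsAffineVariety V) (h : ∀ W ∈ components V, IsIntegralOn f W) : IsIntegralOn f V := by
  intro j
  have hfin := finite_components hV
  choose! p hp hpW using fun W hW => h W hW j
  refine ⟨∏ W ∈ hfin.toFinset, p W,
    Polynomial.monic_prod_of_monic _ _ fun W hW => hp W (by simpa using hW), ?_⟩
  intro ξ hξ
  obtain ⟨W, hW, hξW⟩ := exists_mem_components hV hξ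
  rw [Polynomial.eval₂_finsetProd, map_prod]
  exact Finset.prod_eq_zero (by simpa using hW) (hpW W hW ξ hξW)

theorem isIntegralOn_diagonalPolys {k d : ℕ} {M : Matrix (Fin m) (Fin n) F}
    (hM : IsRegularMatrix k M) (hkn : k ≤ n) {e : Fin n → ℕ} (hd : ∀ j, d < e j)
    (he : Pairwise fun j j' => Nat.Coprime (e j) (e j')) {W : Set (Fin n → F)}
    (hW : IsIrreducibleVariety W) (hdim : dim W ≤ (k : WithBot ℕ∞))
    (hdeg : irreducibleDegree W ≤ (d : ℕ∞)) : IsIntegralOn (diagonalPolys M e) W := by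
  intro j
  obtain ⟨D, hDd, hD⟩ := exists_isGenericSectionNumber_le hdeg
  obtain ⟨r, hr, hrel⟩ := exists_relation_of_isGenericSectionNumber hW hD
  have hrk : r ≤ k := by
    rw [hr] at hdim
    exact_mod_cast hdim
  have hprime := hW.isPrime_vanishingIdeal
  let π : MvPolynomial (Fin n) F →ₐ[F] FractionRing (MvPolynomial (Fin n) F ⧸ vanishingIdeal F W) :=
    (IsScalarTower.toAlgHom F (MvPolynomial (Fin n) F ⧸ vanishingIdeal F W) _).comp
      (Ideal.Quotient.mkₐ F _)
  have hπ : ∀ q, π q = 0 ↔ q ∈ vanishingIdeal F W := by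
    intro q
    rw [← Ideal.Quotient.eq_zero_iff_mem]
    let R := MvPolynomial (Fin n) F ⧸ vanishingIdeal F W
    exact map_eq_zero_iff (algebraMap R (FractionRing R))
      (IsFractionRing.injective _ _)
  have hint := isIntegral_of_diagonal hM hkn hrk hd he (fun j => π (X j)) (fun T => by
    obtain ⟨P, hP0, hPD, hPW⟩ := hrel T
    refine ⟨P, hP0, fun α hα i => (hPD α hα i).trans hDd, ?_⟩
    have h1 : aeval ((fun j => π (X j)) ∘ T) P = π (rename T P) := by
      rw [← AlgHom.comp_apply]
      congr 1
      ext i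
      simp
    rw [h1, hπ]
    intro ξ hξ
    rw [aeval_eq_eval, eval_rename]
    exact hPW ξ hξ) j
  have hy : (fun i => ∑ j, algebraMap F (FractionRing (MvPolynomial (Fin n) F ⧸
      vanishingIdeal F W)) (M i j) * π (X j) ^ e j) = fun i => π (diagonalPolys M e i) := by
    funext i
    simp only [diagonalPolys, map_sum, map_mul, map_pow]
    exact Finset.sum_congr rfl fun l _ => by rw [← algebraMap_eq, AlgHom.commutes]
  rw [hy, Algebra.adjoin_range_eq_range_aeval] at hint
  obtain ⟨q, hq, hq0⟩ := hint
  -- The integral equation has coefficients in the image of `F[Y₁, …, Yₘ]`; it is lifted to a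
  -- polynomial that is still monic.
  obtain ⟨p, hpq, -, hp⟩ := Polynomial.lifts_and_natDegree_eq_and_monic
    (f := (aeval fun i => π (diagonalPolys M e i)).rangeRestrict.toRingHom) (p := q)
    (Polynomial.map_surjective _ (AlgHom.rangeRestrict_surjective _) q) hq
  refine ⟨p, hp, (hπ _).1 ?_⟩
  rw [← hpq, Polynomial.eval₂_map] at hq0
  change π.toRingHom _ = 0
  rw [Polynomial.hom_eval₂, ← hq0]
  congr 1
  ext i
  · simp
  · simp

theorem isIntegralOn_of_degree_le {k d : ℕ} {M : Matrix (Fin m) (Fin n) F}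
    (hM : IsRegularMatrix k M) (hkn : k ≤ n) {e : Fin n → ℕ} (hd : ∀ j, d < e j)
    (he : Pairwise fun j j' => Nat.Coprime (e j) (e j')) {V : Set (Fin n → F)}
    (hV : IsAffineVariety V) (hdim : dim V ≤ (k : WithBot ℕ∞)) (hdeg : degree V ≤ (d : ℕ∞)) :
    IsIntegralOn (diagonalPolys M e) V :=
  isIntegralOn_of_components hV fun _ hW => isIntegralOn_diagonalPolys hM hkn hd he hW.1.1
    ((dim_mono hW.1.2).trans hdim) ((irreducibleDegree_le_degree hV hW).trans hdeg)

theorem isRankCondenser_diagonalPolys {k d : ℕ} {M : Matrix (Fin m) (Fin n) F}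
    (hM : IsRegularMatrix k M) (hkn : k ≤ n) {e : Fin n → ℕ} (hd : ∀ j, d < e j)
    (he : Pairwise fun j j' => Nat.Coprime (e j) (e j')) :
    IsRankCondenser k d (diagonalPolys M e) := fun _ hV hdim hdeg =>
  (isIntegralOn_of_degree_le hM hkn hd he hV hdim hdeg).dim_image hV

end Condenser

/-! ### Primes -/

section Primes

/-- Chebyshev's lower bound for `π(p)`, used twice: with `log (p + 1) ≤ 2 √(p + 1)` it shows that
`p` is polynomial in `k`, so `log (p + 1) ≤ 8 log (k + 2)`, and this estimate is fed back. -/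
theorem nth_prime_le (k : ℕ) :
    (Nat.nth Nat.Prime k : ℝ) ≤ 8 * ((k + 2) * Real.logb 2 (k + 2)) := by
  set p := Nat.nth Nat.Prime k with hp
  have hp2 : (2 : ℝ) ≤ p := by exact_mod_cast (Nat.prime_nth_prime k).two_le
  have hcount : Nat.primeCounting p = k + 1 := by
    rw [Nat.primeCounting, Nat.primeCounting', hp,
      Nat.count_nth_succ_of_infinite Nat.infinite_setOfPred_prime]
  have hlogp : 0 < Real.log p := Real.log_pos (by linarith)
  have h1 := Chebyshev.pi_ge p
  rw [hcount, div_le_iff₀ hlogp] at h1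
  push_cast at h1
  have hlog2 : (0.69 : ℝ) < Real.log 2 := lt_trans (by norm_num) Real.log_two_gt_d9
  have hmono : Real.log p ≤ Real.log (p + 1) := Real.log_le_log (by linarith) (by linarith)
  have hk : (0 : ℝ) ≤ k := Nat.cast_nonneg k
  have h2 : (p : ℝ) * Real.log 2 ≤ (k + 2) * Real.log (p + 1) := by nlinarith
  have hsqrt : Real.log (p + 1) ≤ 2 * Real.sqrt (p + 1) := by
    have hpos : 0 < Real.sqrt ((p : ℝ) + 1) := Real.sqrt_pos.2 (by linarith)
    have h3 := Real.log_le_sub_one_of_pos hpos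
    rw [Real.log_sqrt (by linarith)] at h3
    linarith
  set w := Real.sqrt ((p : ℝ) + 1) with hw
  have hw2 : w ^ 2 = p + 1 := Real.sq_sqrt (by linarith)
  have hw0 : 0 < w := Real.sqrt_pos.2 (by linarith)
  have h4 : w ≤ 8 * (k + 2) := by
    have h5 : (w ^ 2) * (2 / 3) ≤ p := by linarith
    have h6 : w ^ 2 * (2 / 3) * 0.69 ≤ (k + 2) * (2 * w) := by
      calc w ^ 2 * (2 / 3) * 0.69 ≤ p * Real.log 2 := by
            apply mul_le_mul h5 hlog2.le (by norm_num) (by linarith)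
        _ ≤ (k + 2) * Real.log (p + 1) := h2
        _ ≤ (k + 2) * (2 * w) := by gcongr
    nlinarith
  have h7 : (p : ℝ) + 1 ≤ (k + 2) ^ 8 := by
    have h8 : (2 : ℝ) ^ 6 ≤ (k + 2) ^ 6 := by gcongr; linarith
    calc (p : ℝ) + 1 = w ^ 2 := hw2.symm
      _ ≤ (8 * (k + 2)) ^ 2 := by gcongr
      _ = 2 ^ 6 * (k + 2) ^ 2 := by ring
      _ ≤ (k + 2) ^ 6 * (k + 2) ^ 2 := by gcongr
      _ = (k + 2) ^ 8 := by ring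
  have h9 : Real.log (p + 1) ≤ 8 * Real.log (k + 2) := by
    calc Real.log (p + 1) ≤ Real.log ((k + 2) ^ 8) := Real.log_le_log (by linarith) h7
      _ = 8 * Real.log (k + 2) := by rw [Real.log_pow]; norm_num
  rw [Real.logb, ← mul_div_assoc, ← mul_div_assoc, le_div_iff₀ (by linarith)]
  nlinarith

/-- The least prime which is at least `q`. -/
def nextPrime (q : ℕ) : ℕ := Nat.nth Nat.Prime (Nat.count Nat.Prime q)

theorem prime_nextPrime (q : ℕ) : (nextPrime q).Prime := Nat.prime_nth_prime _

theorem le_nextPrime (q : ℕ) : q ≤ nextPrime q :=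
  Nat.le_nth_count Nat.infinite_setOfPred_prime q

theorem not_prime_of_lt_nextPrime {q q' : ℕ} (h1 : q ≤ q') (h2 : q' < nextPrime q) :
    ¬ q'.Prime := by
  intro h
  have h4 : Nat.count Nat.Prime q ≤ Nat.count Nat.Prime q' := Nat.count_monotone _ h1
  have h5 := (Nat.nth_monotone Nat.infinite_setOfPred_prime) h4
  rw [Nat.nth_count h] at h5
  exact absurd h2 (not_lt.2 h5)

/-- The bounds from which the primes `primeFrom q₀ j` are searched. -/
def primeStart (q₀ : ℕ) : ℕ → ℕ
  | 0 => q₀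
  | j + 1 => nextPrime (primeStart q₀ j) + 1

/-- The `j`-th prime, counted from `0`, which is at least `q₀`. -/
def primeFrom (q₀ j : ℕ) : ℕ := nextPrime (primeStart q₀ j)

theorem count_primeStart (q₀ j : ℕ) :
    Nat.count Nat.Prime (primeStart q₀ j) = Nat.count Nat.Prime q₀ + j := by
  induction j with
  | zero => rfl
  | succ j ih =>
    rw [primeStart, nextPrime, Nat.count_nth_succ_of_infinite Nat.infinite_setOfPred_prime, ih]
    rfl

theorem primeFrom_eq (q₀ j : ℕ) :
    primeFrom q₀ j = Nat.nth Nat.Prime (Nat.count Nat.Prime q₀ + j) := by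
  rw [primeFrom, nextPrime, count_primeStart]

theorem prime_primeFrom (q₀ j : ℕ) : (primeFrom q₀ j).Prime := prime_nextPrime _

theorem primeFrom_strictMono (q₀ : ℕ) : StrictMono (primeFrom q₀) := by
  intro i j hij
  rw [primeFrom_eq, primeFrom_eq]
  exact Nat.nth_strictMono Nat.infinite_setOfPred_prime (by omega)

theorem le_primeStart (q₀ j : ℕ) : q₀ ≤ primeStart q₀ j := by
  induction j with
  | zero => rfl
  | succ j ih => exact ih.trans ((le_nextPrime _).trans (Nat.le_succ _))

theorem le_primeFrom (q₀ j : ℕ) : q₀ ≤ primeFrom q₀ j :=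
  (le_primeStart q₀ j).trans (le_nextPrime _)

theorem count_prime_le (k : ℕ) : Nat.count Nat.Prime (k + 2) ≤ k := by
  rw [Nat.count_le_iff_le_nth Nat.infinite_setOfPred_prime]
  exact Nat.add_two_le_nth_prime k

/-- At most `q₀ - 2` primes lie below `q₀`, so the prime in question has index at most `N - 2`. -/
theorem primeFrom_le {q₀ j N : ℕ} (hq₀ : 2 ≤ q₀) (h : q₀ + j ≤ N) :
    (primeFrom q₀ j : ℝ) ≤ 8 * (N * Real.logb 2 N) := by
  obtain ⟨k, rfl⟩ := Nat.exists_eq_add_of_le' hq₀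
  have h1 := count_prime_le k
  have h2 : Nat.nth Nat.Prime (Nat.count Nat.Prime (k + 2) + j) ≤ Nat.nth Nat.Prime (N - 2) :=
    Nat.nth_monotone Nat.infinite_setOfPred_prime (by omega)
  have h3 := nth_prime_le (N - 2)
  have h4 : ((N - 2 : ℕ) : ℝ) + 2 = N := by
    rw [Nat.cast_sub (by omega)]
    push_cast
    ring
  rw [h4] at h3
  rw [primeFrom_eq]
  exact le_trans (by exact_mod_cast h2) h3

/-- The exponents of the construction: the least powers of successive primes exceeding `d`. -/
def primePowerFrom (q₀ d j : ℕ) : ℕ := primeFrom q₀ j ^ (Nat.log (primeFrom q₀ j) d + 1)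

theorem lt_primePowerFrom (q₀ d j : ℕ) : d < primePowerFrom q₀ d j :=
  Nat.lt_pow_succ_log_self (prime_primeFrom q₀ j).one_lt d

theorem coprime_primePowerFrom (q₀ d : ℕ) {i j : ℕ} (h : i ≠ j) :
    Nat.Coprime (primePowerFrom q₀ d i) (primePowerFrom q₀ d j) :=
  Nat.Coprime.pow _ _ ((Nat.coprime_primes (prime_primeFrom q₀ i) (prime_primeFrom q₀ j)).2
    fun h' => h ((primeFrom_strictMono q₀).injective h'))

theorem primePowerFrom_le (q₀ j : ℕ) {d : ℕ} (hd : 1 ≤ d) :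
    primePowerFrom q₀ d j ≤ primeFrom q₀ j * d := by
  rw [primePowerFrom, pow_succ']
  exact Nat.mul_le_mul_left _ (Nat.pow_log_le_self _ (by omega))

theorem primePowerFrom_of_lt {q₀ d : ℕ} (j : ℕ) (h : d < q₀) :
    primePowerFrom q₀ d j = primeFrom q₀ j := by
  rw [primePowerFrom, Nat.log_of_lt (h.trans_le (le_primeFrom q₀ j)), zero_add, pow_one]

end Primes

/-! ### Running programs -/

section Running

/-- The program `p` transforms `s` into `s'`, with cost at most `T` times the cost of handling the
number `N`. -/
def Runs (N : ℕ) (p : Program) (s s' : State) (T : ℕ) : Prop :=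
  ∃ t, Exec p s s' t ∧ t ≤ T * bitCost N

/-- The state in which the first registers contain the list `l` and the other ones zero. -/
def listState (l o : List ℕ) : State := ⟨fun r => l.getD r 0, o⟩

variable {N : ℕ}

theorem bitCost_mono {x y : ℕ} (h : x ≤ y) : bitCost x ≤ bitCost y :=
  Nat.succ_le_succ (Nat.size_le_size h)

theorem listState_set {l : List ℕ} (o : List ℕ) {r : ℕ} (hr : r < l.length) (v : ℕ) :
    (listState l o).set r v = listState (l.set r v) o := by
  simp only [listState, State.set]
  congr 1
  funext x
  by_cases hx : x = r
  · subst hx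
    simp [List.getD_eq_getElem?_getD, hr]
  · rw [Function.update_of_ne hx]
    simp [List.getD_eq_getElem?_getD, Ne.symm hx]

theorem Runs.mono {p : Program} {s s' : State} {T T' : ℕ} (h : Runs N p s s' T) (hT : T ≤ T') :
    Runs N p s s' T' := by
  obtain ⟨t, h1, h2⟩ := h
  exact ⟨t, h1, h2.trans (Nat.mul_le_mul_right _ hT)⟩

theorem Runs.skip (s : State) : Runs N .skip s s 1 :=
  ⟨1, .skip s, by simp [bitCost]⟩

theorem Runs.const {l o : List ℕ} {dst v : ℕ} (hdst : dst < l.length) (hv : v ≤ N) :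
    Runs N (.const dst v) (listState l o) (listState (l.set dst v) o) 1 :=
  ⟨bitCost v, listState_set o hdst v ▸ Exec.const (listState l o) dst v, by
    rw [one_mul]; exact bitCost_mono hv⟩

theorem bitCost_add_le {x y : ℕ} (hx : x ≤ N) (hy : y ≤ N) :
    bitCost x + bitCost y ≤ 2 * bitCost N := by
  have := bitCost_mono hx
  have := bitCost_mono hy
  omega

theorem Runs.add {l o : List ℕ} {dst a b : ℕ} (hdst : dst < l.length) (ha : l.getD a 0 ≤ N)
    (hb : l.getD b 0 ≤ N) : Runs N (.add dst a b) (listState l o)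
      (listState (l.set dst (l.getD a 0 + l.getD b 0)) o) 2 :=
  ⟨_, listState_set o hdst _ ▸ Exec.add (listState l o) dst a b, bitCost_add_le ha hb⟩

theorem Runs.sub {l o : List ℕ} {dst a b : ℕ} (hdst : dst < l.length) (ha : l.getD a 0 ≤ N)
    (hb : l.getD b 0 ≤ N) : Runs N (.sub dst a b) (listState l o)
      (listState (l.set dst (l.getD a 0 - l.getD b 0)) o) 2 :=
  ⟨_, listState_set o hdst _ ▸ Exec.sub (listState l o) dst a b, bitCost_add_le ha hb⟩

theorem Runs.mul {l o : List ℕ} {dst a b : ℕ} (hdst : dst < l.length) (ha : l.getD a 0 ≤ N)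
    (hb : l.getD b 0 ≤ N) : Runs N (.mul dst a b) (listState l o)
      (listState (l.set dst (l.getD a 0 * l.getD b 0)) o) 2 :=
  ⟨_, listState_set o hdst _ ▸ Exec.mul (listState l o) dst a b, bitCost_add_le ha hb⟩

theorem Runs.mod {l o : List ℕ} {dst a b : ℕ} (hdst : dst < l.length) (ha : l.getD a 0 ≤ N)
    (hb : l.getD b 0 ≤ N) : Runs N (.mod dst a b) (listState l o)
      (listState (l.set dst (l.getD a 0 % l.getD b 0)) o) 2 :=
  ⟨_, listState_set o hdst _ ▸ Exec.mod (listState l o) dst a b, bitCost_add_le ha hb⟩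

theorem Runs.write {l o : List ℕ} {src : ℕ} (h : l.getD src 0 ≤ N) :
    Runs N (.write src) (listState l o) (listState l (o ++ [l.getD src 0])) 1 :=
  ⟨_, .write (listState l o) src, by
    rw [one_mul]; exact bitCost_mono h⟩

theorem Runs.seq {p q : Program} {s s' s'' : State} {T T' : ℕ} (h : Runs N p s s' T)
    (h' : Runs N q s' s'' T') : Runs N (.seq p q) s s'' (T + T') := by
  obtain ⟨t, h1, h2⟩ := h
  obtain ⟨t', h1', h2'⟩ := h'
  exact ⟨_, .seq _ _ _ _ _ _ _ h1 h1', by rw [add_mul]; omega⟩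

theorem Runs.ifTrue {p q : Program} {l o : List ℕ} {s' : State} {r T : ℕ} (hr : l.getD r 0 ≤ N)
    (h0 : l.getD r 0 ≠ 0) (h : Runs N p (listState l o) s' T) :
    Runs N (.ifNonzero r p q) (listState l o) s' (T + 1) := by
  obtain ⟨t, h1, h2⟩ := h
  refine ⟨_, .ifTrue r p q _ _ _ h0 h1, ?_⟩
  have := bitCost_mono hr
  change bitCost (l.getD r 0) + t ≤ _
  rw [add_mul, one_mul]
  omega

theorem Runs.ifFalse {p q : Program} {l o : List ℕ} {s' : State} {r T : ℕ}
    (h0 : l.getD r 0 = 0) (h : Runs N q (listState l o) s' T) :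
    Runs N (.ifNonzero r p q) (listState l o) s' (T + 1) := by
  obtain ⟨t, h1, h2⟩ := h
  refine ⟨_, .ifFalse r p q _ _ _ h0 h1, ?_⟩
  have := bitCost_mono (Nat.zero_le N)
  change bitCost (l.getD r 0) + t ≤ _
  rw [add_mul, one_mul, h0]
  omega

/-- The loop invariant is explicit: `l i` and `o i` are the registers and the output after `i` of
the `K` passes. -/
theorem Runs.while {p : Program} {r T : ℕ} (K : ℕ) (l o : ℕ → List ℕ)
    (hr : ∀ i < K, (l i).getD r 0 ≤ N) (hpos : ∀ i < K, (l i).getD r 0 ≠ 0)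
    (hzero : (l K).getD r 0 = 0)
    (hbody : ∀ i < K, Runs N p (listState (l i) (o i)) (listState (l (i + 1)) (o (i + 1))) T) :
    Runs N (.whileNonzero r p) (listState (l 0) (o 0)) (listState (l K) (o K))
      (K * (T + 1) + 1) := by
  induction K generalizing l o with
  | zero =>
    refine ⟨_, .whileDone r p _ hzero, ?_⟩
    change bitCost ((l 0).getD r 0) ≤ _
    rw [hzero]
    simpa using bitCost_mono (Nat.zero_le N)
  | succ K ih =>
    obtain ⟨t, h1, h2⟩ := hbody 0 (by omega)
    obtain ⟨t', h1', h2'⟩ := ih (fun i => l (i + 1)) (fun i => o (i + 1))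
      (fun i hi => hr _ (by omega)) (fun i hi => hpos _ (by omega)) hzero
      (fun i hi => hbody _ (by omega))
    refine ⟨_, .whileStep r p _ _ _ _ _ (hpos 0 (by omega)) h1 h1', ?_⟩
    have := bitCost_mono (hr 0 (by omega))
    change bitCost ((l 0).getD r 0) + t + t' ≤ _
    have e : ((K + 1) * (T + 1) + 1) * bitCost N =
      bitCost N + T * bitCost N + (K * (T + 1) + 1) * bitCost N := by ring
    omega

end Running

/-! ### The program -/

section Algorithm

/-- With `q` in register 6 and `1` in register 4: put the least prime factor of `q` into
register 7. -/
def findFactor : Program :=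
  .seq (.const 7 2) (.seq (.mod 8 6 7) (.whileNonzero 8 (.seq (.add 7 7 4) (.mod 8 6 7))))

/-- Increase register 6 to the next prime. -/
def searchPrime : Program :=
  .seq findFactor (.seq (.sub 8 6 7)
    (.whileNonzero 8 (.seq (.add 6 6 4) (.seq findFactor (.sub 8 6 7)))))

/-- Put into register 11 the least positive power of register 6 which is not less than
register 2. -/
def computePower : Program :=
  .seq (.add 11 6 14) (.seq (.sub 8 2 11)
    (.whileNonzero 8 (.seq (.mul 11 11 6) (.sub 8 2 11))))

/-- Write as many zeros as register 8 says. -/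
def writeZeros : Program :=
  .whileNonzero 8 (.seq (.write 14) (.sub 8 8 4))

/-- Write the term `Xⱼ ^ e`, for `n`, `j`, `e` in the registers 0, 10, 11. -/
def writeTerm : Program :=
  .seq (.write 14) (.seq (.write 4) (.seq (.add 8 10 14) (.seq writeZeros (.seq (.write 11)
    (.seq (.sub 8 0 10) (.seq (.sub 8 8 4) writeZeros))))))

/-- Emit the column `j` of the row `i`. -/
def emitColumn : Program :=
  -- Truncated subtraction leaves `|i - j|` in register 12 and `m - j` in register 13; the term is
  -- written exactly when one of them is zero.
  .seq searchPrime (.seq computePower (.seq (.sub 12 9 10) (.seq (.sub 13 10 9)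
    (.seq (.add 12 12 13) (.seq (.sub 13 1 10)
      (.seq (.ifNonzero 12 (.ifNonzero 13 .skip writeTerm) writeTerm)
        (.seq (.const 7 0) (.seq (.const 11 0) (.seq (.const 12 0) (.seq (.const 13 0)
          (.seq (.add 6 6 4) (.seq (.add 10 10 4) (.sub 8 0 10)))))))))))))

/-- Emit the row `i`. -/
def emitRow : Program :=
  .seq (.write 5) (.seq (.add 6 3 14) (.seq (.sub 8 0 10) (.seq (.whileNonzero 8 emitColumn)
    (.seq (.const 10 0) (.seq (.const 6 0) (.seq (.add 9 9 4) (.sub 8 1 9)))))))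

/-- The whole program; `setBound` puts the lower bound for the primes into register 3. -/
def extractorProgram (setBound : Program) : Program :=
  .seq (.const 4 1) (.seq (.add 2 2 4) (.seq setBound (.seq (.sub 5 0 1) (.seq (.add 5 5 4)
    (.seq (.sub 8 1 9) (.whileNonzero 8 emitRow))))))

variable {N n m D q₀ c q k r i j e u v : ℕ} {o : List ℕ}

/-- Registers 0 to 3 hold `n`, `m`, `d + 1` and the start of the prime search; 4 the constant one; 5
the number of terms per row; 6 and 7 a candidate prime and its least factor; 8 the loop test; 9 and
10 the row and the column; 11 the exponent; 12 and 13 scratch values. Register 14 lies beyond the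
list and so always reads as zero. -/
theorem runs_findFactor (hq : 2 ≤ q) (hqN : q ≤ N) :
    Runs N findFactor (listState [n, m, D, q₀, 1, c, q, k, r, i, j, e, u, v] o)
      (listState [n, m, D, q₀, 1, c, q, q.minFac, 0, i, j, e, u, v] o) (5 * q) := by
  have hmf : 2 ≤ q.minFac := (Nat.minFac_prime (by omega)).two_le
  have hmq : q.minFac ≤ q := Nat.minFac_le (by omega)
  have hloop := Runs.while (N := N) (p := .seq (.add 7 7 4) (.mod 8 6 7)) (r := 8) (T := 4)
    (q.minFac - 2) (fun t => [n, m, D, q₀, 1, c, q, 2 + t, q % (2 + t), i, j, e, u, v])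
    (fun _ => o)
    (fun t _ => show q % (2 + t) ≤ N from (Nat.mod_le _ _).trans hqN)
    (fun t ht => show q % (2 + t) ≠ 0 from fun h0 => by
      have := Nat.minFac_le_of_dvd (by omega) (Nat.dvd_of_mod_eq_zero h0)
      omega)
    (show q % (2 + (q.minFac - 2)) = 0 by
      rw [Nat.add_sub_cancel' hmf]
      exact Nat.mod_eq_zero_of_dvd (Nat.minFac_dvd q))
    (fun t ht => (Runs.add (by simp) (show 2 + t ≤ N by omega) (show 1 ≤ N by omega)).seq
      (Runs.mod (by simp) (show q ≤ N by omega) (show 2 + t + 1 ≤ N by omega)))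
  rw [Nat.add_sub_cancel' hmf, Nat.mod_eq_zero_of_dvd (Nat.minFac_dvd q)] at hloop
  refine Runs.mono ((Runs.const (by simp) (by omega)).seq ((Runs.mod (by simp) (show q ≤ N by omega)
    (show 2 ≤ N by omega)).seq hloop)) ?_
  omega

theorem runs_searchPrime (hq : 2 ≤ q) (hN : nextPrime q ≤ N) :
    Runs N searchPrime (listState [n, m, D, q₀, 1, c, q, k, r, i, j, e, u, v] o)
      (listState [n, m, D, q₀, 1, c, nextPrime q, nextPrime q, 0, i, j, e, u, v] o)
      (5 * nextPrime q * (nextPrime q + 1)) := by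
  have hle := le_nextPrime q
  have hmf : ∀ q', (2 ≤ q') → q'.minFac ≤ q' := fun q' h => Nat.minFac_le (by omega)
  have hloop := Runs.while (N := N) (p := .seq (.add 6 6 4) (.seq findFactor (.sub 8 6 7)))
    (r := 8) (T := 5 * nextPrime q + 4)
    (nextPrime q - q) (fun t => [n, m, D, q₀, 1, c, q + t, (q + t).minFac, q + t - (q + t).minFac,
      i, j, e, u, v])
    (fun _ => o)
    (fun t _ => show q + t - (q + t).minFac ≤ N by omega)
    (fun t ht => show q + t - (q + t).minFac ≠ 0 from fun h0 => by
      refine not_prime_of_lt_nextPrime (q := q) (q' := q + t) (by omega) (by omega) ?_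
      rw [Nat.prime_def_minFac]
      have := hmf (q + t) (by omega)
      omega)
    (show q + (nextPrime q - q) - (q + (nextPrime q - q)).minFac = 0 by
      rw [Nat.add_sub_cancel' hle, (prime_nextPrime q).minFac_eq, Nat.sub_self])
    (fun t ht => Runs.mono
      ((Runs.add (by simp) (show q + t ≤ N by omega) (show 1 ≤ N by omega)).seq
        ((runs_findFactor (q := q + t + 1) (by omega) (by omega)).seq
          (Runs.sub (by simp) (show q + t + 1 ≤ N by omega)
            (show (q + t + 1).minFac ≤ N from (hmf _ (by omega)).trans (by omega))))) (by omega))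
  rw [Nat.add_sub_cancel' hle, (prime_nextPrime q).minFac_eq, Nat.sub_self] at hloop
  refine Runs.mono ((runs_findFactor hq (by omega)).seq ((Runs.sub (by simp)
    (show q ≤ N by omega) (show q.minFac ≤ N from (hmf q hq).trans (by omega))).seq hloop)) ?_
  obtain ⟨a, ha⟩ := Nat.exists_eq_add_of_le hle
  rw [ha, Nat.add_sub_cancel_left]
  nlinarith

theorem runs_computePower {d : ℕ} (hq : 2 ≤ q) (hqN : q ≤ N) (hd : d + 1 ≤ N)
    (hN : q ^ (Nat.log q d + 1) ≤ N) :
    Runs N computePower (listState [n, m, d + 1, q₀, 1, c, q, k, r, i, j, e, u, v] o)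
      (listState [n, m, d + 1, q₀, 1, c, q, k, 0, i, j, q ^ (Nat.log q d + 1), u, v] o)
      (5 * Nat.log 2 d + 5) := by
  have hlt : d < q ^ (Nat.log q d + 1) := Nat.lt_pow_succ_log_self hq d
  have hpow : ∀ t ≤ Nat.log q d, q ^ (t + 1) ≤ N := fun t ht =>
    (Nat.pow_le_pow_right (by omega) (by omega)).trans hN
  have hloop := Runs.while (N := N) (p := .seq (.mul 11 11 6) (.sub 8 2 11))
    (r := 8) (T := 4) (Nat.log q d)
    (fun t => [n, m, d + 1, q₀, 1, c, q, k, d + 1 - q ^ (t + 1), i, j, q ^ (t + 1), u, v])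
    (fun _ => o)
    (fun t _ => show d + 1 - q ^ (t + 1) ≤ N by omega)
    -- Storing `d + 1` instead of `d` lets the truncated difference vanish exactly when the power
    -- exceeds `d`.
    (fun t ht => show d + 1 - q ^ (t + 1) ≠ 0 by
      have := Nat.pow_le_of_le_log (b := q) (x := t + 1) (y := d)
        (by rintro rfl; simp at ht) (by omega)
      omega)
    (show d + 1 - q ^ (Nat.log q d + 1) = 0 by omega)
    (fun t ht => (Runs.mul (by simp) (show q ^ (t + 1) ≤ N from hpow t (by omega))
      (show q ≤ N from hqN)).seq (Runs.sub (by simp) (show d + 1 ≤ N from hd)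
        (show q ^ (t + 1) * q ≤ N from hpow (t + 1) (by omega))))
  have h0 : d + 1 - q ^ (Nat.log q d + 1) = 0 := by omega
  rw [h0, zero_add, pow_one] at hloop
  refine Runs.mono ((Runs.add (by simp) (show q ≤ N from hqN) (show 0 ≤ N by omega)).seq
    ((Runs.sub (by simp) (show d + 1 ≤ N from hd) (show q ≤ N from hqN)).seq hloop)) ?_
  have := Nat.log_anti_left (n := d) Nat.one_lt_two hq
  omega

theorem runs_writeZeros (hr : r ≤ N) (hN : 1 ≤ N) :
    Runs N writeZeros (listState [n, m, D, q₀, 1, c, q, k, r, i, j, e, u, v] o)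
      (listState [n, m, D, q₀, 1, c, q, k, 0, i, j, e, u, v] (o ++ List.replicate r 0))
      (4 * r + 1) := by
  have hloop := Runs.while (N := N) (p := .seq (.write 14) (.sub 8 8 4)) (r := 8) (T := 3) r
    (fun t => [n, m, D, q₀, 1, c, q, k, r - t, i, j, e, u, v])
    (fun t => o ++ List.replicate t 0)
    (fun t _ => show r - t ≤ N by omega)
    (fun t ht => show r - t ≠ 0 by omega)
    (show r - r = 0 by omega)
    (fun t ht => by
      have h := (Runs.write (N := N) (l := [n, m, D, q₀, 1, c, q, k, r - t, i, j, e, u, v])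
        (o := o ++ List.replicate t 0) (src := 14) (show 0 ≤ N by omega)).seq
        (Runs.sub (dst := 8) (a := 8) (b := 4) (by simp) (show r - t ≤ N by omega)
          (show 1 ≤ N by omega))
      rw [List.append_assoc] at h
      rw [List.replicate_succ']
      exact h)
  rw [Nat.sub_self, Nat.sub_zero, List.replicate_zero, List.append_nil] at hloop
  exact hloop.mono (by omega)

/-- The output for the term `Xⱼ ^ e`. -/
def termOutput (n j e : ℕ) : List ℕ :=
  [0, 1] ++ (List.replicate j 0 ++ ([e] ++ List.replicate (n - j - 1) 0))

theorem runs_writeTerm (hn : n ≤ N) (hj : j < n) (he : e ≤ N) :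
    Runs N writeTerm (listState [n, m, D, q₀, 1, c, q, k, 0, i, j, e, u, v] o)
      (listState [n, m, D, q₀, 1, c, q, k, 0, i, j, e, u, v] (o ++ termOutput n j e))
      (4 * n + 11) := by
  have h := (Runs.write (N := N) (l := [n, m, D, q₀, 1, c, q, k, 0, i, j, e, u, v])
        (o := o) (src := 14) (show 0 ≤ N by omega)).seq
    ((Runs.write (src := 4) (show 1 ≤ N by omega)).seq
    ((Runs.add (dst := 8) (a := 10) (b := 14) (by simp) (show j ≤ N by omega)
      (show 0 ≤ N by omega)).seq
    ((runs_writeZeros (r := j) (by omega) (by omega)).seq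
    ((Runs.write (src := 11) (show e ≤ N by omega)).seq
    ((Runs.sub (dst := 8) (a := 0) (b := 10) (by simp) (show n ≤ N by omega)
      (show j ≤ N by omega)).seq
    ((Runs.sub (dst := 8) (a := 8) (b := 4) (by simp) (show n - j ≤ N by omega)
      (show 1 ≤ N by omega)).seq
    (runs_writeZeros (r := n - j - 1) (by omega) (by omega))))))))
  simp only [List.append_assoc] at h
  exact Runs.mono h (by omega)

/-- The output for the column `j` of the row `i`. -/
def columnOutput (n m q₀ d i j : ℕ) : List ℕ :=
  if j = i ∨ m ≤ j then termOutput n j (primePowerFrom q₀ d j) else []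

theorem runs_coefficient (hn : n ≤ N) (hm : m ≤ N) (hj : j < n) (he : e ≤ N)
    (hN : i - j + (j - i) ≤ N) :
    Runs N (.ifNonzero 12 (.ifNonzero 13 .skip writeTerm) writeTerm)
      (listState [n, m, D, q₀, 1, c, q, k, 0, i, j, e, i - j + (j - i), m - j] o)
      (listState [n, m, D, q₀, 1, c, q, k, 0, i, j, e, i - j + (j - i), m - j]
        (o ++ if j = i ∨ m ≤ j then termOutput n j e else [])) (4 * n + 13) := by
  by_cases h1 : j = i
  · rw [if_pos (.inl h1)]
    exact Runs.mono (Runs.ifFalse (show i - j + (j - i) = 0 by omega) (runs_writeTerm hn hj he))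
      (by omega)
  · by_cases h2 : m ≤ j
    · rw [if_pos (.inr h2)]
      exact Runs.ifTrue hN (show i - j + (j - i) ≠ 0 by omega)
        (Runs.ifFalse (show m - j = 0 by omega) (runs_writeTerm hn hj he))
    · rw [if_neg (by tauto), List.append_nil]
      exact Runs.mono (Runs.ifTrue hN (show i - j + (j - i) ≠ 0 by omega)
        (Runs.ifTrue (show m - j ≤ N by omega) (show m - j ≠ 0 by omega) (Runs.skip _)))
        (by omega)

theorem runs_emitColumn {d Q : ℕ} (hq₀ : 2 ≤ q₀) (hn : n ≤ N) (hm : m ≤ n) (hi : i < m)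
    (hj : j < n) (hd : d + 1 ≤ N) (hQ : primeFrom q₀ j ≤ Q) (hQN : Q < N)
    (he : primePowerFrom q₀ d j ≤ N) :
    Runs N emitColumn
      (listState [n, m, d + 1, q₀, 1, c, primeStart q₀ j, 0, n - j, i, j, 0, 0, 0] o)
      (listState [n, m, d + 1, q₀, 1, c, primeStart q₀ (j + 1), 0, n - (j + 1), i, j + 1, 0, 0, 0]
        (o ++ columnOutput n m q₀ d i j))
      (5 * Q * (Q + 1) + 5 * Nat.log 2 d + 4 * n + 40) := by
  have h := (runs_searchPrime (N := N) (n := n) (m := m) (D := d + 1) (q₀ := q₀) (c := c) (k := 0)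
      (r := n - j) (i := i) (j := j) (e := 0) (u := 0) (v := 0) (o := o)
      (hq₀.trans (le_primeStart q₀ j)) (hQ.trans hQN.le)).seq
    ((runs_computePower (prime_primeFrom q₀ j).two_le (hQ.trans hQN.le) hd he).seq
    ((Runs.sub (dst := 12) (a := 9) (b := 10) (by simp) (show i ≤ N by omega)
      (show j ≤ N by omega)).seq
    ((Runs.sub (dst := 13) (a := 10) (b := 9) (by simp) (show j ≤ N by omega)
      (show i ≤ N by omega)).seq
    ((Runs.add (dst := 12) (a := 12) (b := 13) (by simp) (show i - j ≤ N by omega)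
      (show j - i ≤ N by omega)).seq
    ((Runs.sub (dst := 13) (a := 1) (b := 10) (by simp) (show m ≤ N by omega)
      (show j ≤ N by omega)).seq
    ((runs_coefficient hn (by omega) hj he (by omega)).seq
    ((Runs.const (dst := 7) (v := 0) (by simp) (by omega)).seq
    ((Runs.const (dst := 11) (v := 0) (by simp) (by omega)).seq
    ((Runs.const (dst := 12) (v := 0) (by simp) (by omega)).seq
    ((Runs.const (dst := 13) (v := 0) (by simp) (by omega)).seq
    ((Runs.add (dst := 6) (a := 6) (b := 4) (by simp) (show primeFrom q₀ j ≤ N by omega)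
      (show 1 ≤ N by omega)).seq
    ((Runs.add (dst := 10) (a := 10) (b := 4) (by simp) (show j ≤ N by omega)
      (show 1 ≤ N by omega)).seq
    (Runs.sub (dst := 8) (a := 0) (b := 10) (by simp) (show n ≤ N by omega)
      (show j + 1 ≤ N by omega))))))))))))))
  refine Runs.mono h ?_
  have h1 : 5 * primeFrom q₀ j * (primeFrom q₀ j + 1) ≤ 5 * Q * (Q + 1) := by gcongr
  change 5 * primeFrom q₀ j * (primeFrom q₀ j + 1) + _ ≤ _
  omega

/-- The output for the row `i`. -/
def rowOutput (n m q₀ d i : ℕ) : List ℕ :=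
  (n - m + 1) :: (List.range n).flatMap (columnOutput n m q₀ d i)

theorem runs_emitRow {d Q : ℕ} (hq₀ : 2 ≤ q₀) (hn : n < N) (hm : m ≤ n) (hi : i < m)
    (hd : d + 1 ≤ N) (hQ : ∀ j < n, primeFrom q₀ j ≤ Q) (hQN : Q < N)
    (he : ∀ j < n, primePowerFrom q₀ d j ≤ N) :
    Runs N emitRow
      (listState [n, m, d + 1, q₀, 1, n - m + 1, 0, 0, m - i, i, 0, 0, 0, 0] o)
      (listState [n, m, d + 1, q₀, 1, n - m + 1, 0, 0, m - (i + 1), i + 1, 0, 0, 0, 0]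
        (o ++ rowOutput n m q₀ d i))
      (n * (5 * Q * (Q + 1) + 5 * Nat.log 2 d + 4 * n + 41) + 12) := by
  have hq₀N : q₀ ≤ N := ((le_primeFrom q₀ 0).trans (hQ 0 (by omega))).trans hQN.le
  have hloop := Runs.while (N := N) (p := emitColumn) (r := 8)
    (T := 5 * Q * (Q + 1) + 5 * Nat.log 2 d + 4 * n + 40) n
    (fun j => [n, m, d + 1, q₀, 1, n - m + 1, primeStart q₀ j, 0, n - j, i, j, 0, 0, 0])
    (fun j => (o ++ [n - m + 1]) ++ (List.range j).flatMap (columnOutput n m q₀ d i))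
    (fun j _ => show n - j ≤ N by omega)
    (fun j _ => show n - j ≠ 0 by omega)
    (show n - n = 0 by omega)
    (fun j hj => by
      have h := runs_emitColumn (c := n - m + 1)
        (o := (o ++ [n - m + 1]) ++ (List.range j).flatMap (columnOutput n m q₀ d i))
        hq₀ hn.le hm hi hj hd (hQ j hj) hQN (he j hj)
      rw [List.range_succ, List.flatMap_append, List.flatMap_singleton, ← List.append_assoc]
      exact h)
  rw [List.range_zero, List.flatMap_nil, List.append_nil, List.append_assoc] at hloop
  replace hloop := hloop.mono
    (T' := n * (5 * Q * (Q + 1) + 5 * Nat.log 2 d + 4 * n + 41) + 1) le_rfl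
  have h := (Runs.write (N := N) (src := 5) (o := o)
      (l := [n, m, d + 1, q₀, 1, n - m + 1, 0, 0, m - i, i, 0, 0, 0, 0])
      (show n - m + 1 ≤ N by omega)).seq
    ((Runs.add (dst := 6) (a := 3) (b := 14) (by simp) (show q₀ ≤ N from hq₀N)
      (show 0 ≤ N by omega)).seq
    ((Runs.sub (dst := 8) (a := 0) (b := 10) (by simp) (show n ≤ N by omega)
      (show 0 ≤ N by omega)).seq
    (hloop.seq
    ((Runs.const (dst := 10) (v := 0) (by simp) (by omega)).seq
    ((Runs.const (dst := 6) (v := 0) (by simp) (by omega)).seq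
    ((Runs.add (dst := 9) (a := 9) (b := 4) (by simp) (show i ≤ N by omega)
      (show 1 ≤ N by omega)).seq
    (Runs.sub (dst := 8) (a := 1) (b := 9) (by simp) (show m ≤ N by omega)
      (show i + 1 ≤ N by omega))))))))
  have h' := Runs.mono (T' := n * (5 * Q * (Q + 1) + 5 * Nat.log 2 d + 4 * n + 41) + 12) h
    (by omega)
  rw [Nat.sub_self] at h'
  exact h'

theorem runs_extractorProgram {d Q : ℕ} {setBound : Program} (hq₀ : 2 ≤ q₀) (hn : n < N)
    (hm1 : 1 ≤ m) (hm : m ≤ n)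
    (hd : d + 1 ≤ N) (hQ : ∀ j < n, primeFrom q₀ j ≤ Q) (hQN : Q < N)
    (he : ∀ j < n, primePowerFrom q₀ d j ≤ N)
    (hsetBound : Runs N setBound (listState [n, m, d + 1, 0, 1, 0, 0, 0, 0, 0, 0, 0, 0, 0] [])
      (listState [n, m, d + 1, q₀, 1, 0, 0, 0, 0, 0, 0, 0, 0, 0] []) 2) :
    ∃ s, Runs N (extractorProgram setBound) (initState [n, m, d]) s
      (m * (n * (5 * Q * (Q + 1) + 5 * Nat.log 2 d + 4 * n + 41) + 13) + 12) ∧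
      s.out = (List.range m).flatMap (rowOutput n m q₀ d) := by
  have hloop := Runs.while (N := N) (p := emitRow) (r := 8)
    (T := n * (5 * Q * (Q + 1) + 5 * Nat.log 2 d + 4 * n + 41) + 12) m
    (fun i => [n, m, d + 1, q₀, 1, n - m + 1, 0, 0, m - i, i, 0, 0, 0, 0])
    (fun i => (List.range i).flatMap (rowOutput n m q₀ d))
    (fun i _ => show m - i ≤ N by omega)
    (fun i _ => show m - i ≠ 0 by omega)
    (show m - m = 0 by omega)
    (fun i hi => by
      have h := runs_emitRow (o := (List.range i).flatMap (rowOutput n m q₀ d))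
        hq₀ hn hm hi hd hQ hQN he
      rw [List.range_succ, List.flatMap_append, List.flatMap_singleton]
      exact h)
  replace hloop := hloop.mono
    (T' := m * (n * (5 * Q * (Q + 1) + 5 * Nat.log 2 d + 4 * n + 41) + 13) + 1)
    (by rw [Nat.add_assoc _ 12 1])
  have hstart : initState [n, m, d] = listState [n, m, d, 0, 0, 0, 0, 0, 0, 0, 0, 0, 0, 0] [] := by
    simp only [initState, listState]
    congr 1
    funext x
    rcases x with _ | _ | _ | x
    · rfl
    · rfl
    · rfl
    · have : ∀ (t x : ℕ), (List.replicate t 0).getD x 0 = 0 := fun t x => by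
        simp only [List.getD_eq_getElem?_getD, List.getElem?_replicate]
        split <;> rfl
      exact (this 11 x).symm
  rw [hstart]
  have h := (Runs.const (N := N) (l := [n, m, d, 0, 0, 0, 0, 0, 0, 0, 0, 0, 0, 0]) (o := [])
      (dst := 4) (v := 1) (by simp) (by omega)).seq
    ((Runs.add (dst := 2) (a := 2) (b := 4) (by simp) (show d ≤ N by omega)
      (show 1 ≤ N by omega)).seq
    (hsetBound.seq
    ((Runs.sub (dst := 5) (a := 0) (b := 1) (by simp) (show n ≤ N by omega)
      (show m ≤ N by omega)).seq
    ((Runs.add (dst := 5) (a := 5) (b := 4) (by simp) (show n - m ≤ N by omega)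
      (show 1 ≤ N by omega)).seq
    ((Runs.sub (dst := 8) (a := 1) (b := 9) (by simp) (show m ≤ N by omega)
      (show 0 ≤ N by omega)).seq
    hloop)))))
  exact ⟨listState [n, m, d + 1, q₀, 1, n - m + 1, 0, 0, m - m, m, 0, 0, 0, 0]
    ((List.range m).flatMap (rowOutput n m q₀ d)), Runs.mono h (by omega), rfl⟩

end Algorithm

/-! ### Running time and output of the program -/

section Construction

open MvPolynomial

theorem bitCost_mul_le (Q d n : ℕ) :
    bitCost ((Q + 1) * (d + 1) * (n + 2)) ≤ Q + Nat.log 2 d + n + 4 := by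
  have h1 : Q + 1 ≤ 2 ^ Q := Nat.lt_two_pow_self
  have h2 : d + 1 ≤ 2 ^ (Nat.log 2 d + 1) := Nat.lt_pow_succ_log_self Nat.one_lt_two d
  have h3 : n + 2 ≤ 2 ^ (n + 1) := Nat.lt_two_pow_self
  have h4 : (Q + 1) * (d + 1) * (n + 2) < 2 ^ (Q + Nat.log 2 d + n + 3) := by
    calc (Q + 1) * (d + 1) * (n + 2) ≤ 2 ^ Q * 2 ^ (Nat.log 2 d + 1) * 2 ^ (n + 1) := by gcongr
      _ = 2 ^ (Q + Nat.log 2 d + n + 2) := by rw [← pow_add, ← pow_add]; congr 1; omega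
      _ < 2 ^ (Q + Nat.log 2 d + n + 3) := Nat.pow_lt_pow_right (by norm_num) (by omega)
  exact Nat.succ_le_succ (Nat.size_le.2 h4)

theorem outputsInTime_extractorProgram {n m d q₀ S : ℕ} {setBound : Program} (hq₀ : 2 ≤ q₀)
    (hn : 1 ≤ n) (hm1 : 1 ≤ m) (hm : m ≤ n) (hd : 1 ≤ d) (hnS : n ≤ S) (hdS : Nat.log 2 d ≤ S)
    (hS : ∀ j < n, primeFrom q₀ j ≤ S)
    (hsetBound : ∀ N, 2 ≤ N → d + 1 ≤ N →
      Runs N setBound (listState [n, m, d + 1, 0, 1, 0, 0, 0, 0, 0, 0, 0, 0, 0] [])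
        (listState [n, m, d + 1, q₀, 1, 0, 0, 0, 0, 0, 0, 0, 0, 0] []) 2) :
    OutputsInTime (extractorProgram setBound) [n, m, d]
      ((List.range m).flatMap (rowOutput n m q₀ d)) (600 * S ^ 5) := by
  -- The number `(S + 1) * (d + 1) * (n + 2)` bounds every number handled, the prime powers (at most
  -- `S * d`) included, while its bit length is only linear in `S`.
  have hN1 : n + 2 ≤ (S + 1) * (d + 1) * (n + 2) := Nat.le_mul_of_pos_left _ (by positivity)
  have hN2 : (S + 1) * (d + 1) ≤ (S + 1) * (d + 1) * (n + 2) :=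
    Nat.le_mul_of_pos_right _ (by positivity)
  have hN3 : d + 1 ≤ (S + 1) * (d + 1) := Nat.le_mul_of_pos_left _ (by positivity)
  have hN4 : S + 1 ≤ (S + 1) * (d + 1) := Nat.le_mul_of_pos_right _ (by positivity)
  obtain ⟨s, ⟨t, ht, htle⟩, hs⟩ := runs_extractorProgram (N := (S + 1) * (d + 1) * (n + 2))
    (n := n) (m := m) (d := d) (Q := S) (setBound := setBound) hq₀ (by omega) hm1 hm (by omega) hS
    (by omega)
    (fun j hj => (primePowerFrom_le q₀ j hd).trans (le_trans
      (Nat.mul_le_mul ((hS j hj).trans (Nat.le_succ S)) (Nat.le_succ d)) hN2))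
    (hsetBound _ (by omega) (by omega))
  refine ⟨s, t, ht, hs, htle.trans ?_⟩
  have hS1 : 1 ≤ S := hn.trans hnS
  have hb := bitCost_mul_le S d n
  have h1 : m * (n * (5 * S * (S + 1) + 5 * Nat.log 2 d + 4 * n + 41) + 13) + 12 ≤
      85 * S ^ 4 := by
    calc m * (n * (5 * S * (S + 1) + 5 * Nat.log 2 d + 4 * n + 41) + 13) + 12
        ≤ S * (S * (5 * S * (S + S) + 5 * S * S + 4 * S * S + 41 * S * S) + 13 * S ^ 3) +
          12 * S ^ 4 := by
          have h2 : S ≤ S * S := Nat.le_mul_of_pos_left _ hS1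
          have h3 : 1 ≤ S ^ 3 := Nat.one_le_pow _ _ hS1
          have h4 : 1 ≤ S ^ 4 := Nat.one_le_pow _ _ hS1
          have h5 : m ≤ S := hm.trans hnS
          have h6 : Nat.log 2 d ≤ S * S := hdS.trans h2
          have h7 : n ≤ S * S := hnS.trans h2
          have h8 : 1 ≤ S * S := hS1.trans h2
          have h9 : 5 * S * (S + 1) + 5 * Nat.log 2 d + 4 * n + 41 ≤
              5 * S * (S + S) + 5 * S * S + 4 * S * S + 41 * S * S := by nlinarith
          have h10 : n * (5 * S * (S + 1) + 5 * Nat.log 2 d + 4 * n + 41) + 13 ≤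
              S * (5 * S * (S + S) + 5 * S * S + 4 * S * S + 41 * S * S) + 13 * S ^ 3 :=
            Nat.add_le_add (Nat.mul_le_mul hnS h9) (by omega)
          exact Nat.add_le_add (Nat.mul_le_mul h5 h10) (by omega)
      _ = 85 * S ^ 4 := by ring
  -- The cost of one number is at most `S + log d + n + 4 ≤ 7 * S`, and `85 * 7 = 595`.
  calc _ ≤ 85 * S ^ 4 * (7 * S) := Nat.mul_le_mul h1 (by omega)
    _ ≤ 600 * S ^ 5 := by nlinarith [pow_succ S 4, Nat.zero_le (S ^ 5)]

/-- The coefficients of the construction: an identity matrix and columns of ones. -/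
def onesMatrix (m n : ℕ) : Matrix (Fin m) (Fin n) ℤ :=
  fun i j => if (j : ℕ) = i ∨ m ≤ j then 1 else 0

/-- For `m = 1` all entries are one and for `m = n` the matrix is the identity. For `m + 1 = n` any
relation between all columns is a multiple of one relation with no zero coefficient, so `m` columns
are independent. All this holds in every characteristic. -/
theorem isRegularMatrix_onesMatrix (F : Type u) [Field F] {m n : ℕ} (hm1 : 1 ≤ m)
    (hmn : m = 1 ∨ m + 1 = n ∨ m = n) :
    IsRegularMatrix m ((onesMatrix m n).map (Int.castRingHom F)) := by
  classical
  intro s hs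
  rw [Fintype.linearIndependent_iff]
  intro g hg
  let G : Fin n → F := fun j => if h : j ∈ s then g ⟨j, h⟩ else 0
  have hGs : ∀ j ∉ s, G j = 0 := fun j hj => dif_neg hj
  have hG : ∀ i : Fin m, ∑ j, G j * (if (j : ℕ) = i ∨ m ≤ j then 1 else 0) = 0 := by
    intro i
    have h1 := congrFun hg i
    simp only [Finset.sum_apply, Pi.smul_apply, smul_eq_mul, Pi.zero_apply] at h1
    refine Eq.trans ?_ h1
    rw [← Finset.sum_subset (Finset.subset_univ s) fun j _ hj => by rw [hGs j hj, zero_mul],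
      ← Finset.sum_coe_sort s]
    refine Finset.sum_congr rfl fun j _ => ?_
    simp only [G, j.2, dif_pos, Matrix.col_apply, Matrix.map_apply, onesMatrix]
    split <;> simp
  suffices h : ∀ j, G j = 0 by
    intro j
    have := h j
    simpa [G] using this
  rcases hmn with rfl | rfl | rfl
  · obtain ⟨j₀, rfl⟩ := Finset.card_eq_one.1 hs
    intro j
    by_cases hj : j = j₀
    · subst hj
      have h1 := hG 0
      rw [Finset.sum_eq_single j (fun l _ hl => by rw [hGs l (by simpa using hl), zero_mul])
        (by simp), if_pos (by simp; omega), mul_one] at h1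
      exact h1
    · exact hGs j (by simpa using hj)
  · have hrow : ∀ i : Fin m, G i.castSucc + G (Fin.last m) = 0 := by
      intro i
      have h1 := hG i
      rw [Fin.sum_univ_castSucc, Finset.sum_eq_single i] at h1
      · simpa using h1
      · intro l _ hl
        rw [if_neg, mul_zero]
        rintro (h | h)
        · exact hl (Fin.ext h)
        · exact absurd h (not_le.2 l.2)
      · simp
    have hlast : G (Fin.last m) = 0 := by
      by_contra hne
      have hall : ∀ j, j ∈ s := by
        intro j
        by_contra hj
        refine Fin.lastCases (motive := fun j => j ∉ s → False) ?_ ?_ j hj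
        · exact fun hj => hne (hGs _ hj)
        · intro i hi
          have := hrow i
          rw [hGs _ hi, zero_add] at this
          exact hne this
      rw [Finset.eq_univ_of_forall hall, Finset.card_univ, Fintype.card_fin] at hs
      omega
    intro j
    refine Fin.lastCases hlast (fun i => ?_) j
    have := hrow i
    rwa [hlast, add_zero] at this
  · intro i
    have h1 := hG i
    rw [Finset.sum_eq_single i] at h1
    · simpa using h1
    · intro l _ hl
      rw [if_neg, mul_zero]
      rintro (h | h)
      · exact hl (Fin.ext h)
      · exact absurd h (not_le.2 l.2)
    · simp

/-! ### Sparse representations of the constructed polynomials -/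

theorem map_diagonalPolys {R : Type*} {S : Type u} [CommRing R] [CommRing S] {m n : ℕ}
    (f : R →+* S) (c : Matrix (Fin m) (Fin n) R) (e : Fin n → ℕ) (i : Fin m) :
    map f (diagonalPolys c e i) = diagonalPolys (c.map f) e i := by
  simp [diagonalPolys]

theorem diagonalPolys_eq_sum_monomial {R : Type*} [CommRing R] {m n : ℕ}
    (c : Matrix (Fin m) (Fin n) R) (e : Fin n → ℕ) (i : Fin m) :
    diagonalPolys c e i = ∑ j, monomial (Finsupp.single j (e j)) (c i j) := by
  refine Finset.sum_congr rfl fun j _ => ?_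
  rw [C_mul_X_pow_eq_monomial]

theorem single_injective_of_pos {n : ℕ} {e : Fin n → ℕ} (he : ∀ j, 0 < e j) :
    Function.Injective fun j => Finsupp.single j (e j) := by
  intro j l h
  exact ((Finsupp.single_eq_single_iff _ _ _ _).1 h).elim (fun h => h.1)
    fun h => absurd h.1 (he j).ne'

theorem coeff_diagonalPolys {R : Type*} [CommRing R] {m n : ℕ}
    (c : Matrix (Fin m) (Fin n) R) {e : Fin n → ℕ} (he : ∀ j, 0 < e j) (i : Fin m)
    (s : Fin n →₀ ℕ) : coeff s (diagonalPolys c e i) = 0 ∨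
      ∃ j, coeff s (diagonalPolys c e i) = c i j := by
  classical
  rw [diagonalPolys_eq_sum_monomial, coeff_sum]
  simp only [coeff_monomial]
  by_cases h : ∃ j, Finsupp.single j (e j) = s
  · obtain ⟨j, rfl⟩ := h
    refine .inr ⟨j, ?_⟩
    simp only [(single_injective_of_pos he).eq_iff]
    simp
  · left
    push Not at h
    exact Finset.sum_eq_zero fun j _ => if_neg (h j)

theorem totalDegree_diagonalPolys_le {R : Type*} [CommRing R] {m n D : ℕ}
    (c : Matrix (Fin m) (Fin n) R) {e : Fin n → ℕ} (he : ∀ j, e j ≤ D) (i : Fin m) :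
    (diagonalPolys c e i).totalDegree ≤ D := by
  rw [diagonalPolys_eq_sum_monomial]
  refine totalDegree_finsetSum_le fun j _ => (totalDegree_monomial_le _ _).trans ?_
  simpa [Finsupp.sum_single_index] using he j

theorem flatMap_filter_eq {α β : Type*} (p : α → Bool) (f : α → List β) (l : List α) :
    (l.filter p).flatMap f = l.flatMap fun x => if p x then f x else [] := by
  induction l with
  | nil => rfl
  | cons a l ih =>
    by_cases h : p a <;> simp [h, ih]

theorem encodeTerm_single {n : ℕ} (j : Fin n) (e : ℕ) :
    encodeTerm (Finsupp.single j e, (1 : ℤ)) = termOutput n j e := by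
  have h : List.ofFn (fun l : Fin n => (Finsupp.single j e) l) =
      List.replicate (j : ℕ) 0 ++ ([e] ++ List.replicate (n - j - 1) 0) := by
    apply List.ext_getElem
    · simp
      omega
    · intro l h1 h2
      rw [List.getElem_ofFn, Finsupp.single_apply]
      rcases lt_trichotomy (j : ℕ) l with h | h | h
      · rw [if_neg (by intro h'; rw [h'] at h; simp at h),
          List.getElem_append_right (by simp; omega),
          List.getElem_append_right (by simp; omega), List.getElem_replicate]
      · rw [if_pos (Fin.ext h), List.getElem_append_right (by simp; omega)]
        simp [h]
      · rw [if_neg (by intro h'; rw [h'] at h; simp at h),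
          List.getElem_append_left (by simpa using h),
          List.getElem_replicate]
  rw [encodeTerm, termOutput, h]
  rfl

/-- The terms of the row `i` of the construction. -/
def rowTerms {n : ℕ} (m : ℕ) (e : Fin n → ℕ) (i : ℕ) : List ((Fin n →₀ ℕ) × ℤ) :=
  ((List.finRange n).filter fun j : Fin n => decide ((j : ℕ) = i ∨ m ≤ j)).map
    fun j => (Finsupp.single j (e j), 1)

theorem isSparseRep_rowTerms {m n : ℕ} {e : Fin n → ℕ} (he : ∀ j, 0 < e j) (i : Fin m) :
    IsSparseRep (diagonalPolys (onesMatrix m n) e i) (rowTerms m e i) := by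
  have hnd : ((List.finRange n).filter fun j : Fin n => decide ((j : ℕ) = i ∨ m ≤ j)).Nodup :=
    (List.nodup_finRange n).filter _
  refine ⟨?_, ?_, ?_⟩
  · rw [rowTerms, List.map_map]
    exact hnd.map (single_injective_of_pos he)
  · intro t ht
    obtain ⟨j, -, rfl⟩ := List.mem_map.1 ht
    exact one_ne_zero
  · rw [rowTerms, List.map_map, ← List.sum_toFinset _ hnd, diagonalPolys_eq_sum_monomial,
      List.toFinset_filter, List.toFinset_finRange, Finset.sum_filter]
    refine Finset.sum_congr rfl fun j _ => ?_
    by_cases h : (j : ℕ) = i ∨ m ≤ j <;> simp [h, onesMatrix]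

theorem length_rowTerms {m n : ℕ} (e : Fin n → ℕ) {i : ℕ} (hi : i < m) (hm : m ≤ n) :
    (rowTerms m e i).length = n - m + 1 := by
  have h1 : (rowTerms m e i).length =
      ((List.range n).filter fun j => decide (j = i ∨ m ≤ j)).length := by
    rw [← List.map_coe_finRange_eq_range, List.filter_map, List.length_map, rowTerms,
      List.length_map]
    rfl
  have h2 : ((List.range n).filter fun j => decide (j = i ∨ m ≤ j)).toFinset =
      insert i (Finset.Ico m n) := by
    ext j
    simp
    omega
  rw [h1, ← List.toFinset_card_of_nodup (List.nodup_range.filter _), h2,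
    Finset.card_insert_of_notMem (by simp; omega), Nat.card_Ico]

theorem encodeTerms_rowTerms {m n q₀ d : ℕ} {i : ℕ} (hi : i < m) (hm : m ≤ n) :
    encodeTerms (rowTerms m (fun j : Fin n => primePowerFrom q₀ d j) i) =
      rowOutput n m q₀ d i := by
  rw [encodeTerms, rowOutput, length_rowTerms _ hi hm, rowTerms, List.flatMap_map,
    flatMap_filter_eq, ← List.map_coe_finRange_eq_range, List.flatMap_map]
  congr 2
  funext j
  simp only [decide_eq_true_eq, encodeTerm_single, columnOutput]

theorem isSparseEncoding_onesMatrix {m n : ℕ} (q₀ d : ℕ) (hm : m ≤ n) :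
    IsSparseEncoding (diagonalPolys (onesMatrix m n) fun j : Fin n => primePowerFrom q₀ d j)
      ((List.range m).flatMap (rowOutput n m q₀ d)) := by
  refine ⟨fun i => rowTerms m _ i, isSparseRep_rowTerms fun j =>
    (Nat.zero_le d).trans_lt (lt_primePowerFrom q₀ d j), ?_⟩
  rw [List.ofFn_eq_map, List.flatMap_map, ← List.map_coe_finRange_eq_range, List.flatMap_map]
  congr 1
  funext i
  exact (encodeTerms_rowTerms i.2 hm).symm

theorem isExplicitExtractorConstruction_extractorProgram {setBound : Program} {q₀ : ℕ → ℕ}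
    (hq₀ : ∀ d, 1 ≤ d → 2 ≤ q₀ d)
    (hsetBound : ∀ n m d N, 2 ≤ N → d + 1 ≤ N →
      Runs N setBound (listState [n, m, d + 1, 0, 1, 0, 0, 0, 0, 0, 0, 0, 0, 0] [])
        (listState [n, m, d + 1, q₀ d, 1, 0, 0, 0, 0, 0, 0, 0, 0, 0] []) 2)
    {degBound : ℕ → ℕ → ℝ} {timeBound : ℕ → ℕ → ℕ}
    (hdeg : ∀ n d, 1 ≤ n → 1 ≤ d → ∀ j < n, (primePowerFrom (q₀ d) d j : ℝ) ≤ degBound n d)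
    (htime : ∀ n d, 1 ≤ n → 1 ≤ d → ∃ S, n ≤ S ∧ Nat.log 2 d ≤ S ∧
      (∀ j < n, primeFrom (q₀ d) j ≤ S) ∧ 600 * S ^ 5 ≤ timeBound n d) :
    IsExplicitExtractorConstruction.{u} (extractorProgram setBound) degBound timeBound := by
  intro n m d hn hd hm1 hmn
  have hm : m ≤ n := by omega
  have hd0 : ∀ j : Fin n, d < primePowerFrom (q₀ d) d j := fun j => lt_primePowerFrom _ _ _
  have hpos : ∀ j : Fin n, 0 < primePowerFrom (q₀ d) d j := fun j =>
    (Nat.zero_le d).trans_lt (hd0 j)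
  have hcop : Pairwise fun j j' : Fin n =>
      Nat.Coprime (primePowerFrom (q₀ d) d j) (primePowerFrom (q₀ d) d j') := fun j j' h =>
    coprime_primePowerFrom _ _ fun h' => h (Fin.ext h')
  have hentry : ∀ i j, onesMatrix m n i j = 0 ∨ onesMatrix m n i j = 1 ∨
      onesMatrix m n i j = -1 := by
    intro i j
    rw [onesMatrix]
    split <;> simp
  obtain ⟨S, hnS, hdS, hS, hT⟩ := htime n d hn hd
  refine ⟨onesMatrix m n, fun j => primePowerFrom (q₀ d) d j, _, hentry, hd0, hcop, ?_, ?_,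
    isSparseEncoding_onesMatrix (q₀ d) d hm, ?_, ?_⟩
  · intro i s
    rcases coeff_diagonalPolys (onesMatrix m n) hpos i s with h | ⟨j, h⟩
    · exact .inl h
    · rw [h]
      exact hentry i j
  · intro i
    obtain ⟨j, -, hj⟩ := Finset.exists_max_image Finset.univ
      (fun j : Fin n => primePowerFrom (q₀ d) d j) ⟨⟨0, hn⟩, Finset.mem_univ _⟩
    have h1 := totalDegree_diagonalPolys_le (onesMatrix m n)
      (fun l => hj l (Finset.mem_univ _)) i
    exact le_trans (by exact_mod_cast h1) (hdeg n d hn hd j j.2)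
  · obtain ⟨s, t, h1, h2, h3⟩ := outputsInTime_extractorProgram (hq₀ d hd) hn hm1 hm hd hnS hdS hS
      (hsetBound n m d)
    exact ⟨s, t, h1, h2, h3.trans hT⟩
  · intro F _ _
    simp only [map_diagonalPolys]
    exact isRankCondenser_diagonalPolys (isRegularMatrix_onesMatrix F hm1 (by tauto)) hm hd0 hcop

/-! ### Degree and time bounds of the two constructions -/

theorem logb_two_le {x k : ℕ} (hx : 1 ≤ x) (h : x ≤ 2 ^ k) : Real.logb 2 x ≤ k := by
  rw [Real.logb_le_iff_le_rpow one_lt_two (by exact_mod_cast hx), Real.rpow_natCast]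
  exact_mod_cast h

/-- The bound `600 * S ^ 5` for `S = 16 * X ^ 2`; the same `C` serves as factor and, being at least
10, as exponent. -/
theorem mul_pow_le_mul_pow {X C : ℕ} (hX : 1 ≤ X) (hC : 600 * 16 ^ 5 ≤ C) :
    600 * (16 * X ^ 2) ^ 5 ≤ C * X ^ C := by
  calc 600 * (16 * X ^ 2) ^ 5 = 600 * 16 ^ 5 * X ^ 10 := by ring
    _ ≤ C * X ^ C := Nat.mul_le_mul hC (Nat.pow_le_pow_right hX (le_trans (by norm_num) hC))

theorem exists_construction_polynomial_in_degree : ∃ (prog : Program) (C : ℕ),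
    IsExplicitExtractorConstruction.{u} prog
      (fun n d => C * ((n + d) * Real.logb 2 (n + d))) (fun n d => C * (n + d) ^ C) := by
  obtain ⟨C, hC⟩ : ∃ C : ℕ, 600 * 16 ^ 5 ≤ C := ⟨_, le_rfl⟩
  have hC8 : (8 : ℝ) ≤ C := by exact_mod_cast le_trans (by norm_num) hC
  have hprime : ∀ n d, 1 ≤ n → 1 ≤ d → ∀ j < n,
      (primeFrom (d + 1) j : ℝ) ≤ 8 * (((n + d : ℕ) : ℝ) * Real.logb 2 ((n + d : ℕ) : ℝ)) :=
    fun n d _ hd j hj => primeFrom_le (by omega) (by omega)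
  refine ⟨extractorProgram (.add 3 2 14), C, isExplicitExtractorConstruction_extractorProgram
    (q₀ := fun d => d + 1) (fun d hd => by omega) (fun n m d N h2 hN => ?_) ?_ ?_⟩
  · exact Runs.add (by simp) (show d + 1 ≤ N from hN) (show 0 ≤ N by omega)
  · intro n d hn hd j hj
    rw [primePowerFrom_of_lt j (Nat.lt_succ_self d)]
    have h1 := hprime n d hn hd j hj
    push_cast at h1
    have h2 : (1 : ℝ) ≤ n + d := by exact_mod_cast hn.trans (Nat.le_add_right n d)
    refine h1.trans (mul_le_mul_of_nonneg_right hC8 (mul_nonneg (by linarith) ?_))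
    exact Real.logb_nonneg one_lt_two h2
  · intro n d hn hd
    have hX : n + d ≤ (n + d) ^ 2 := Nat.le_self_pow (by norm_num) _
    refine ⟨16 * (n + d) ^ 2, by omega, ?_, fun j hj => ?_, mul_pow_le_mul_pow (by omega) hC⟩
    · have := Nat.log_le_self 2 d
      omega
    · have h1 := hprime n d hn hd j hj
      have h2 := logb_two_le (x := n + d) (k := n + d) (by omega) Nat.lt_two_pow_self.le
      have h3 : (primeFrom (d + 1) j : ℝ) ≤ 8 * (((n + d : ℕ) : ℝ) * ((n + d : ℕ) : ℝ)) :=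
        h1.trans (by gcongr)
      have h4 : primeFrom (d + 1) j ≤ 8 * ((n + d) * (n + d)) := by exact_mod_cast h3
      nlinarith

theorem exists_construction_polynomial_in_log_degree : ∃ (prog : Program) (C : ℕ),
    IsExplicitExtractorConstruction.{u} prog
      (fun n d => C * (n * d * Real.logb 2 (n + 1))) (fun n d => C * (n + Nat.log 2 d) ^ C) := by
  obtain ⟨C, hC⟩ : ∃ C : ℕ, 600 * 16 ^ 5 ≤ C := ⟨_, le_rfl⟩
  have hC16 : (16 : ℝ) ≤ C := by exact_mod_cast le_trans (by norm_num) hC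
  have hprime : ∀ n, 1 ≤ n → ∀ j < n,
      (primeFrom 2 j : ℝ) ≤ 16 * (n * Real.logb 2 (n + 1)) := by
    intro n hn j hj
    -- The constant 16 comes from `8 * (n + 1) ≤ 16 * n`.
    have h1 := primeFrom_le (q₀ := 2) (j := j) (N := n + 1) le_rfl (by omega)
    push_cast at h1
    have h2 : (1 : ℝ) ≤ n := by exact_mod_cast hn
    have h3 : 0 ≤ Real.logb 2 ((n : ℝ) + 1) := Real.logb_nonneg one_lt_two (by linarith)
    nlinarith
  refine ⟨extractorProgram (.const 3 2), C, isExplicitExtractorConstruction_extractorProgram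
    (q₀ := fun _ => 2) (fun d hd => le_rfl) (fun n m d N h2 hN => ?_) ?_ ?_⟩
  · exact Runs.mono (Runs.const (by simp) h2) (by omega)
  · intro n d hn hd j hj
    have h1 := hprime n hn j hj
    have h2 : (primePowerFrom 2 d j : ℝ) ≤ primeFrom 2 j * d := by
      exact_mod_cast primePowerFrom_le 2 j hd
    have h3 : 0 ≤ Real.logb 2 ((n : ℝ) + 1) := Real.logb_nonneg one_lt_two (by simp)
    calc (primePowerFrom 2 d j : ℝ) ≤ primeFrom 2 j * d := h2
      _ ≤ 16 * (n * Real.logb 2 (n + 1)) * d := by gcongr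
      _ = 16 * (n * d * Real.logb 2 (n + 1)) := by ring
      _ ≤ C * (n * d * Real.logb 2 (n + 1)) := by gcongr
  · intro n d hn hd
    have hX : n + Nat.log 2 d ≤ (n + Nat.log 2 d) ^ 2 := Nat.le_self_pow (by norm_num) _
    refine ⟨16 * (n + Nat.log 2 d) ^ 2, by omega, by omega, fun j hj => ?_,
      mul_pow_le_mul_pow (by omega) hC⟩
    have h1 := hprime n hn j hj
    have h2 := logb_two_le (x := n + 1) (k := n) (by omega) Nat.lt_two_pow_self
    push_cast at h2
    have h3 : (primeFrom 2 j : ℝ) ≤ 16 * ((n : ℝ) * n) := h1.trans (by gcongr)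
    have h4 : primeFrom 2 j ≤ 16 * (n * n) := by exact_mod_cast h3
    nlinarith [Nat.zero_le (n * Nat.log 2 d), Nat.zero_le (Nat.log 2 d * Nat.log 2 d)]

end Construction

end RankExtractor

end

/-! ### The main theorem -/

theorem mainTheorem3 :
    -- the construction from a `k`-regular matrix and pairwise coprime exponents
    (∀ (F : Type u) [Field F] [IsAlgClosed F] (n d m k : ℕ),
      1 ≤ n → 1 ≤ d → 1 ≤ m → m ≤ n → 1 ≤ k → k ≤ n →
      ∀ (M : Matrix (Fin m) (Fin n) F) (e : Fin n → ℕ),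
        RankExtractor.IsRegularMatrix k M →
        (∀ j, d < e j) → Pairwise (fun j j' => Nat.Coprime (e j) (e j')) →
        (∀ V : Set (Fin n → F), RankExtractor.IsAffineVariety V →
          RankExtractor.dim V ≤ (k : WithBot ℕ∞) → RankExtractor.degree V ≤ (d : ℕ∞) →
          ∀ b : Fin m → F,
            (RankExtractor.polyMap (RankExtractor.diagonalPolys M e) ⁻¹' {b} ∩ V).Finite) ∧
        RankExtractor.IsRankCondenser k d (RankExtractor.diagonalPolys M e) ∧
        (m = k → RankExtractor.IsRankExtractor d (RankExtractor.diagonalPolys M e))) ∧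
    -- degree `O((n + d) log (n + d))` in time `poly(n, d)`
    (∃ (prog : RankExtractor.Program) (C : ℕ),
      RankExtractor.IsExplicitExtractorConstruction.{u} prog
        (fun n d => C * ((n + d) * Real.logb 2 (n + d)))
        (fun n d => C * (n + d) ^ C)) ∧
    -- degree `O(n d log (n + 1))` in time `poly(n, log d)`
    (∃ (prog : RankExtractor.Program) (C : ℕ),
      RankExtractor.IsExplicitExtractorConstruction.{u} prog
        (fun n d => C * (n * d * Real.logb 2 (n + 1)))
        (fun n d => C * (n + Nat.log 2 d) ^ C)) := by
  refine ⟨fun F _ _ n d m k _ _ _ _ _ hkn M e hM hd he => ⟨fun V hV hdim hdeg b =>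
    (RankExtractor.isIntegralOn_of_degree_le hM hkn hd he hV hdim hdeg).finite_fiber b,
    RankExtractor.isRankCondenser_diagonalPolys hM hkn hd he, ?_⟩,
    RankExtractor.exists_construction_polynomial_in_degree,
    RankExtractor.exists_construction_polynomial_in_log_degree⟩
  rintro rfl
  exact RankExtractor.isRankCondenser_diagonalPolys hM hkn hd he
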